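/- Let $m\ge 2$ and $t\ge 0$ be integers. The random search tree for a set of $n$ (linearly ordered) keys is defined as follows. If $n=0$, it is empty; if $1\le n\le m-1$, it consists of a root that stores all the keys. If $n\ge m$ and $n\ge mt+m-1$, choose a uniformly random subset $y_1<\dots<y_{mt+m-1}$ of the keys and let the pivots be $y_{t+1},y_{2(t+1)},\dots,y_{(m-1)(t+1)}$; if $m\le n<mt+m-1$, choose $m-1$ pivots by an arbitrary fixed supplementary rule (possibly random, but depending only on the order of the keys). The pivots are stored in the root and split the remaining keys into $m$ intervals; the $m$ subtrees of the root are independent random search trees for these $m$ sets of keys. Let $X_{n,k}$ be the number of keys stored in nodes of depth $k$ in the tree with $n$ keys, and let $W_n(z)=\sum_{k\ge0}X_{n,k}z^k$. Let $$F(\theta)=\frac{t!}{m\,(mt+m-1)!}\,(\theta+t)(\theta+t+1)\cdots(\theta+mt+m-2),$$ let $\lambda_1(z)$ be a root of $F(\theta)=z$ with the largest real part, and let $D_1$ be the set of all $z\in\mathbb C$ such that $\Re\lambda_1(z)>1$ and $\Re\lambda_1(z)>\Re\lambda$ for all the other roots $\lambda$ of $F(\theta)=z$, counted with multiplicities. ($\lambda_1$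 is real-valued on $(0,\infty)$.) Let $$\alpha_0=\Bigl(\frac1{t+1}+\frac1{t+2}+\dots+\frac1{(t+1)m-1}\Bigr)^{-1}.$$ For every $\alpha>0$ there is a unique $\beta=\beta(\alpha)>0$ such that $\beta\lambda_1'(\beta)=\alpha$, and $\beta(\alpha)\in D_1$ if $\alpha>\alpha_0$. There is an analytic function $E$ on $D_1$, positive on $D_1\cap(0,\infty)$ and determined by $$\mathbb E W_n(z)=(E(z)+o(1))\,n^{\lambda_1(z)-1}\quad(n\to\infty),\qquad z\in D_1,$$ such that the following holds. For all $\alpha_0<\alpha_1<\alpha_2<\infty$, with $\alpha=\alpha_{n,k}=k/\log n$ and $\beta=\beta(\alpha_{n,k})$, $$\mathbb E X_{n,k}=\frac{E(\beta)\,n^{\lambda_1(\beta)-\alpha\log\beta-1}}{\sqrt{2\pi\,(\alpha+\beta^2\lambda_1''(\beta))\log n}}\,\bigl(1+O((\log n)^{-1/2})\bigr)$$ uniformly over all integers $n\ge2$, $k\ge0$ with $k/\log n\in[\alpha_1,\alpha_2]$; that is, the implied constant depends only on $m$, $t$, the supplementary rule, $\alpha_1$ and $\alpha_2$. -/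

import Mathlib

open Filter Topology MeasureTheory

noncomputable section

namespace SearchTree

/-! ### Trees and their profile -/

/-- `m`-ary search trees with keys in `ℕ`: a tree is empty, or it has a root that stores a finite set
of keys and has `m` (possibly empty) subtrees. -/
inductive KeyTree (m : ℕ) : Type
  | empty : KeyTree m
  | node (keys : Finset ℕ) (children : Fin m → KeyTree m) : KeyTree m

instance (m : ℕ) : MeasurableSpace (KeyTree m) := ⊤

/-- `T.profile k` is the number of keys that are stored in nodes of `T` with depth `k`. -/
def KeyTree.profile {m : ℕ} : KeyTree m → ℕ → ℕ
  | .empty, _ => 0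
  | .node keys _, 0 => keys.card
  | .node _ children, k + 1 => ∑ i, (children i).profile k

/-- The profile polynomial `W(z) = ∑ₖ Xₖ zᵏ` of a tree (only finitely many terms are nonzero). -/
def KeyTree.profilePoly {m : ℕ} (T : KeyTree m) (z : ℂ) : ℂ :=
  ∑' k : ℕ, (T.profile k : ℂ) * z ^ k

/-! ### The random search tree with parameters `m` and `t` -/

/-- The supplementary rule by which `m - 1` pivots are chosen from `n` keys if
`m ≤ n < m t + m - 1`. It may be random, but depends only on the order of the keys: it is a
probability distribution on the sets of `m - 1` ranks among the ranks `0, …, n - 1`. -/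
structure SupplementaryRule (m t : ℕ) where
  /-- the distribution of the set of ranks of the pivots -/
  ranks : ℕ → PMF (Finset ℕ)
  ranks_spec : ∀ n, m ≤ n → n < m * t + m - 1 → ∀ R ∈ (ranks n).support,
    R ⊆ Finset.range n ∧ R.card = m - 1

/-- The pivots in a sample `y₁ < y₂ < ⋯ < y_{mt+m-1}` are `y_{t+1}, y_{2(t+1)}, …, y_{(m-1)(t+1)}`,
i.e. the elements whose (one-based) rank in the sample is a multiple of `t + 1`. -/
def samplePivots (t : ℕ) (sample : Finset ℕ) : Finset ℕ :=
  sample.filter fun y => (t + 1) ∣ (sample.filter fun x => x ≤ y).card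

/-- The keys in `s` whose (zero-based) rank in `s` belongs to `R`. -/
def keysOfRanks (s R : Finset ℕ) : Finset ℕ :=
  s.filter fun x => (s.filter fun y => y < x).card ∈ R

/-- The distribution of the set of pivots chosen from the set `s` of keys, `m ≤ s.card`: they are
the pivots in a uniformly random subset of `s` with `m t + m - 1` elements if there is one, and are
given by the supplementary rule otherwise. -/
def pivotLaw {m t : ℕ} (rule : SupplementaryRule m t) (s : Finset ℕ) : PMF (Finset ℕ) :=
  if h : m * t + m - 1 ≤ s.card then
    (PMF.uniformOfFinset (s.powersetCard (m * t + m - 1))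
      (Finset.powersetCard_nonempty.2 h)).map (samplePivots t)
  else (rule.ranks s.card).map (keysOfRanks s)

/-- The pivots `x₁ < ⋯ < x_{m-1}` split the other keys into `m` subsets. The `i`-th one
(`i = 0, …, m - 1`) consists of the keys that are larger than exactly `i` pivots. -/
def part (s pivots : Finset ℕ) (i : ℕ) : Finset ℕ :=
  (s \ pivots).filter fun x => (pivots.filter fun p => p < x).card = i

/-- The joint distribution of independent random elements with distributions
`p 0, …, p (k - 1)`. -/
def independent {α : Type} : {k : ℕ} → (Fin k → PMF α) → PMF (Fin k → α)
  | 0, _ => PMF.pure Fin.elim0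
  | _ + 1, p => (p 0).bind fun a => (independent fun i => p i.succ).map (Fin.cons a)

theorem samplePivots_nonempty {m t : ℕ} (hm : 2 ≤ m) {T : Finset ℕ}
    (hT : T.card = m * t + m - 1) : (samplePivots t T).Nonempty := by
  have ht : t < T.card := by
    have : 2 * t ≤ m * t := Nat.mul_le_mul_right t hm
    omega
  refine ⟨T.orderEmbOfFin rfl ⟨t, ht⟩, Finset.mem_filter.2 ⟨T.orderEmbOfFin_mem rfl _, ?_⟩⟩
  have : (T.filter fun x => x ≤ T.orderEmbOfFin rfl ⟨t, ht⟩) =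
      (Finset.Iic (⟨t, ht⟩ : Fin T.card)).map (T.orderEmbOfFin rfl).toEmbedding := by
    ext x
    simp only [Finset.mem_filter, Finset.mem_map, Finset.mem_Iic]
    constructor
    · rintro ⟨hx, hle⟩
      have hx' : x ∈ Set.range (T.orderEmbOfFin rfl) := by
        rw [Finset.range_orderEmbOfFin]; exact hx
      obtain ⟨i, rfl⟩ := hx'
      exact ⟨i, (T.orderEmbOfFin rfl).le_iff_le.1 hle, rfl⟩
    · rintro ⟨i, hi, rfl⟩
      exact ⟨T.orderEmbOfFin_mem rfl _, (T.orderEmbOfFin rfl).le_iff_le.2 hi⟩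
  rw [this, Finset.card_map, Fin.card_Iic]

theorem keysOfRanks_nonempty {s R : Finset ℕ} (hR : R ⊆ Finset.range s.card) (h0 : R.Nonempty) :
    (keysOfRanks s R).Nonempty := by
  obtain ⟨r, hr⟩ := h0
  have hrs : r < s.card := Finset.mem_range.1 (hR hr)
  refine ⟨s.orderEmbOfFin rfl ⟨r, hrs⟩, Finset.mem_filter.2 ⟨s.orderEmbOfFin_mem rfl _, ?_⟩⟩
  have : (s.filter fun x => x < s.orderEmbOfFin rfl ⟨r, hrs⟩) =
      (Finset.Iio (⟨r, hrs⟩ : Fin s.card)).map (s.orderEmbOfFin rfl).toEmbedding := by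
    ext x
    simp only [Finset.mem_filter, Finset.mem_map, Finset.mem_Iio]
    constructor
    · rintro ⟨hx, hle⟩
      have hx' : x ∈ Set.range (s.orderEmbOfFin rfl) := by
        rw [Finset.range_orderEmbOfFin]; exact hx
      obtain ⟨i, rfl⟩ := hx'
      exact ⟨i, (s.orderEmbOfFin rfl).lt_iff_lt.1 hle, rfl⟩
    · rintro ⟨i, hi, rfl⟩
      exact ⟨s.orderEmbOfFin_mem rfl _, (s.orderEmbOfFin rfl).lt_iff_lt.2 hi⟩
  rw [this, Finset.card_map, Fin.card_Iio]
  exact hr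

/-- The pivots are keys, and there is at least one of them. -/
theorem pivotLaw_support {m t : ℕ} (hm : 2 ≤ m) (rule : SupplementaryRule m t) {s : Finset ℕ}
    (hs : m ≤ s.card) {P : Finset ℕ} (hP : P ∈ (pivotLaw rule s).support) :
    P ⊆ s ∧ P.Nonempty := by
  unfold pivotLaw at hP
  split_ifs at hP with h
  · rw [PMF.mem_support_map_iff] at hP
    obtain ⟨T, hT, rfl⟩ := hP
    rw [PMF.mem_support_uniformOfFinset_iff, Finset.mem_powersetCard] at hT
    exact ⟨(Finset.filter_subset _ _).trans hT.1, samplePivots_nonempty hm hT.2⟩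
  · rw [PMF.mem_support_map_iff] at hP
    obtain ⟨R, hR, rfl⟩ := hP
    obtain ⟨h1, h2⟩ := rule.ranks_spec _ hs (not_le.1 h) R hR
    exact ⟨Finset.filter_subset _ _,
      keysOfRanks_nonempty h1 (Finset.card_pos.1 (by omega))⟩

theorem card_part_lt {s P : Finset ℕ} (h : P ⊆ s) (h0 : P.Nonempty) (i : ℕ) :
    (part s P i).card < s.card := by
  refine Finset.card_lt_card ((Finset.filter_subset _ _).trans_ssubset ?_)
  exact Finset.sdiff_ssubset h h0

/-- The distribution of the random search tree for the set `s` of keys. If there are fewer than `m`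
keys, then they are all stored in the root (and the tree is empty if there is no key). Otherwise a
random set of pivots is stored in the root, and the subtrees of the root are independent random
search trees for the `m` sets into which the pivots split the other keys. -/
def randomTree {m t : ℕ} (hm : 2 ≤ m) (rule : SupplementaryRule m t) (s : Finset ℕ) :
    PMF (KeyTree m) :=
  if s = ∅ then PMF.pure .empty
  else if hs : s.card < m then PMF.pure (.node s fun _ => .empty)
  else (pivotLaw rule s).bindOnSupport fun P _ =>
    (independent fun i : Fin m => randomTree hm rule (part s P i)).map (KeyTree.node P)
termination_by s.card
decreasing_by
  rename_i hP
  obtain ⟨h1, h2⟩ := pivotLaw_support hm rule (not_lt.1 hs) hP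
  exact card_part_lt h1 h2 _

/-- `𝔼 X_{n,k}`, where `X_{n,k}` is the number of keys at depth `k` in the random search tree with
`n` keys (which may be taken as `0, …, n - 1`, since only their order matters). -/
def expProfile {m t : ℕ} (hm : 2 ≤ m) (rule : SupplementaryRule m t) (n k : ℕ) : ℝ :=
  ∫ T, (T.profile k : ℝ) ∂(randomTree hm rule (Finset.range n)).toMeasure

/-- `𝔼 W_n(z)`, where `W_n` is the profile polynomial of the random search tree with `n` keys. -/
def expProfilePoly {m t : ℕ} (hm : 2 ≤ m) (rule : SupplementaryRule m t) (n : ℕ) (z : ℂ) : ℂ :=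
  ∫ T, T.profilePoly z ∂(randomTree hm rule (Finset.range n)).toMeasure

/-! ### The dominant root `λ₁` and the functions derived from it -/

/-- `F(θ) = t! / (m (mt+m-1)!) · (θ+t)(θ+t+1)⋯(θ+mt+m-2)`. -/
def F (m t : ℕ) : Polynomial ℂ :=
  Polynomial.C ((t.factorial : ℂ) / (m * (m * t + m - 1).factorial)) *
    ∏ i ∈ Finset.Icc t (m * t + m - 2), (Polynomial.X + Polynomial.C (i : ℂ))

/-- `λ₁(z)`: a root of `F(θ) = z` with the largest real part. -/
def lambdaOne (m t : ℕ) (z : ℂ) : ℂ :=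
  Classical.epsilon fun θ => (F m t).eval θ = z ∧ ∀ θ', (F m t).eval θ' = z → θ'.re ≤ θ.re

/-- `D_s`: the set of all `z` such that `Re λ₁(z) > s` and `Re λ₁(z) > Re λ_j(z)` for all the other
roots `λ_j(z)` of `F(θ) = z`, counted with multiplicities. -/
def D (m t : ℕ) (s : ℝ) : Set ℂ :=
  {z | s < (lambdaOne m t z).re ∧
    ∀ θ ∈ (F m t - Polynomial.C z).roots.erase (lambdaOne m t z), θ.re < (lambdaOne m t z).re}

/-- `λ₁` as a real function (it takes real values on the positive half-line). -/
def lambdaReal (m t : ℕ) (x : ℝ) : ℝ := (lambdaOne m t (x : ℂ)).re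

/-- `α₀ = (1/(t+1) + 1/(t+2) + ⋯ + 1/((t+1)m-1))⁻¹`. -/
def alphaZero (m t : ℕ) : ℝ := (∑ j ∈ Finset.Icc (t + 1) ((t + 1) * m - 1), 1 / (j : ℝ))⁻¹

/-- `β` is a positive solution of `β λ₁'(β) = α`. -/
def IsBeta (m t : ℕ) (α β : ℝ) : Prop := 0 < β ∧ β * deriv (lambdaReal m t) β = α

/-- `β(α) > 0`, defined by `β(α) λ₁'(β(α)) = α`. -/
def beta (m t : ℕ) (α : ℝ) : ℝ := Classical.epsilon (IsBeta m t α)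

/-- `E` is the function in the first-order asymptotics of the expected profile polynomials:
`𝔼 W_n(z) = (E(z) + o(1)) n^{λ₁(z)-1}` for `z ∈ D₁`; it is analytic in `D₁`, and positive at the
positive reals in `D₁`. (The first property determines `E` in `D₁`.) -/
structure IsLeadingCoeff {m t : ℕ} (hm : 2 ≤ m) (rule : SupplementaryRule m t) (E : ℂ → ℂ) :
    Prop where
  tendsto : ∀ z ∈ D m t 1, Tendsto
    (fun n : ℕ => expProfilePoly hm rule n z / (n : ℂ) ^ (lambdaOne m t z - 1)) atTop (𝓝 (E z))
  analytic : AnalyticOnNhd ℂ E (D m t 1)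
  positive : ∀ x : ℝ, 0 < x → (x : ℂ) ∈ D m t 1 → (E x).im = 0 ∧ 0 < (E x).re

/-- The main term of the expected profile,
`E(β) n^{λ₁(β) - α log β - 1} / √(2π (α + β² λ₁''(β)) log n)` with `α = k / log n`, `β = β(α)`. -/
def mainTerm (m t : ℕ) (E : ℂ → ℂ) (n k : ℕ) : ℝ :=
  let α : ℝ := k / Real.log n
  let β : ℝ := beta m t α
  (E β).re * (n : ℝ) ^ (lambdaReal m t β - α * Real.log β - 1) /
    √(2 * Real.pi * (α + β ^ 2 * iteratedDeriv 2 (lambdaReal m t) β) * Real.log n)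

end SearchTree

end

/-! All `m` subtrees of the root have the same size distribution: of the samples of `mt+m-1` keys,
`C(j,t) C(n-1-j, mt+m-2-t)` give a fixed subtree exactly `j` keys (`sum_part_card`). Hence the means
of `W_n(z)` obey a linear convolution recursion (`expProfilePoly_rec`) with the constant toll `m-1`,
which disappears when `(m-1)/(zm-1)` is added. The `t`-th derivative `B` of the generating function
of these shifted means satisfies `B^(d) = c (1-x)^(-d) B` with `d = (m-1)(t+1)`. In terms of the
Euler operator `ϑ = (1-x) d/dx` this is `p(ϑ) B = 0`, where `p(s)` is proportional to `F(s-t) - z`.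

The asymptotics of the coefficients come from factoring `p`. Each factor `ϑ - r` is a first-order
recursion on coefficients, and roots with real part below `κ` preserve a bound of the order of the
coefficients of `(1-x)^(-κ)` (`first_order_bound`, `euler_product_bound`). If `λ₁` is simple and
dominant, `(ϑ - λ₁ - t) B` is annihilated by the other factors, so the shifted means `a_n` satisfy
`(n+1) a_{n+1} - (n+λ₁) a_n = O(n^(κ-1))` with `κ < Re λ₁`, and `a_n n^(1-λ₁)` converges at a rate
`n^(-δ)` (`mean_limit`). The constants depend only on bounds for the roots, their separation and the
initial values. The convergence is therefore locally uniform on `D₁` and the limit `E` is analytic.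
Positivity of `E` follows by comparing `B` with a multiple of `(1-x)^(-λ₁-t)`: the recursion has
nonnegative coefficients for positive `z` (`shiftedMean_lower`).

To the right of its zeros `|F|` grows with the real part and with the absolute imaginary part. So
`λ₁` is real, simple and dominant on `(0,∞)`, and `Re λ₁(z) < λ₁(|z|)` elsewhere
(`re_lt_of_norm_le`). With `S = F'/F = ∑ 1/(θ+t+i)` one has `β λ₁'(β) = 1/S(λ₁(β))`, which increases
from `0` to `∞` and equals `α₀` where `λ₁ = 1`. This settles existence and uniqueness of `β(α)` and
its membership in `D₁`.

The mean profile is a Cauchy integral of the mean of `W_n` over the circle `|z| = β`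
(`saddle_estimate`). The choice `β λ₁'(β) = k / log n` removes the linear term of the phase. Near
the positive axis a Gaussian integral with variance `α + β² λ₁''(β)` remains, and the rest of the
circle is smaller by a power of `n`. After normalisation the error is `O(1/log n)` against a main
term of order `(log n)^(-1/2)`, hence the relative error `O((log n)^(-1/2))`. -/

noncomputable section

namespace SearchTree

/-! ### Size distribution of the parts, by a generating function over all samples -/

/-- The number of elements of `T` below `x`. -/
def rankIn (T : Finset ℕ) (x : ℕ) : ℕ := (T.filter fun u => u < x).card

theorem rankIn_insert_of_le {T : Finset ℕ} {n x : ℕ} (hx : x ≤ n) :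
    rankIn (insert n T) x = rankIn T x := by
  unfold rankIn
  rw [Finset.filter_insert, if_neg (by omega)]

theorem rankIn_of_subset_range {T : Finset ℕ} {n : ℕ} (h : T ⊆ Finset.range n) :
    rankIn T n = T.card := by
  unfold rankIn
  rw [Finset.filter_true_of_mem]
  intro x hx
  exact Finset.mem_range.1 (h hx)

/-- The keys below `n` that are not pivots of the sample `T` and have exactly `i` pivots below
them. -/
def cell (t i n : ℕ) (T : Finset ℕ) : Finset ℕ :=
  (Finset.range n).filter fun x =>
    rankIn T x / (t + 1) = i ∧ ¬ (x ∈ T ∧ (t + 1) ∣ rankIn T x + 1)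

theorem card_filter_le_eq (T : Finset ℕ) {y : ℕ} (hy : y ∈ T) :
    (T.filter fun x => x ≤ y).card = rankIn T y + 1 := by
  unfold rankIn
  have : (T.filter fun x => x ≤ y) = insert y (T.filter fun x => x < y) := by
    ext x; simp only [Finset.mem_filter, Finset.mem_insert]
    constructor
    · rintro ⟨h1, h2⟩
      rcases h2.eq_or_lt with h | h
      · exact Or.inl h
      · exact Or.inr ⟨h1, h⟩
    · rintro (rfl | ⟨h1, h2⟩)
      · exact ⟨hy, le_rfl⟩
      · exact ⟨h1, h2.le⟩
  rw [this, Finset.card_insert_of_notMem (by simp)]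

theorem mem_samplePivots {t : ℕ} {T : Finset ℕ} {y : ℕ} :
    y ∈ samplePivots t T ↔ y ∈ T ∧ (t + 1) ∣ rankIn T y + 1 := by
  unfold samplePivots
  rw [Finset.mem_filter]
  constructor
  · rintro ⟨h1, h2⟩; rw [card_filter_le_eq T h1] at h2; exact ⟨h1, h2⟩
  · rintro ⟨h1, h2⟩; rw [card_filter_le_eq T h1]; exact ⟨h1, h2⟩

/-- Every `(t+1)`-st sampled key is a pivot, so each completed block of `t+1` sampled keys below `x`
contributes one. The induction on `x` is the successor rule for integer division. -/
theorem card_samplePivots_lt (t : ℕ) (T : Finset ℕ) (x : ℕ) :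
    ((samplePivots t T).filter fun p => p < x).card = rankIn T x / (t + 1) := by
  induction x with
  | zero => simp [rankIn]
  | succ x ih =>
    have key : ∀ S : Finset ℕ, (S.filter fun p => p < x + 1).card =
        (S.filter fun p => p < x).card + if x ∈ S then 1 else 0 := by
      intro S
      split_ifs with h
      · have : (S.filter fun p => p < x + 1) = insert x (S.filter fun p => p < x) := by
          ext y; simp only [Finset.mem_filter, Finset.mem_insert]
          constructor
          · rintro ⟨h1, h2⟩
            by_cases hxy : y = x
            · exact Or.inl hxy
            · exact Or.inr ⟨h1, by omega⟩
          · rintro (rfl | ⟨h1, h2⟩)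
            · exact ⟨h, by omega⟩
            · exact ⟨h1, by omega⟩
        rw [this, Finset.card_insert_of_notMem (by simp)]
      · rw [add_zero]
        congr 1
        ext y; simp only [Finset.mem_filter]
        constructor
        · rintro ⟨h1, h2⟩
          have : y ≠ x := fun h' => h (h' ▸ h1)
          exact ⟨h1, by omega⟩
        · rintro ⟨h1, h2⟩; exact ⟨h1, by omega⟩
    rw [key, ih]
    have h2 : rankIn T (x + 1) = rankIn T x + if x ∈ T then 1 else 0 := key T
    rw [h2, if_congr (mem_samplePivots (t := t) (T := T) (y := x)) rfl rfl]
    by_cases hx : x ∈ T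
    · simp only [hx, true_and, if_true]
      rw [Nat.succ_div]
    · simp [hx]

theorem part_samplePivots {t i n : ℕ} {T : Finset ℕ} :
    part (Finset.range n) (samplePivots t T) i = cell t i n T := by
  unfold part cell
  ext x
  simp only [Finset.mem_filter, Finset.mem_sdiff, mem_samplePivots, card_samplePivots_lt]
  tauto

theorem cell_card_succ (t i n : ℕ) (T : Finset ℕ) :
    (cell t i (n + 1) T).card = (cell t i n T).card +
      if rankIn T n / (t + 1) = i ∧ ¬ (n ∈ T ∧ (t + 1) ∣ rankIn T n + 1) then 1 else 0 := by
  unfold cell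
  rw [Finset.range_add_one, Finset.filter_insert]
  split_ifs with h
  · rw [Finset.card_insert_of_notMem (by simp)]
  · rfl

theorem cell_insert (t i n : ℕ) (T : Finset ℕ) :
    cell t i n (insert n T) = cell t i n T := by
  unfold cell
  refine Finset.filter_congr fun x hx => ?_
  have hx' := Finset.mem_range.1 hx
  rw [rankIn_insert_of_le hx'.le, Finset.mem_insert]
  simp [hx'.ne]

open Polynomial in
/-- The generating polynomial of the cell size over all samples of size `N` from `n` keys. -/
def cellPoly (t i n N : ℕ) : ℤ[X] :=
  ∑ T ∈ (Finset.range n).powersetCard N, X ^ (cell t i n T).card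

-- The factor contributed by a key outside the sample that has `r` sampled keys below it.
open Polynomial in
def keyWeight (t i r : ℕ) : ℤ[X] := if r / (t + 1) = i then X else 1

-- The factor contributed by a sampled key that has `r` sampled keys below it. It is `1` for pivots,
-- which belong to no cell.
open Polynomial in
def sampleWeight (t i r : ℕ) : ℤ[X] := if r / (t + 1) = i ∧ ¬ (t + 1) ∣ r + 1 then X else 1

theorem cellPoly_zero_right (t i n : ℕ) : cellPoly t i n 0 = keyWeight t i 0 ^ n := by
  unfold cellPoly
  rw [Finset.powersetCard_zero, Finset.sum_singleton]
  induction n with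
  | zero => simp [cell]
  | succ n ih =>
    rw [cell_card_succ, pow_add, ih, pow_succ]
    congr 1
    simp only [rankIn, keyWeight]
    by_cases h : 0 / (t + 1) = i <;> simp [h]

theorem cellPoly_zero_left (t i N : ℕ) : cellPoly t i 0 (N + 1) = 0 := by
  unfold cellPoly
  rw [Finset.powersetCard_eq_empty.2 (by simp)]; simp

/-- The two terms correspond to the largest key `n` being outside or inside the sample. Adding `n`
does not affect the membership of smaller keys in the cell. -/
theorem cellPoly_succ_succ (t i n N : ℕ) : cellPoly t i (n + 1) (N + 1) =
    keyWeight t i (N + 1) * cellPoly t i n (N + 1) + sampleWeight t i N * cellPoly t i n N := by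
  unfold cellPoly
  rw [Finset.range_add_one, Finset.powersetCard_succ_insert (by simp), Finset.sum_union,
    Finset.mul_sum, Finset.mul_sum]
  · congr 1
    · refine Finset.sum_congr rfl fun T hT => ?_
      rw [Finset.mem_powersetCard] at hT
      rw [cell_card_succ, pow_add, mul_comm, rankIn_of_subset_range hT.1, hT.2]
      congr 1
      have hn : n ∉ T := fun h => by simpa using hT.1 h
      simp only [hn, false_and, not_false_eq_true, and_true, keyWeight]
      split_ifs <;> simp
    · rw [Finset.sum_image]
      · refine Finset.sum_congr rfl fun T hT => ?_
        rw [Finset.mem_powersetCard] at hT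
        rw [cell_card_succ, pow_add, mul_comm, cell_insert, rankIn_insert_of_le le_rfl,
          rankIn_of_subset_range hT.1, hT.2]
        congr 1
        simp only [Finset.mem_insert_self, true_and, sampleWeight]
        split_ifs <;> simp
      · intro T hT T' hT' h
        rw [Finset.mem_coe, Finset.mem_powersetCard] at hT hT'
        have hn : n ∉ T := fun h => by simpa using hT.1 h
        have hn' : n ∉ T' := fun h => by simpa using hT'.1 h
        have h' : insert n T = insert n T' := h
        rw [← Finset.erase_insert hn, h', Finset.erase_insert hn']
  · rw [Finset.disjoint_left]
    intro T hT hT'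
    rw [Finset.mem_powersetCard] at hT
    obtain ⟨T', -, rfl⟩ := Finset.mem_image.1 hT'
    simpa using hT.1 (Finset.mem_insert_self n T')

open PowerSeries in
theorem cellSeries_zero (t i : ℕ) :
    (1 - C (keyWeight t i 0) * X) * mk (fun n => cellPoly t i n 0) = 1 := by
  ext n
  rw [sub_mul, one_mul, map_sub, coeff_mk, mul_assoc, coeff_C_mul]
  cases n with
  | zero => simp [cellPoly_zero_right]
  | succ n =>
    rw [coeff_succ_X_mul, coeff_mk, cellPoly_zero_right, cellPoly_zero_right, coeff_one]
    simp [pow_succ']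

open PowerSeries in
theorem cellSeries_succ (t i N : ℕ) :
    (1 - C (keyWeight t i (N + 1)) * X) * mk (fun n => cellPoly t i n (N + 1)) =
      C (sampleWeight t i N) * X * mk (fun n => cellPoly t i n N) := by
  ext n
  rw [sub_mul, one_mul, map_sub, coeff_mk, mul_assoc, coeff_C_mul, mul_assoc, coeff_C_mul]
  cases n with
  | zero => simp [cellPoly_zero_left]
  | succ n =>
    rw [coeff_succ_X_mul, coeff_mk, coeff_succ_X_mul, coeff_mk, cellPoly_succ_succ]
    ring_nf

-- A sample of `N` keys leaves `N+1` gaps. The gap above `l` sampled keys contributes a geometric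
-- series with ratio `keyWeight t i l * X`, and each sampled key contributes its weight times `X`.
open PowerSeries in
theorem cellSeries_prod (t i N : ℕ) :
    (∏ l ∈ Finset.range (N + 1), (1 - C (keyWeight t i l) * X)) * mk (fun n => cellPoly t i n N) =
      C (∏ l ∈ Finset.range N, sampleWeight t i l) * X ^ N := by
  induction N with
  | zero => simpa using cellSeries_zero t i
  | succ N ih =>
    rw [Finset.prod_range_succ _ (N + 1), mul_assoc, cellSeries_succ,
      Finset.prod_range_succ (sampleWeight t i) N, map_mul, mul_left_comm, ih]
    ring

theorem prod_range_mul_blocks {M : Type*} [CommMonoid M] (f : ℕ → M) (a m : ℕ) :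
    ∏ l ∈ Finset.range (m * a), f l = ∏ q ∈ Finset.range m, ∏ r ∈ Finset.range a, f (q * a + r) := by
  induction m with
  | zero => simp
  | succ m ih => rw [Nat.succ_mul, Finset.prod_range_add, ih, Finset.prod_range_succ]

theorem block_div {t q r : ℕ} (hr : r < t + 1) : (q * (t + 1) + r) / (t + 1) = q := by
  rw [add_comm, Nat.add_mul_div_right _ _ (Nat.succ_pos t), Nat.div_eq_of_lt hr, zero_add]

theorem prod_one_sub_keyWeight {t i m : ℕ} (hi : i < m) :
    ∏ l ∈ Finset.range (m * (t + 1)), (1 - PowerSeries.C (keyWeight t i l) * PowerSeries.X) =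
      (1 - PowerSeries.C Polynomial.X * PowerSeries.X) ^ (t + 1) *
        (1 - PowerSeries.X) ^ ((m - 1) * (t + 1)) := by
  rw [prod_range_mul_blocks]
  have h : ∀ q ∈ Finset.range m, ∏ r ∈ Finset.range (t + 1),
      (1 - PowerSeries.C (keyWeight t i (q * (t + 1) + r)) * PowerSeries.X) =
      if q = i then (1 - PowerSeries.C Polynomial.X * PowerSeries.X) ^ (t + 1) else
        (1 - PowerSeries.X) ^ (t + 1) := by
    intro q _
    have : ∀ r ∈ Finset.range (t + 1), (1 - PowerSeries.C (keyWeight t i (q * (t + 1) + r)) *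
        PowerSeries.X) = if q = i then (1 - PowerSeries.C Polynomial.X * PowerSeries.X) else
        (1 - PowerSeries.X) := by
      intro r hr
      unfold keyWeight
      rw [block_div (Finset.mem_range.1 hr)]
      split_ifs <;> simp
    rw [Finset.prod_congr rfl this, Finset.prod_const, Finset.card_range]
    split_ifs <;> rfl
  rw [Finset.prod_congr rfl h, ← Finset.mul_prod_erase _ _ (Finset.mem_range.2 hi), if_pos rfl]
  congr 1
  rw [Finset.prod_congr rfl (g := fun _ => (1 - PowerSeries.X) ^ (t + 1)), Finset.prod_const,
    Finset.card_erase_of_mem (Finset.mem_range.2 hi), Finset.card_range, ← pow_mul, mul_comm]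
  intro q hq
  rw [if_neg (Finset.ne_of_mem_erase hq)]

/-- Only block `i` contributes: it has `t` sampled keys that are not pivots. -/
theorem prod_sampleWeight {t i m : ℕ} (hi : i < m) :
    ∏ l ∈ Finset.range (m * (t + 1) - 1), sampleWeight t i l = Polynomial.X ^ t := by
  -- One factor is added to complete the last block. It sits at a pivot position and so equals `1`.
  have h1 : ∏ l ∈ Finset.range (m * (t + 1)), sampleWeight t i l = Polynomial.X ^ t := by
    rw [prod_range_mul_blocks, Finset.prod_eq_single_of_mem i (Finset.mem_range.2 hi)]
    · rw [Finset.prod_range_succ]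
      have : ∀ r ∈ Finset.range t, sampleWeight t i (i * (t + 1) + r) = Polynomial.X := by
        intro r hr
        have hr := Finset.mem_range.1 hr
        unfold sampleWeight
        rw [block_div (by omega), if_pos]
        refine ⟨rfl, fun h => ?_⟩
        rw [add_assoc, Nat.dvd_add_right (Dvd.intro_left i rfl)] at h
        exact absurd (Nat.le_of_dvd (by omega) h) (by omega)
      rw [Finset.prod_congr rfl this, Finset.prod_const, Finset.card_range]
      unfold sampleWeight
      rw [if_neg, mul_one]
      rintro ⟨-, h⟩
      exact h ⟨i + 1, by ring⟩
    · intro q _ hq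
      refine Finset.prod_eq_one fun r hr => ?_
      unfold sampleWeight
      rw [block_div (Finset.mem_range.1 hr), if_neg (fun h => hq h.1)]
  have hpos : 0 < m * (t + 1) := Nat.mul_pos (by omega) (Nat.succ_pos t)
  obtain ⟨N, hN⟩ : ∃ N, m * (t + 1) = N + 1 := ⟨m * (t + 1) - 1, by omega⟩
  rw [hN, Finset.prod_range_succ] at h1
  rw [hN, Nat.add_sub_cancel, ← h1]
  unfold sampleWeight
  rw [if_neg (c := N / (t + 1) = i ∧ _), mul_one]
  rintro ⟨-, h⟩
  exact h (hN ▸ Dvd.intro_left m rfl)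

theorem mk_choose_mul (a : ℕ) :
    (PowerSeries.mk fun n => ((a + n).choose a : Polynomial ℤ) * Polynomial.X ^ n) *
      (1 - PowerSeries.C Polynomial.X * PowerSeries.X) ^ (a + 1) = 1 := by
  have h := congrArg (PowerSeries.rescale (Polynomial.X : Polynomial ℤ))
    (PowerSeries.mk_add_choose_mul_one_sub_pow_eq_one (Polynomial ℤ) a)
  rw [map_mul, map_pow, map_sub, map_one, PowerSeries.rescale_X] at h
  have h2 : (PowerSeries.mk fun n => ((a + n).choose a : Polynomial ℤ) * Polynomial.X ^ n) =
      PowerSeries.rescale (Polynomial.X : Polynomial ℤ)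
        (PowerSeries.mk fun n => ((a + n).choose a : Polynomial ℤ)) := by
    refine PowerSeries.ext fun n => ?_
    rw [PowerSeries.coeff_rescale, PowerSeries.coeff_mk, PowerSeries.coeff_mk, mul_comm]
  rw [h2, h]

/-- With `Y` marking the cell size, the generating function is `Y^t X^N / ((1-YX)^(t+1)
(1-X)^(d+1))`, where `N = m(t+1)-1` and `d+1 = (m-1)(t+1)`. It does not depend on `i`, and its
coefficients are convolutions of two binomial series. -/
theorem cellPoly_eq {t i m n : ℕ} (hm : 2 ≤ m) (hi : i < m) :
    cellPoly t i n (m * t + m - 1) = ∑ j ∈ Finset.range n,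
      ((j.choose t * (n - 1 - j).choose (m * t + m - 1 - t - 1) : ℕ) : Polynomial ℤ) *
        Polynomial.X ^ j := by
  have hN : m * t + m - 1 = m * (t + 1) - 1 := by rw [mul_add, mul_one]
  have hpos : 2 * (t + 1) ≤ m * (t + 1) := Nat.mul_le_mul_right _ hm
  have h1 := cellSeries_prod t i (m * (t + 1) - 1)
  rw [Nat.sub_add_cancel (by omega), prod_one_sub_keyWeight hi, prod_sampleWeight hi] at h1
  obtain ⟨d, hd⟩ : ∃ d, (m - 1) * (t + 1) = d + 1 :=
    ⟨(m - 1) * (t + 1) - 1, by have : 0 < (m - 1) * (t + 1) := Nat.mul_pos (by omega) (Nat.succ_pos t); omega⟩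
  have hd' : m * (t + 1) = d + 1 + (t + 1) := by
    rw [← hd, ← Nat.succ_mul]; congr 1; omega
  have h2 := PowerSeries.mk_add_choose_mul_one_sub_pow_eq_one (Polynomial ℤ) d
  have h3 := mk_choose_mul t
  rw [hd] at h1
  have h4 : PowerSeries.mk (fun n => cellPoly t i n (m * (t + 1) - 1)) =
      PowerSeries.C (Polynomial.X ^ t) * (PowerSeries.X ^ (m * (t + 1) - 1) *
       ((PowerSeries.mk fun n => ((t + n).choose t : Polynomial ℤ) * Polynomial.X ^ n) *
        (PowerSeries.mk fun n => ((d + n).choose d : Polynomial ℤ)))) := by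
    calc _ = ((PowerSeries.mk fun n => ((t + n).choose t : Polynomial ℤ) * Polynomial.X ^ n) *
      (1 - PowerSeries.C Polynomial.X * PowerSeries.X) ^ (t + 1)) *
      ((PowerSeries.mk fun n => ((d + n).choose d : Polynomial ℤ)) * (1 - PowerSeries.X) ^ (d + 1))
        * PowerSeries.mk (fun n => cellPoly t i n (m * (t + 1) - 1)) := by
          rw [h2, h3, one_mul, one_mul]
      _ = ((PowerSeries.mk fun n => ((t + n).choose t : Polynomial ℤ) * Polynomial.X ^ n) *
          (PowerSeries.mk fun n => ((d + n).choose d : Polynomial ℤ))) *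
          ((1 - PowerSeries.C Polynomial.X * PowerSeries.X) ^ (t + 1) * (1 - PowerSeries.X) ^ (d + 1)
           * PowerSeries.mk (fun n => cellPoly t i n (m * (t + 1) - 1))) := by ring
      _ = _ := by rw [h1]; ring
  have h5 := congrArg (PowerSeries.coeff n) h4
  rw [PowerSeries.coeff_mk, PowerSeries.coeff_C_mul, PowerSeries.coeff_X_pow_mul'] at h5
  rw [hN, h5]
  split_ifs with hn
  · rw [PowerSeries.coeff_mul, Finset.Nat.sum_antidiagonal_eq_sum_range_succ_mk, Finset.mul_sum]
    simp only [PowerSeries.coeff_mk]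
    obtain ⟨r, hr⟩ : ∃ r, n = m * (t + 1) - 1 + r := ⟨n - (m * (t + 1) - 1), by omega⟩
    have e1 : n - (m * (t + 1) - 1) = r := by omega
    have e2 : n = t + (r + 1) + d := by omega
    have e3 : m * (t + 1) - 1 - t - 1 = d := by omega
    -- The terms with `j < t` and the last `d` terms contain a vanishing binomial coefficient. The
    -- `r+1` terms between them are the convolution, with `j = t + x`.
    rw [e1, e3, e2, Finset.sum_range_add _ (t + (r + 1)) d, Finset.sum_range_add _ t (r + 1)]
    rw [Finset.sum_eq_zero (s := Finset.range t), Finset.sum_eq_zero (s := Finset.range d), zero_add,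
      add_zero]
    · refine Finset.sum_congr rfl fun x hx => ?_
      have hx := Finset.mem_range.1 hx
      rw [show t + (r + 1) + d - 1 - (t + x) = d + (r - x) by omega]
      push_cast
      ring
    · intro x hx
      have hx := Finset.mem_range.1 hx
      rw [Nat.choose_eq_zero_of_lt (k := d) (by omega)]; simp
    · intro x hx
      have hx := Finset.mem_range.1 hx
      rw [Nat.choose_eq_zero_of_lt (k := t) (by omega)]; simp
  · rw [mul_zero]
    refine (Finset.sum_eq_zero fun j hj => ?_).symm
    have hj := Finset.mem_range.1 hj
    by_cases h : j < t
    · rw [Nat.choose_eq_zero_of_lt h]; simp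
    · rw [Nat.choose_eq_zero_of_lt (k := m * (t + 1) - 1 - t - 1) (by omega)]; simp

/-- The sizes of the parts have the same distribution for all of the `m` parts. -/
theorem sum_part_card {t i m n : ℕ} (hm : 2 ≤ m) (hi : i < m) (g : ℕ → ℝ) :
    ∑ T ∈ (Finset.range n).powersetCard (m * t + m - 1),
        g (part (Finset.range n) (samplePivots t T) i).card =
      ∑ j ∈ Finset.range n,
        ((j.choose t * (n - 1 - j).choose (m * t + m - 1 - t - 1) : ℕ) : ℝ) * g j := by
  simp only [part_samplePivots]
  have hc := cellPoly_eq (t := t) (n := n) hm hi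
  unfold cellPoly at hc
  have hlt : ∀ T ∈ (Finset.range n).powersetCard (m * t + m - 1),
      (cell t i n T).card ∈ Finset.range (n + 1) := by
    intro T _
    rw [Finset.mem_range]
    have := Finset.card_le_card (Finset.filter_subset (fun x =>
      rankIn T x / (t + 1) = i ∧ ¬ (x ∈ T ∧ (t + 1) ∣ rankIn T x + 1)) (Finset.range n))
    rw [Finset.card_range] at this
    exact Nat.lt_succ_of_le this
  have hcount : ∀ j, (((Finset.range n).powersetCard (m * t + m - 1)).filter
      fun T => (cell t i n T).card = j).card =
      if j < n then j.choose t * (n - 1 - j).choose (m * t + m - 1 - t - 1) else 0 := by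
    intro j
    have h := congrArg (fun p => Polynomial.coeff p j) hc
    simp only [Polynomial.finsetSum_coeff, Polynomial.coeff_X_pow, ← Polynomial.C_eq_natCast,
      Polynomial.coeff_C_mul] at h
    rw [Finset.card_filter]
    have h' : ∑ T ∈ (Finset.range n).powersetCard (m * t + m - 1),
      (if (cell t i n T).card = j then (1 : ℤ) else 0) =
      ∑ x ∈ Finset.range n, ((x.choose t * (n - 1 - x).choose (m * t + m - 1 - t - 1) : ℕ) : ℤ) *
        if j = x then 1 else 0 := by
      rw [← h]
      refine Finset.sum_congr rfl fun T _ => ?_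
      simp [eq_comm]
    simp only [mul_ite, mul_one, mul_zero, Finset.sum_ite_eq, Finset.mem_range] at h'
    exact_mod_cast h'
  rw [← Finset.sum_fiberwise_of_maps_to hlt, Finset.sum_range_succ]
  have hz : ∀ j, ∑ T ∈ ((Finset.range n).powersetCard (m * t + m - 1)).filter
      (fun T => (cell t i n T).card = j), g (cell t i n T).card =
      ((if j < n then j.choose t * (n - 1 - j).choose (m * t + m - 1 - t - 1) else 0 : ℕ) : ℝ) *
        g j := by
    intro j
    rw [← hcount j, Finset.sum_congr rfl (g := fun _ => g j), Finset.sum_const, nsmul_eq_mul]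
    intro T hT
    rw [(Finset.mem_filter.1 hT).2]
  rw [hz n, if_neg (lt_irrefl n), Nat.cast_zero, zero_mul, add_zero]
  refine Finset.sum_congr rfl fun j hj => ?_
  rw [hz j, if_pos (Finset.mem_range.1 hj)]

/-! ### Expectations under discrete distributions -/

open scoped ENNReal

/-- The expectation of a nonnegative function under a discrete distribution. -/
def expect {α : Type*} (p : PMF α) (f : α → ℝ≥0∞) : ℝ≥0∞ := ∑' a, p a * f a

section expect

variable {α β : Type*}

theorem expect_pure (a : α) (f : α → ℝ≥0∞) : expect (PMF.pure a) f = f a := by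
  unfold expect
  rw [tsum_eq_single a]
  · simp
  · intro b hb; simp [PMF.pure_apply, hb]

theorem expect_congr (p : PMF α) {f g : α → ℝ≥0∞} (h : ∀ a ∈ p.support, f a = g a) :
    expect p f = expect p g := by
  refine tsum_congr fun a => ?_
  by_cases ha : p a = 0
  · simp [ha]
  · rw [h a ((PMF.mem_support_iff _ _).2 ha)]

theorem expect_mono (p : PMF α) {f g : α → ℝ≥0∞} (h : ∀ a ∈ p.support, f a ≤ g a) :
    expect p f ≤ expect p g := by
  refine ENNReal.tsum_le_tsum fun a => ?_
  by_cases ha : p a = 0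
  · simp [ha]
  · exact mul_le_mul_right (h a ((PMF.mem_support_iff _ _).2 ha)) _

theorem expect_const (p : PMF α) (c : ℝ≥0∞) : expect p (fun _ => c) = c := by
  unfold expect
  rw [ENNReal.tsum_mul_right, p.tsum_coe, one_mul]

theorem expect_bind (p : PMF α) (q : α → PMF β) (f : β → ℝ≥0∞) :
    expect (p.bind q) f = expect p fun a => expect (q a) f := by
  unfold expect
  simp only [PMF.bind_apply, ← ENNReal.tsum_mul_right, ← ENNReal.tsum_mul_left]
  rw [ENNReal.tsum_comm]
  simp only [mul_assoc]

theorem expect_map (p : PMF α) (g : α → β) (f : β → ℝ≥0∞) :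
    expect (p.map g) f = expect p (f ∘ g) := by
  rw [← PMF.bind_pure_comp, expect_bind]
  simp only [Function.comp_def, expect_pure]

theorem expect_sum (p : PMF α) {ι : Type*} (s : Finset ι) (f : ι → α → ℝ≥0∞) :
    expect p (fun a => ∑ i ∈ s, f i a) = ∑ i ∈ s, expect p (f i) := by
  unfold expect
  simp only [Finset.mul_sum]
  exact Summable.tsum_finsetSum fun _ _ => ENNReal.summable

theorem expect_uniformOfFinset (s : Finset α) (hs : s.Nonempty) (f : α → ℝ≥0∞) :
    expect (PMF.uniformOfFinset s hs) f = (s.card : ℝ≥0∞)⁻¹ * ∑ a ∈ s, f a := by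
  unfold expect
  rw [tsum_eq_sum (s := s), Finset.mul_sum]
  · refine Finset.sum_congr rfl fun a ha => ?_
    rw [PMF.uniformOfFinset_apply_of_mem _ ha]
  · intro a ha
    rw [PMF.uniformOfFinset_apply_of_notMem _ ha, zero_mul]

theorem lintegral_toMeasure_eq_expect [MeasurableSpace α] (p : PMF α) {f : α → ℝ≥0∞}
    (hf : Measurable f) : ∫⁻ a, f a ∂p.toMeasure = expect p f := by
  have : p.toMeasure = Measure.sum fun a => p a • Measure.dirac a := by
    ext s hs
    rw [PMF.toMeasure_apply _ hs, Measure.sum_apply _ hs]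
    refine tsum_congr fun a => ?_
    rw [Measure.smul_apply, Measure.dirac_apply' _ hs]
    by_cases h : a ∈ s <;> simp [h]
  rw [this, lintegral_sum_measure]
  refine tsum_congr fun a => ?_
  rw [lintegral_smul_measure, lintegral_dirac' _ hf, smul_eq_mul]

end expect

/-- The mean profile is additive over the subtrees, so of the joint law only the marginals are
needed. -/
theorem independent_map_apply {α : Type} {k : ℕ} (p : Fin k → PMF α) (i : Fin k) :
    (independent p).map (fun f => f i) = p i := by
  induction k with
  | zero => exact i.elim0
  | succ k ih =>
    rw [independent, PMF.map_bind]
    simp only [PMF.map_comp]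
    refine Fin.cases ?_ (fun j => ?_) i
    · have : ∀ a : α, (fun f : Fin (k + 1) → α => f 0) ∘ Fin.cons (α := fun _ => α) a =
          Function.const _ a := by intro a; ext f; simp
      simp only [this, PMF.map_const, PMF.bind_pure]
    · have : ∀ a : α, (fun f : Fin (k + 1) → α => f j.succ) ∘ Fin.cons (α := fun _ => α) a =
          fun f => f j := by intro a; ext f; simp
      simp only [this, ih (fun i => p i.succ) j, PMF.bind_const]

theorem mem_support_of_mem_support_independent {α : Type} {k : ℕ} {p : Fin k → PMF α}
    {f : Fin k → α} (hf : f ∈ (independent p).support) (i : Fin k) : f i ∈ (p i).support := by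
  rw [← independent_map_apply p i, PMF.mem_support_map_iff]
  exact ⟨f, hf, rfl⟩

/-! ### The recursion for the mean profile -/

section tree

variable {m t : ℕ} (hm : 2 ≤ m) (rule : SupplementaryRule m t)

theorem randomTree_of_card_lt {s : Finset ℕ} (hs : s.card < m) (h0 : s ≠ ∅) :
    randomTree hm rule s = PMF.pure (.node s fun _ => .empty) := by
  rw [randomTree, if_neg h0, dif_pos hs]

theorem randomTree_empty : randomTree hm rule ∅ = PMF.pure .empty := by
  rw [randomTree, if_pos rfl]

theorem randomTree_of_le_card {s : Finset ℕ} (hs : m ≤ s.card) :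
    randomTree hm rule s = (pivotLaw rule s).bind fun P =>
      (independent fun i : Fin m => randomTree hm rule (part s P i)).map (KeyTree.node P) := by
  have h0 : s ≠ ∅ := by rintro rfl; simp at hs; omega
  rw [randomTree, if_neg h0, dif_neg (not_lt.2 hs), PMF.bindOnSupport_eq_bind]

/-- The expected profile, as an extended nonnegative number, for an arbitrary set of keys. -/
def meanProfile (s : Finset ℕ) (k : ℕ) : ℝ≥0∞ :=
  expect (randomTree hm rule s) fun T => (T.profile k : ℝ≥0∞)

theorem meanProfile_zero_of_le_card {s : Finset ℕ} (hs : m ≤ s.card) :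
    meanProfile hm rule s 0 = expect (pivotLaw rule s) fun P => (P.card : ℝ≥0∞) := by
  unfold meanProfile
  rw [randomTree_of_le_card hm rule hs, expect_bind]
  congr 1; ext P
  rw [expect_map]
  have : ((fun T : KeyTree m => (T.profile 0 : ℝ≥0∞)) ∘ KeyTree.node P) =
      fun _ => (P.card : ℝ≥0∞) := by
    ext f; simp [KeyTree.profile]
  rw [this, expect_const]

theorem meanProfile_succ_of_le_card {s : Finset ℕ} (hs : m ≤ s.card) (k : ℕ) :
    meanProfile hm rule s (k + 1) =
      expect (pivotLaw rule s) fun P => ∑ i : Fin m, meanProfile hm rule (part s P i) k := by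
  unfold meanProfile
  rw [randomTree_of_le_card hm rule hs, expect_bind]
  congr 1; ext P
  rw [expect_map]
  have : ((fun T : KeyTree m => (T.profile (k + 1) : ℝ≥0∞)) ∘ KeyTree.node P) =
      fun f => ∑ i, ((f i).profile k : ℝ≥0∞) := by
    ext f; simp [KeyTree.profile]
  rw [this, expect_sum]
  refine Finset.sum_congr rfl fun i _ => ?_
  conv_rhs => rw [← independent_map_apply (fun i : Fin m => randomTree hm rule (part s P i)) i]
  rw [expect_map]
  rfl

/-- Every level removes at least one key, the pivots, so no key is deeper than the number of keys
allows. The crude bound gives integrability, and the vanishing turns `W_n` into a polynomial of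
degree less than `n`. -/
theorem profile_le {s : Finset ℕ} {T : KeyTree m} (hT : T ∈ (randomTree hm rule s).support)
    (k : ℕ) : T.profile k ≤ m ^ k * s.card ∧ (s.card ≤ k → T.profile k = 0) := by
  induction hc : s.card using Nat.strong_induction_on generalizing s T k with
  | _ c ih =>
    subst hc
    by_cases h0 : s = ∅
    · subst h0
      rw [randomTree_empty, PMF.mem_support_pure_iff] at hT
      subst hT; simp [KeyTree.profile]
    · have hpos : 0 < s.card := Finset.card_pos.2 (Finset.nonempty_iff_ne_empty.2 h0)
      by_cases hs : s.card < m
      · rw [randomTree_of_card_lt hm rule hs h0, PMF.mem_support_pure_iff] at hT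
        subst hT
        cases k with
        | zero => simp [KeyTree.profile, h0]
        | succ k => simp [KeyTree.profile]
      · rw [not_lt] at hs
        rw [randomTree_of_le_card hm rule hs, PMF.mem_support_bind_iff] at hT
        obtain ⟨P, hP, hT⟩ := hT
        obtain ⟨f, hf, rfl⟩ := (PMF.mem_support_map_iff _ _ _).1 hT
        obtain ⟨h1, h2⟩ := pivotLaw_support hm rule hs hP
        cases k with
        | zero =>
          refine ⟨by simpa [KeyTree.profile] using Finset.card_le_card h1, fun h => by omega⟩
        | succ k =>
          have hi := fun i : Fin m => ih _ (card_part_lt h1 h2 i)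
            (mem_support_of_mem_support_independent hf i) k rfl
          constructor
          · calc _ = ∑ i, (f i).profile k := rfl
              _ ≤ ∑ _i : Fin m, m ^ k * s.card := Finset.sum_le_sum fun i _ =>
                  (hi i).1.trans (Nat.mul_le_mul_left _ (card_part_lt h1 h2 i).le)
              _ = _ := by simp; ring
          · intro h
            refine Finset.sum_eq_zero fun i _ => (hi i).2 ?_
            have := card_part_lt h1 h2 i
            omega

theorem meanProfile_ne_top (s : Finset ℕ) (k : ℕ) : meanProfile hm rule s k ≠ ∞ := by
  refine ne_top_of_le_ne_top (b := ((m ^ k * s.card : ℕ) : ℝ≥0∞)) (ENNReal.natCast_ne_top _) ?_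
  refine (expect_mono _ (g := fun _ => ((m ^ k * s.card : ℕ) : ℝ≥0∞)) ?_).trans
    (expect_const _ _).le
  intro T hT
  exact_mod_cast (profile_le hm rule hT k).1

theorem meanProfile_eq_zero {s : Finset ℕ} {k : ℕ} (h : s.card ≤ k) :
    meanProfile hm rule s k = 0 := by
  rw [← expect_const (randomTree hm rule s) 0]
  refine expect_congr _ fun T hT => ?_
  rw [(profile_le hm rule hT k).2 h, Nat.cast_zero]

/-! ### Invariance under order embeddings -/

section orderInvariance

variable (ψ : ℕ ↪o ℕ)

theorem samplePivots_map (t : ℕ) (T : Finset ℕ) :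
    samplePivots t (T.map ψ.toEmbedding) = (samplePivots t T).map ψ.toEmbedding := by
  unfold samplePivots
  rw [Finset.filter_map]
  congr 1
  refine Finset.filter_congr fun x _ => ?_
  simp only [Function.comp, Finset.filter_map, Finset.card_map]
  simp

theorem keysOfRanks_map (s R : Finset ℕ) :
    keysOfRanks (s.map ψ.toEmbedding) R = (keysOfRanks s R).map ψ.toEmbedding := by
  unfold keysOfRanks
  rw [Finset.filter_map]
  congr 1
  refine Finset.filter_congr fun x _ => ?_
  simp only [Function.comp, Finset.filter_map, Finset.card_map]
  simp

theorem part_map (s P : Finset ℕ) (i : ℕ) :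
    part (s.map ψ.toEmbedding) (P.map ψ.toEmbedding) i = (part s P i).map ψ.toEmbedding := by
  unfold part
  rw [← Finset.map_sdiff, Finset.filter_map]
  congr 1
  refine Finset.filter_congr fun x _ => ?_
  simp only [Function.comp, Finset.filter_map, Finset.card_map]
  simp

theorem expect_pivotLaw_map (s : Finset ℕ) (f : Finset ℕ → ℝ≥0∞) :
    expect (pivotLaw rule (s.map ψ.toEmbedding)) f =
      expect (pivotLaw rule s) fun P => f (P.map ψ.toEmbedding) := by
  unfold pivotLaw
  by_cases h : m * t + m - 1 ≤ s.card
  · rw [dif_pos (by rwa [Finset.card_map]), dif_pos h, expect_map, expect_map,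
      expect_uniformOfFinset, expect_uniformOfFinset, Finset.powersetCard_map, Finset.card_map,
      Finset.sum_map]
    simp only [Function.comp]
    congr 1
    refine Finset.sum_congr rfl fun T _ => ?_
    rw [← samplePivots_map]
    rfl
  · rw [dif_neg (by rwa [Finset.card_map]), dif_neg h, expect_map, expect_map, Finset.card_map]
    congr 1
    ext R
    simp only [Function.comp, keysOfRanks_map]

theorem meanProfile_map (s : Finset ℕ) (k : ℕ) :
    meanProfile hm rule (s.map ψ.toEmbedding) k = meanProfile hm rule s k := by
  induction hc : s.card using Nat.strong_induction_on generalizing s k with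
  | _ c ih =>
    subst hc
    by_cases h0 : s = ∅
    · subst h0; simp
    by_cases hs : s.card < m
    · unfold meanProfile
      rw [randomTree_of_card_lt hm rule hs h0, randomTree_of_card_lt hm rule
        (by rwa [Finset.card_map]) (by simpa using h0), expect_pure, expect_pure]
      cases k <;> simp [KeyTree.profile]
    · rw [not_lt] at hs
      cases k with
      | zero =>
        rw [meanProfile_zero_of_le_card hm rule hs,
          meanProfile_zero_of_le_card hm rule (by rwa [Finset.card_map]), expect_pivotLaw_map]
        simp
      | succ k =>
        rw [meanProfile_succ_of_le_card hm rule hs,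
          meanProfile_succ_of_le_card hm rule (by rwa [Finset.card_map]), expect_pivotLaw_map]
        refine expect_congr _ fun P hP => Finset.sum_congr rfl fun i _ => ?_
        obtain ⟨h1, h2⟩ := pivotLaw_support hm rule hs hP
        rw [part_map, ih _ (card_part_lt h1 h2 i) _ _ rfl]

end orderInvariance

theorem exists_map_range (s : Finset ℕ) :
    ∃ ψ : ℕ ↪o ℕ, (Finset.range s.card).map ψ.toEmbedding = s := by
  classical
  let b := s.sup id + 1
  have hb : ∀ x ∈ s, x < b := fun x hx => Nat.lt_succ_of_le (Finset.le_sup (f := id) hx)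
  let g : ℕ → ℕ := fun n => if h : n < s.card then s.orderEmbOfFin rfl ⟨n, h⟩ else b + n
  have hg : StrictMono g := by
    intro i j hij
    simp only [g]
    split_ifs with h1 h2
    · exact (s.orderEmbOfFin rfl).lt_iff_lt.2 hij
    · exact (hb _ (s.orderEmbOfFin_mem rfl _)).trans_le (by omega)
    · omega
    · omega
  refine ⟨OrderEmbedding.ofStrictMono g hg, ?_⟩
  refine Finset.eq_of_subset_of_card_le ?_ (by simp)
  intro x hx
  obtain ⟨i, hi, rfl⟩ := Finset.mem_map.1 hx
  have hi := Finset.mem_range.1 hi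
  have : (OrderEmbedding.ofStrictMono g hg).toEmbedding i = s.orderEmbOfFin rfl ⟨i, hi⟩ := by
    simp [g, hi]
  rw [this]
  exact s.orderEmbOfFin_mem rfl _

theorem meanProfile_eq_range (s : Finset ℕ) (k : ℕ) :
    meanProfile hm rule s k = meanProfile hm rule (Finset.range s.card) k := by
  obtain ⟨ψ, hψ⟩ := exists_map_range s
  rw [← meanProfile_map hm rule ψ (Finset.range s.card), hψ]

theorem expProfile_eq_toReal (n k : ℕ) :
    expProfile hm rule n k = (meanProfile hm rule (Finset.range n) k).toReal := by
  unfold expProfile meanProfile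
  rw [integral_eq_lintegral_of_nonneg_ae (ae_of_all _ fun _ => Nat.cast_nonneg _)
    (Measurable.aestronglyMeasurable measurable_from_top),
    lintegral_toMeasure_eq_expect _ measurable_from_top]
  simp

theorem expProfile_nonneg (n k : ℕ) : 0 ≤ expProfile hm rule n k := by
  rw [expProfile_eq_toReal]; exact ENNReal.toReal_nonneg

theorem expProfile_eq_zero {n k : ℕ} (h : n ≤ k) : expProfile hm rule n k = 0 := by
  rw [expProfile_eq_toReal, meanProfile_eq_zero hm rule (by simpa using h)]; rfl

theorem expProfile_zero_of_lt {n : ℕ} (hn : n < m) : expProfile hm rule n 0 = n := by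
  rw [expProfile_eq_toReal]
  unfold meanProfile
  rcases Nat.eq_zero_or_pos n with rfl | h
  · simp [randomTree_empty, expect_pure, KeyTree.profile]
  · rw [randomTree_of_card_lt hm rule (by simpa) (by simpa using h.ne'), expect_pure]
    simp [KeyTree.profile]

theorem expProfile_succ_of_lt {n : ℕ} (hn : n < m) (k : ℕ) : expProfile hm rule n (k + 1) = 0 := by
  rw [expProfile_eq_toReal]
  unfold meanProfile
  rcases Nat.eq_zero_or_pos n with rfl | h
  · simp [randomTree_empty, expect_pure, KeyTree.profile]
  · rw [randomTree_of_card_lt hm rule (by simpa) (by simpa using h.ne'), expect_pure]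
    simp [KeyTree.profile]

theorem card_samplePivots {t m : ℕ} (hm : 2 ≤ m) {T : Finset ℕ} (hT : T.card = m * t + m - 1) :
    (samplePivots t T).card = m - 1 := by
  have h := card_samplePivots_lt t T (T.sup id + 1)
  have hb : ∀ x ∈ T, x < T.sup id + 1 := fun x hx => Nat.lt_succ_of_le (Finset.le_sup (f := id) hx)
  rw [Finset.filter_true_of_mem (fun x hx => hb x (mem_samplePivots.1 hx).1)] at h
  rw [h]
  unfold rankIn
  rw [Finset.filter_true_of_mem hb, hT]
  obtain ⟨k, rfl⟩ : ∃ k, m = k + 1 := ⟨m - 1, by omega⟩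
  rw [show (k + 1) * t + (k + 1) - 1 = t + k * (t + 1) by
    have : (k + 1) * t + (k + 1) = t + k * (t + 1) + 1 := by ring
    omega]
  rw [Nat.add_mul_div_right _ _ (Nat.succ_pos t), Nat.div_eq_of_lt (Nat.lt_succ_self t)]
  simp

theorem pivotLaw_range {n : ℕ} (hn : m * t + m - 1 ≤ n) (f : Finset ℕ → ℝ≥0∞) :
    expect (pivotLaw rule (Finset.range n)) f = (n.choose (m * t + m - 1) : ℝ≥0∞)⁻¹ *
      ∑ T ∈ (Finset.range n).powersetCard (m * t + m - 1), f (samplePivots t T) := by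
  unfold pivotLaw
  rw [dif_pos (by rwa [Finset.card_range]), expect_map, expect_uniformOfFinset, Finset.card_powersetCard,
    Finset.card_range]
  rfl

theorem expProfile_zero {n : ℕ} (hn : m * t + m - 1 ≤ n) (hn' : m ≤ n) :
    expProfile hm rule n 0 = m - 1 := by
  have hc : ((n.choose (m * t + m - 1) : ℕ) : ℝ≥0∞) ≠ 0 := by
    exact_mod_cast (Nat.choose_pos hn).ne'
  rw [expProfile_eq_toReal, meanProfile_zero_of_le_card hm rule (by simpa), pivotLaw_range rule hn,
    Finset.sum_congr rfl (g := fun _ => ((m - 1 : ℕ) : ℝ≥0∞)), Finset.sum_const,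
    Finset.card_powersetCard, Finset.card_range, nsmul_eq_mul, ← mul_assoc,
    ENNReal.inv_mul_cancel hc (ENNReal.natCast_ne_top _), one_mul, ENNReal.toReal_natCast,
    Nat.cast_sub (by omega), Nat.cast_one]
  intro T hT
  rw [card_samplePivots hm (Finset.mem_powersetCard.1 hT).2]

/-- By order invariance (`meanProfile_eq_range`) a subtree enters only through its size. By
`sum_part_card` the size has the same distribution for all subtrees, hence the factor `m`. -/
theorem expProfile_succ {n : ℕ} (hn : m * t + m - 1 ≤ n) (hn' : m ≤ n) (k : ℕ) :
    (n.choose (m * t + m - 1) : ℝ) * expProfile hm rule n (k + 1) = m * ∑ j ∈ Finset.range n,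
      ((j.choose t * (n - 1 - j).choose (m * t + m - 1 - t - 1) : ℕ) : ℝ) *
        expProfile hm rule j k := by
  have hc : (n.choose (m * t + m - 1) : ℝ) ≠ 0 := by
    exact_mod_cast (Nat.choose_pos hn).ne'
  rw [expProfile_eq_toReal, meanProfile_succ_of_le_card hm rule (by simpa), pivotLaw_range rule hn]
  simp only [fun (P : Finset ℕ) (i : Fin m) =>
    meanProfile_eq_range hm rule (part (Finset.range n) P i) k]
  rw [ENNReal.toReal_mul, ENNReal.toReal_inv, ENNReal.toReal_natCast, ← mul_assoc,
    mul_inv_cancel₀ hc, one_mul, ENNReal.toReal_sum]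
  · have : ∀ T ∈ (Finset.range n).powersetCard (m * t + m - 1),
        (∑ i : Fin m, meanProfile hm rule
          (Finset.range (part (Finset.range n) (samplePivots t T) i).card) k).toReal =
        ∑ i : Fin m, expProfile hm rule (part (Finset.range n) (samplePivots t T) i).card k := by
      intro T _
      rw [ENNReal.toReal_sum fun _ _ => meanProfile_ne_top hm rule _ _]
      simp only [expProfile_eq_toReal]
    rw [Finset.sum_congr rfl this, Finset.sum_comm]
    rw [Finset.sum_congr rfl fun i _ => sum_part_card hm i.2 fun j => expProfile hm rule j k]
    simp
  · intro T _
    exact (ENNReal.sum_lt_top.2 fun i _ => (meanProfile_ne_top hm rule _ _).lt_top).ne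

theorem ae_mem_support {α : Type*} [MeasurableSpace α] (p : PMF α)
    (hp : MeasurableSet p.support) : ∀ᵐ a ∂p.toMeasure, a ∈ p.support := by
  rw [ae_iff]
  exact (PMF.toMeasure_apply_eq_zero_iff _ hp.compl).2 disjoint_compl_right

theorem expProfilePoly_eq_sum (n : ℕ) (z : ℂ) : expProfilePoly hm rule n z =
    ∑ k ∈ Finset.range n, (expProfile hm rule n k : ℂ) * z ^ k := by
  unfold expProfilePoly
  have hae := ae_mem_support (randomTree hm rule (Finset.range n)) trivial
  have h1 : ∀ᵐ T ∂(randomTree hm rule (Finset.range n)).toMeasure,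
      T.profilePoly z = ∑ k ∈ Finset.range n, (T.profile k : ℂ) * z ^ k := by
    filter_upwards [hae] with T hT
    unfold KeyTree.profilePoly
    refine tsum_eq_sum fun k hk => ?_
    rw [(profile_le hm rule hT k).2 (by simpa using hk)]
    simp
  rw [integral_congr_ae h1, integral_finsetSum]
  · refine Finset.sum_congr rfl fun k _ => ?_
    rw [integral_mul_const]
    congr 1
    unfold expProfile
    rw [← integral_complex_ofReal]
    simp
  · intro k _
    refine Integrable.mul_const ?_ _
    refine Integrable.of_bound (C := ((m ^ k * n : ℕ) : ℝ))
      (Measurable.aestronglyMeasurable measurable_from_top) ?_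
    filter_upwards [hae] with T hT
    have := (profile_le hm rule hT k).1
    rw [Finset.card_range] at this
    rw [Complex.norm_natCast]
    exact_mod_cast this

theorem expProfilePoly_eq_sum_of_le {n M : ℕ} (h : n ≤ M) (z : ℂ) : expProfilePoly hm rule n z =
    ∑ k ∈ Finset.range M, (expProfile hm rule n k : ℂ) * z ^ k := by
  rw [expProfilePoly_eq_sum]
  refine Finset.sum_subset (Finset.range_mono h) fun k _ hk => ?_
  rw [expProfile_eq_zero hm rule (by simpa using hk)]; simp

theorem expProfilePoly_zero (z : ℂ) : expProfilePoly hm rule 0 z = 0 := by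
  rw [expProfilePoly_eq_sum]; simp

theorem expProfilePoly_of_lt {n : ℕ} (hn : n < m) (z : ℂ) : expProfilePoly hm rule n z = n := by
  rw [expProfilePoly_eq_sum_of_le hm rule (Nat.le_succ n), Finset.sum_range_succ',
    expProfile_zero_of_lt hm rule hn]
  rw [Finset.sum_eq_zero fun k _ => by rw [expProfile_succ_of_lt hm rule hn]; simp]
  simp

/-- The recursion for the expected profile polynomials. -/
theorem expProfilePoly_rec {n : ℕ} (hn : m * t + m - 1 ≤ n) (z : ℂ) :
    (n.choose (m * t + m - 1) : ℂ) * expProfilePoly hm rule n z =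
      n.choose (m * t + m - 1) * (m - 1) + z * (m * ∑ j ∈ Finset.range n,
        ((j.choose t * (n - 1 - j).choose (m * t + m - 1 - t - 1) : ℕ) : ℂ) *
          expProfilePoly hm rule j z) := by
  rcases lt_or_ge n m with h | h
  -- A root that merely stores fewer than `m` keys is compatible with the sampling condition only
  -- for `t = 0` and `n = m-1`. There the convolution has the single term `j = 0`, which vanishes.
  · have ht : t = 0 := by
      by_contra h0
      have : m * 1 ≤ m * t := Nat.mul_le_mul_left _ (by omega)
      omega
    subst ht
    have hnm : n = m - 1 := by omega
    rw [expProfilePoly_of_lt hm rule h, Finset.sum_eq_zero, hnm, Nat.cast_sub (by omega)]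
    · simp
    · intro j hj
      have hj := Finset.mem_range.1 hj
      rcases Nat.eq_zero_or_pos j with rfl | hj0
      · rw [expProfilePoly_zero, mul_zero]
      · rw [Nat.choose_eq_zero_of_lt (n := n - 1 - j) (by omega)]; simp
  · rw [expProfilePoly_eq_sum_of_le hm rule (Nat.le_succ n), Finset.sum_range_succ',
      expProfile_zero hm rule hn h, pow_zero, mul_one, mul_add, add_comm, Finset.mul_sum]
    congr 1
    · push_cast; rfl
    · have : ∀ k ∈ Finset.range n, (n.choose (m * t + m - 1) : ℂ) *
          ((expProfile hm rule n (k + 1) : ℂ) * z ^ (k + 1)) =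
          z * (m * ∑ j ∈ Finset.range n,
          ((j.choose t * (n - 1 - j).choose (m * t + m - 1 - t - 1) : ℕ) : ℂ) *
            ((expProfile hm rule j k : ℂ) * z ^ k)) := by
        intro k _
        have := congrArg (fun x : ℝ => (x : ℂ)) (expProfile_succ hm rule hn h k)
        push_cast at this
        rw [← mul_assoc, this, pow_succ]
        simp only [← mul_assoc, ← Finset.sum_mul]
        push_cast
        ring
      rw [Finset.sum_congr rfl this, ← Finset.mul_sum, ← Finset.mul_sum, Finset.sum_comm]
      congr 2
      refine Finset.sum_congr rfl fun j hj => ?_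
      rw [← Finset.mul_sum, expProfilePoly_eq_sum_of_le hm rule (Finset.mem_range.1 hj).le]

theorem expProfilePoly_ofReal (n : ℕ) (x : ℝ) : expProfilePoly hm rule n x =
    ((∑ k ∈ Finset.range n, expProfile hm rule n k * x ^ k : ℝ) : ℂ) := by
  rw [expProfilePoly_eq_sum]; push_cast; rfl

theorem continuous_expProfilePoly (n : ℕ) : Continuous (expProfilePoly hm rule n) := by
  simp only [funext (expProfilePoly_eq_sum hm rule n)]
  fun_prop

theorem differentiable_expProfilePoly (n : ℕ) : Differentiable ℂ (expProfilePoly hm rule n) := by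
  simp only [funext (expProfilePoly_eq_sum hm rule n)]
  fun_prop

end tree

/-! ### The Euler operator and binomial convolution recursions -/

section euler

open PowerSeries

/-- The Euler operator `(1 - X) d/dX` on formal power series. -/
def eulerOp : Module.End ℂ ℂ⟦X⟧ :=
  LinearMap.mulLeft ℂ (1 - X : ℂ⟦X⟧) ∘ₗ (derivative ℂ).toLinearMap

theorem eulerOp_apply (f : ℂ⟦X⟧) : eulerOp f = (1 - X) * derivative ℂ f := rfl

theorem coeff_eulerOp (f : ℂ⟦X⟧) (n : ℕ) :
    coeff n (eulerOp f) = (n + 1) * coeff (n + 1) f - n * coeff n f := by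
  rw [eulerOp_apply, sub_mul, one_mul, map_sub, coeff_derivative]
  cases n with
  | zero => simp
  | succ n => rw [coeff_succ_X_mul, coeff_derivative]; push_cast; ring

theorem coeff_eulerOp_sub (s : ℂ) (f : ℂ⟦X⟧) (n : ℕ) :
    coeff n ((eulerOp - algebraMap ℂ _ s) f) = (n + 1) * coeff (n + 1) f - (n + s) * coeff n f := by
  rw [LinearMap.sub_apply, map_sub, coeff_eulerOp, Module.algebraMap_end_apply]
  simp
  ring

/-- Applying `eulerOp + d` to `(1-X)^d g` gives `(1-X)^(d+1) g'`: the summand `d` cancels the term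
in which `(1-X)^d` is differentiated. Iteration produces the rising factorial of `eulerOp`. -/
theorem one_sub_pow_mul_iterate_derivative (d : ℕ) (f : ℂ⟦X⟧) :
    (1 - X) ^ d * (derivative ℂ)^[d] f = Polynomial.aeval eulerOp (ascPochhammer ℂ d) f := by
  induction d with
  | zero => simp
  | succ d ih =>
    have h1 : ((1 : ℂ⟦X⟧) - X) * derivative ℂ ((1 - X) ^ d) = -(d : ℂ⟦X⟧) * (1 - X) ^ d := by
      cases d with
      | zero => simp
      | succ d =>
        rw [derivative_pow]
        simp
        ring
    rw [ascPochhammer_succ_right, mul_comm (ascPochhammer ℂ d), map_mul, Module.End.mul_apply, ← ih, map_add,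
      Polynomial.aeval_X, LinearMap.add_apply, eulerOp_apply, Derivation.leibniz, smul_eq_mul,
      smul_eq_mul, mul_add, Function.iterate_succ_apply', map_natCast]
    have h2 : ((d : Module.End ℂ ℂ⟦X⟧)) ((1 - X) ^ d * (derivative ℂ)^[d] f) =
        (d : ℂ⟦X⟧) * ((1 - X) ^ d * (derivative ℂ)^[d] f) := by
      simp
    rw [h2]
    linear_combination -((derivative ℂ)^[d] f) * h1

theorem coeff_iterate_derivative_mk (a : ℕ → ℂ) (n k : ℕ) :
    coeff n ((derivative ℂ)^[k] (mk a)) = k.factorial * (n + k).choose k * a (n + k) := by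
  rw [coeff_iterate_derivative, coeff_mk, Nat.ascFactorial_eq_factorial_mul_choose]
  push_cast
  ring

/-- A binomial convolution recursion is an Euler differential equation. -/
theorem euler_of_rec {a : ℕ → ℂ} {t d : ℕ} {c : ℂ} (hd : 0 < d)
    (h : ∀ n, t + d ≤ n → ((t + d).factorial * n.choose (t + d) : ℂ) * a n =
      c * ∑ j ∈ Finset.range n,
        t.factorial * ((j.choose t * (n - 1 - j).choose (d - 1) : ℕ) : ℂ) * a j) :
    (derivative ℂ)^[d] ((derivative ℂ)^[t] (mk a)) =
      C c * ((mk fun n => ((d - 1 + n).choose (d - 1) : ℂ)) * (derivative ℂ)^[t] (mk a)) := by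
  ext n
  rw [← Function.iterate_add_apply, add_comm d t, coeff_iterate_derivative_mk, h _ (by omega),
    coeff_C_mul, mul_comm (PowerSeries.mk _) ((derivative ℂ)^[t] _), coeff_mul,
    Finset.Nat.sum_antidiagonal_eq_sum_range_succ_mk]
  simp only [coeff_mk, coeff_iterate_derivative_mk]
  congr 1
  rw [show n + (t + d) = t + (n + 1) + (d - 1) by omega, Finset.sum_range_add _ (t + (n + 1)),
    Finset.sum_range_add _ t,
    Finset.sum_eq_zero (s := Finset.range t), Finset.sum_eq_zero (s := Finset.range (d - 1)),
    zero_add, add_zero]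
  · refine Finset.sum_congr rfl fun x hx => ?_
    have hx := Finset.mem_range.1 hx
    rw [add_comm x t,
      show t + (n + 1) + (d - 1) - 1 - (t + x) = d - 1 + (n - x) by omega]
    push_cast
    ring
  · intro x hx
    have hx := Finset.mem_range.1 hx
    rw [Nat.choose_eq_zero_of_lt (k := d - 1) (by omega)]; simp
  · intro x hx
    have hx := Finset.mem_range.1 hx
    rw [Nat.choose_eq_zero_of_lt (k := t) (by omega)]; simp

theorem one_sub_pow_mul_mk_choose {d : ℕ} (hd : 0 < d) :
    ((1 : ℂ⟦X⟧) - X) ^ d * (mk fun n => ((d - 1 + n).choose (d - 1) : ℂ)) = 1 := by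
  have := mk_add_choose_mul_one_sub_pow_eq_one ℂ (d - 1)
  rw [Nat.sub_add_cancel hd] at this
  rw [mul_comm, this]

theorem aeval_eulerOp_of_euler {B : ℂ⟦X⟧} {d : ℕ} {c : ℂ} (hd : 0 < d)
    (h : (derivative ℂ)^[d] B = C c * ((mk fun n => ((d - 1 + n).choose (d - 1) : ℂ)) * B)) :
    Polynomial.aeval eulerOp (ascPochhammer ℂ d - Polynomial.C c) B = 0 := by
  rw [map_sub, LinearMap.sub_apply, ← one_sub_pow_mul_iterate_derivative, h, mul_left_comm,
    ← mul_assoc (_ ^ d), one_sub_pow_mul_mk_choose hd, one_mul, Polynomial.aeval_C,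
    Module.algebraMap_end_apply, smul_eq_C_mul, sub_self]

theorem euler_of_aeval_eulerOp {B : ℂ⟦X⟧} {d : ℕ} {c : ℂ} (hd : 0 < d)
    (h : Polynomial.aeval eulerOp (ascPochhammer ℂ d - Polynomial.C c) B = 0) :
    (derivative ℂ)^[d] B = C c * ((mk fun n => ((d - 1 + n).choose (d - 1) : ℂ)) * B) := by
  rw [map_sub, LinearMap.sub_apply, ← one_sub_pow_mul_iterate_derivative, Polynomial.aeval_C,
    Module.algebraMap_end_apply, smul_eq_C_mul, sub_eq_zero] at h
  calc _ = (PowerSeries.mk fun n => ((d - 1 + n).choose (d - 1) : ℂ)) *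
      ((1 - X) ^ d * (derivative ℂ)^[d] B) := by
        rw [← mul_assoc, mul_comm (PowerSeries.mk _), one_sub_pow_mul_mk_choose hd, one_mul]
    _ = _ := by rw [h]; ring

end euler

/-! ### The Euler equation for the shifted means -/

theorem sum_choose_mul_choose {m t n : ℕ} (hm : 2 ≤ m) :
    ∑ j ∈ Finset.range n, ((j.choose t * (n - 1 - j).choose (m * t + m - 1 - t - 1) : ℕ) : ℂ) =
      n.choose (m * t + m - 1) := by
  have h := sum_part_card (t := t) (i := 0) (n := n) hm (by omega) fun _ => 1
  simp only [Finset.sum_const, Finset.card_powersetCard, Finset.card_range, nsmul_eq_mul,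
    mul_one] at h
  have := congrArg (fun x : ℝ => (x : ℂ)) h
  push_cast at this ⊢
  exact this.symm

section tree

variable {m t : ℕ} (hm : 2 ≤ m) (rule : SupplementaryRule m t)

/-- The expected profile polynomials, shifted by the constant that turns their recursion into a
homogeneous one. -/
def shiftedMean (z : ℂ) (n : ℕ) : ℂ := expProfilePoly hm rule n z + (m - 1) / (z * m - 1)

/-- The factor between `F(θ)` and the rising factorial of `θ + t`. -/
def scale (m t : ℕ) : ℂ := m * (m * t + m - 1).factorial / t.factorial

/-- The degree of `F`. -/
def deg (m t : ℕ) : ℕ := m * t + m - 1 - t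

include hm in
theorem deg_pos : 0 < deg m t := by
  unfold deg
  have : 2 * t ≤ m * t := Nat.mul_le_mul_right t hm
  omega

include hm in
theorem add_deg : t + deg m t = m * t + m - 1 := by
  unfold deg
  have : 2 * t ≤ m * t := Nat.mul_le_mul_right t hm
  omega

/-- The convolution weights add up to `C(n, mt+m-1)`, so a constant `γ` with `γ (zm-1) = m-1`
absorbs the toll `m-1`. -/
theorem shiftedMean_rec {z : ℂ} (hz : z * m ≠ 1) {n : ℕ} (hn : m * t + m - 1 ≤ n) :
    (n.choose (m * t + m - 1) : ℂ) * shiftedMean hm rule z n = z * (m * ∑ j ∈ Finset.range n,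
        ((j.choose t * (n - 1 - j).choose (m * t + m - 1 - t - 1) : ℕ) : ℂ) *
          shiftedMean hm rule z j) := by
  have hz' : z * m - 1 ≠ 0 := sub_ne_zero.2 hz
  unfold shiftedMean
  obtain ⟨γ, hγ⟩ : ∃ γ : ℂ, ((m : ℂ) - 1) / (z * m - 1) = γ := ⟨_, rfl⟩
  have h1 : (m : ℂ) - 1 = γ * (z * m - 1) := by rw [← hγ, div_mul_cancel₀ _ hz']
  rw [hγ]
  simp only [mul_add, Finset.sum_add_distrib]
  rw [← Finset.sum_mul, sum_choose_mul_choose hm, expProfilePoly_rec hm rule hn, h1]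
  ring

/-- The power series of the shifted means, differentiated `t` times. -/
def meanSeries (z : ℂ) : PowerSeries ℂ :=
  (PowerSeries.derivative ℂ)^[t] (PowerSeries.mk (shiftedMean hm rule z))

theorem coeff_meanSeries (z : ℂ) (n : ℕ) : PowerSeries.coeff n (meanSeries hm rule z) =
    t.factorial * (n + t).choose t * shiftedMean hm rule z (n + t) :=
  coeff_iterate_derivative_mk _ _ _

theorem meanSeries_euler {z : ℂ} (hz : z * m ≠ 1) :
    (PowerSeries.derivative ℂ)^[deg m t] (meanSeries hm rule z) =
      PowerSeries.C (z * scale m t) * ((PowerSeries.mk fun n =>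
        ((deg m t - 1 + n).choose (deg m t - 1) : ℂ)) * meanSeries hm rule z) := by
  refine euler_of_rec (deg_pos hm) fun n hn => ?_
  rw [add_deg hm] at hn ⊢
  rw [mul_assoc, shiftedMean_rec hm rule hz hn]
  have ht : (t.factorial : ℂ) ≠ 0 := by exact_mod_cast t.factorial_ne_zero
  simp only [mul_assoc (t.factorial : ℂ), ← Finset.mul_sum]
  rw [show deg m t - 1 = m * t + m - 1 - t - 1 from rfl]
  unfold scale
  field_simp

theorem meanSeries_aeval {z : ℂ} (hz : z * m ≠ 1) :
    Polynomial.aeval eulerOp (ascPochhammer ℂ (deg m t) - Polynomial.C (z * scale m t))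
      (meanSeries hm rule z) = 0 :=
  aeval_eulerOp_of_euler (deg_pos hm) (meanSeries_euler hm rule hz)

end tree

/-! ### Growth of solutions of Euler equations -/

/-- The coefficients of `(1 - x)^{-κ}`. -/
def binomCoeff (κ : ℝ) (n : ℕ) : ℝ := ∏ i ∈ Finset.range n, (κ + i) / (i + 1)

theorem binomCoeff_zero (κ : ℝ) : binomCoeff κ 0 = 1 := by simp [binomCoeff]

theorem binomCoeff_succ (κ : ℝ) (n : ℕ) :
    (n + 1) * binomCoeff κ (n + 1) = (n + κ) * binomCoeff κ n := by
  unfold binomCoeff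
  have : (n : ℝ) + 1 ≠ 0 := by positivity
  rw [Finset.prod_range_succ]
  field_simp
  ring

theorem binomCoeff_pos {κ : ℝ} (hκ : 0 < κ) (n : ℕ) : 0 < binomCoeff κ n :=
  Finset.prod_pos fun _ _ => by positivity

theorem binomCoeff_tendsto {κ : ℝ} (hκ : 0 < κ) :
    Tendsto (fun n : ℕ => binomCoeff κ n / ((n : ℝ) + 1) ^ (κ - 1)) atTop (𝓝 (Real.Gamma κ)⁻¹) := by
  have h1 := (Real.GammaSeq_tendsto_Gamma κ).inv₀ (Real.Gamma_pos_of_pos hκ).ne'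
  have h2 : Tendsto (fun n : ℕ => ((n : ℝ) / (n + 1)) ^ κ) atTop (𝓝 1) := by
    have := (tendsto_natCast_div_add_atTop (1 : ℝ)).rpow_const (p := κ) (Or.inl one_ne_zero)
    rwa [Real.one_rpow] at this
  have h4 : Tendsto (fun n : ℕ => ((n : ℝ) + 1) / ((n : ℝ) + κ)) atTop (𝓝 1) := by
    have h5 := (tendsto_natCast_div_add_atTop (1 : ℝ)).inv₀ one_ne_zero
    have h6 := tendsto_natCast_div_add_atTop κ
    have := h5.mul h6
    rw [inv_one, one_mul] at this
    refine this.congr' ?_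
    filter_upwards [eventually_gt_atTop 0] with n hn
    have : (n : ℝ) ≠ 0 := by positivity
    field_simp
  have h3 := (h2.mul h1).mul h4
  rw [one_mul, mul_one] at h3
  refine h3.congr' ?_
  filter_upwards [eventually_gt_atTop 0] with n hn
  have hn' : (0 : ℝ) < n := by exact_mod_cast hn
  unfold Real.GammaSeq
  have hprod : ∏ j ∈ Finset.range (n + 1), (κ + j) = binomCoeff κ n * n.factorial * (n + κ) := by
    rw [Finset.prod_range_succ, add_comm κ n]
    congr 1
    unfold binomCoeff
    rw [Finset.prod_div_distrib, ← Finset.prod_range_add_one_eq_factorial]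
    push_cast
    have : ∏ x ∈ Finset.range n, ((x : ℝ) + 1) ≠ 0 :=
      Finset.prod_ne_zero_iff.2 fun x _ => by positivity
    field_simp
  rw [hprod, Real.div_rpow hn'.le (by positivity), Real.rpow_sub_one (by positivity)]
  have h7 : (0 : ℝ) < (n : ℝ) ^ κ := Real.rpow_pos_of_pos hn' κ
  have h8 : (0 : ℝ) < ((n : ℝ) + 1) ^ κ := Real.rpow_pos_of_pos (by positivity) κ
  have h9 : (n.factorial : ℝ) ≠ 0 := by positivity
  have h10 : (n : ℝ) + κ ≠ 0 := by positivity
  field_simp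

theorem binomCoeff_le {κ : ℝ} (hκ : 0 < κ) :
    ∃ C, 0 ≤ C ∧ ∀ n : ℕ, binomCoeff κ n ≤ C * ((n : ℝ) + 1) ^ (κ - 1) := by
  obtain ⟨C, hC⟩ := (binomCoeff_tendsto hκ).bddAbove_range
  have h : ∀ n : ℕ, binomCoeff κ n / ((n : ℝ) + 1) ^ (κ - 1) ≤ C := fun n => hC ⟨n, rfl⟩
  refine ⟨C, le_trans ?_ (h 0), fun n => ?_⟩
  · rw [binomCoeff_zero]; positivity
  · have := h n
    rwa [div_le_iff₀ (Real.rpow_pos_of_pos (by positivity) _)] at this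

/-- Since `|x+r|² = x² + 2x Re r + |r|²` and `|r|² ≤ δx`, half of the margin `δ` pays for the
imaginary part and half is kept. -/
theorem norm_add_le_of_large {κ δ R : ℝ} (hκ : 0 < κ) {r : ℂ} (hR : ‖r‖ ≤ R)
    (hr : r.re ≤ κ - δ) {x : ℝ} (hx : 0 < x) (h1 : δ ≤ x) (h2 : R ^ 2 ≤ δ * x) :
    ‖(x : ℂ) + r‖ ≤ x + κ - δ / 2 := by
  have h0 : 0 ≤ x + κ - δ / 2 := by linarith
  refine abs_le_of_sq_le_sq' ?_ h0 |>.2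
  have hsq : ‖(x : ℂ) + r‖ ^ 2 = x ^ 2 + 2 * x * r.re + ‖r‖ ^ 2 := by
    rw [Complex.sq_norm, Complex.sq_norm, Complex.normSq_apply, Complex.normSq_apply]
    simp
    ring
  have hr2 : ‖r‖ ^ 2 ≤ R ^ 2 := by gcongr
  rw [hsq]
  nlinarith [mul_le_mul_of_nonneg_left hr hx.le, sq_nonneg (κ - δ / 2)]

/-- Stability of a first-order recursion: the solution is of the order of the inhomogeneity. -/
theorem first_order_bound {κ δ : ℝ} (R : ℝ) (hκ : 0 < κ) (hδ : 0 < δ) :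
    ∃ C, 0 ≤ C ∧ ∀ r : ℂ, ‖r‖ ≤ R → r.re ≤ κ - δ → ∀ b c : ℕ → ℂ,
      (∀ n, (n + 1) * b (n + 1) = (n + r) * b n + c n) → ∀ M, 0 ≤ M → ‖b 0‖ ≤ M →
      (∀ n, ‖c n‖ ≤ M * binomCoeff κ n) → ∀ n, ‖b n‖ ≤ C * M * binomCoeff κ n := by
  have hstep : ∀ (b c : ℕ → ℂ) (r : ℂ) (n : ℕ),
      (n + 1) * b (n + 1) = (n + r) * b n + c n →
      (n + 1) * ‖b (n + 1)‖ ≤ ‖(n : ℂ) + r‖ * ‖b n‖ + ‖c n‖ := by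
    intro b c r n h
    have := congrArg norm h
    rw [norm_mul] at this
    have h1 : ‖(n : ℂ) + 1‖ = n + 1 := by
      rw [← Nat.cast_succ, Complex.norm_natCast]; push_cast; rfl
    rw [h1] at this
    rw [this]
    exact (norm_add_le _ _).trans (by rw [norm_mul])
  -- On an initial stretch of indices the crude estimate `|n+r| ≤ n + |R|` suffices. Its constant
  -- depends on the length of the stretch but not on `r`.
  have hfin : ∀ N : ℕ, ∃ C, 0 ≤ C ∧ ∀ r : ℂ, ‖r‖ ≤ R → ∀ b c : ℕ → ℂ,
      (∀ n, (n + 1) * b (n + 1) = (n + r) * b n + c n) → ∀ M, 0 ≤ M → ‖b 0‖ ≤ M →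
      (∀ n, ‖c n‖ ≤ M * binomCoeff κ n) → ∀ n ≤ N, ‖b n‖ ≤ C * M * binomCoeff κ n := by
    intro N
    induction N with
    | zero =>
      refine ⟨1, zero_le_one, fun r _ b c _ M _ h0 _ n hn => ?_⟩
      obtain rfl : n = 0 := by omega
      simpa [binomCoeff_zero] using h0
    | succ N ih =>
      obtain ⟨C, hC0, hC⟩ := ih
      refine ⟨max C ((((N : ℝ) + |R|) * C + 1) / (N + κ)), le_max_of_le_left hC0,
        fun r hr b c hrec M hM h0 hc n hn => ?_⟩
      have hu := binomCoeff_pos hκ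
      rcases Nat.lt_or_ge N n with hNn | hNn
      · obtain rfl : n = N + 1 := by omega
        have h1 := hC r hr b c hrec M hM h0 hc N le_rfl
        have h2 := hstep b c r N (hrec N)
        have h3 : ‖(N : ℂ) + r‖ ≤ N + |R| := by
          refine (norm_add_le _ _).trans ?_
          rw [Complex.norm_natCast]
          have := hr.trans (le_abs_self R)
          linarith
        have h4 : ((N : ℝ) + 1) * ‖b (N + 1)‖ ≤
            (((N : ℝ) + |R|) * C + 1) / (N + κ) * M * ((N + κ) * binomCoeff κ N) := by
          have hN : (0 : ℝ) < N + κ := by positivity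
          have : (((N : ℝ) + |R|) * C + 1) / (N + κ) * M * ((N + κ) * binomCoeff κ N) =
              (N + |R|) * (C * M * binomCoeff κ N) + M * binomCoeff κ N := by
            field_simp
          rw [this]
          refine h2.trans (add_le_add ?_ (hc N))
          exact mul_le_mul h3 h1 (norm_nonneg _) (by positivity)
        have h5 : ‖b (N + 1)‖ ≤
            (((N : ℝ) + |R|) * C + 1) / (N + κ) * M * binomCoeff κ (N + 1) := by
          rw [add_comm (N : ℝ) κ, add_comm κ, ← binomCoeff_succ] at h4
          have hN : (0 : ℝ) < (N : ℝ) + 1 := by positivity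
          nlinarith
        refine h5.trans ?_
        gcongr
        · exact (hu _).le
        · exact le_max_right _ _
      · refine (hC r hr b c hrec M hM h0 hc n hNn).trans ?_
        gcongr
        · exact (hu _).le
        · exact le_max_left _ _
  -- From `N` on, `|n+r| ≤ n+κ-δ/2`, whereas `binomCoeff κ` grows with the factor `n+κ`. The surplus
  -- `δ/2` absorbs the inhomogeneity as soon as the constant is at least `2/δ`.
  obtain ⟨N, hN⟩ := exists_nat_ge (max (max δ 1) (R ^ 2 / δ))
  obtain ⟨C, hC0, hC⟩ := hfin N
  refine ⟨max C (2 / δ), le_max_of_le_left hC0, fun r hR hr b c hrec M hM h0 hc n => ?_⟩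
  have hu := binomCoeff_pos hκ
  rcases Nat.lt_or_ge n N with hn | hn
  · refine (hC r hR b c hrec M hM h0 hc n hn.le).trans ?_
    gcongr
    · exact (hu _).le
    · exact le_max_left _ _
  · induction n, hn using Nat.le_induction with
    | base =>
      refine (hC r hR b c hrec M hM h0 hc N le_rfl).trans ?_
      gcongr
      · exact (hu _).le
      · exact le_max_left _ _
    | succ n hn ih =>
      set A := max C (2 / δ) with hA
      have hn' : max (max δ 1) (R ^ 2 / δ) ≤ (n : ℝ) := hN.trans (by exact_mod_cast hn)
      have hn1 : δ ≤ n := (le_max_left _ _).trans ((le_max_left _ _).trans hn')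
      have hn2 : R ^ 2 ≤ δ * n := by
        have := (le_max_right _ _).trans hn'
        rwa [div_le_iff₀' hδ] at this
      have h3 := norm_add_le_of_large hκ hR hr (hδ.trans_le hn1) hn1 hn2
      have h2 := hstep b c r n (hrec n)
      have hA2 : 2 ≤ A * δ := by
        have : 2 / δ ≤ A := le_max_right _ _
        rwa [div_le_iff₀ hδ] at this
      have hA0 : 0 ≤ A := le_max_of_le_left hC0
      have h4 : ((n : ℝ) + 1) * ‖b (n + 1)‖ ≤ A * M * ((n + κ) * binomCoeff κ n) := by
        refine h2.trans ?_
        have h5 : ‖(n : ℂ) + r‖ * ‖b n‖ ≤ (n + κ - δ / 2) * (A * M * binomCoeff κ n) :=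
          mul_le_mul (by exact_mod_cast h3) ih (norm_nonneg _) (by linarith)
        have h6 := hc n
        have h7 : 0 ≤ M * binomCoeff κ n := mul_nonneg hM (hu n).le
        nlinarith [mul_le_mul_of_nonneg_right hA2 h7]
      rw [← binomCoeff_succ] at h4
      have hN : (0 : ℝ) < (n : ℝ) + 1 := by positivity
      nlinarith

/-- Induction on the number of factors: `(eulerOp - r) f` is annihilated by the remaining ones and
hence bounded, and the coefficients of `f` solve a first-order recursion with this inhomogeneity.
The factor `2k+1+R` bounds the initial coefficients of `(eulerOp - r) f` by those of `f`. -/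
theorem euler_product_bound {κ δ R : ℝ} (hκ : 0 < κ) (hδ : 0 < δ) (hR : 0 ≤ R) (k : ℕ) :
    ∃ C, 0 ≤ C ∧ ∀ S : Multiset ℂ, S.card = k → (∀ r ∈ S, ‖r‖ ≤ R ∧ r.re ≤ κ - δ) →
      ∀ f : PowerSeries ℂ,
        Polynomial.aeval eulerOp (S.map fun r => Polynomial.X - Polynomial.C r).prod f = 0 →
      ∀ M, 0 ≤ M → (∀ n < k, ‖PowerSeries.coeff n f‖ ≤ M) →
      ∀ n, ‖PowerSeries.coeff n f‖ ≤ C * M * binomCoeff κ n := by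
  induction k with
  | zero =>
    refine ⟨0, le_rfl, fun S hS _ f hf M _ _ n => ?_⟩
    rw [Multiset.card_eq_zero] at hS
    subst hS
    have : f = 0 := by simpa using hf
    simp [this]
  | succ k ih =>
    obtain ⟨C₁, hC₁, h₁⟩ := ih
    obtain ⟨C₂, hC₂, h₂⟩ := first_order_bound R hκ hδ
    refine ⟨C₂ * (1 + C₁ * (2 * k + 1 + R)), by positivity, fun S hS hSr f hf M hM h0 n => ?_⟩
    obtain ⟨r, S', rfl⟩ : ∃ r S', S = r ::ₘ S' := by
      obtain ⟨r, hr⟩ := Multiset.card_pos_iff_exists_mem.1 (by omega : 0 < S.card)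
      exact ⟨r, S.erase r, (Multiset.cons_erase hr).symm⟩
    rw [Multiset.map_cons, Multiset.prod_cons, mul_comm, map_mul, Module.End.mul_apply, map_sub,
      Polynomial.aeval_X, Polynomial.aeval_C] at hf
    obtain ⟨hr1, hr2⟩ := hSr r (Multiset.mem_cons_self _ _)
    have hg : ∀ n < k, ‖PowerSeries.coeff n ((eulerOp - algebraMap ℂ _ r) f)‖ ≤
        (2 * k + 1 + R) * M := by
      intro n hn
      rw [coeff_eulerOp_sub]
      have e1 := h0 n (by omega)
      have e2 := h0 (n + 1) (by omega)
      have hnk : (n : ℝ) ≤ k := by exact_mod_cast hn.le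
      have e3 : ‖(n : ℂ) + 1‖ = n + 1 := by
        rw [← Nat.cast_succ, Complex.norm_natCast]; push_cast; rfl
      have e4 : ‖(n : ℂ) + r‖ ≤ n + R := by
        refine (norm_add_le _ _).trans ?_
        rw [Complex.norm_natCast]; linarith
      calc _ ≤ ‖((n : ℂ) + 1) * PowerSeries.coeff (n + 1) f‖ +
            ‖((n : ℂ) + r) * PowerSeries.coeff n f‖ := norm_sub_le _ _
        _ ≤ (n + 1) * M + (n + R) * M := by
          rw [norm_mul, norm_mul, e3]
          gcongr
        _ ≤ _ := by nlinarith
    have hg2 := h₁ S' (by simpa using hS) (fun r hr => hSr r (Multiset.mem_cons_of_mem hr)) _ hf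
      ((2 * k + 1 + R) * M) (by positivity) hg
    have hM' : 0 ≤ C₁ * (2 * k + 1 + R) * M := by positivity
    refine (h₂ r hr1 hr2 (fun n => PowerSeries.coeff n f) _ (fun n => ?_)
      ((1 + C₁ * (2 * k + 1 + R)) * M) (by positivity) ?_ (fun n => (hg2 n).trans ?_) n).trans
        (le_of_eq (by ring))
    · rw [coeff_eulerOp_sub]; ring
    · have := h0 0 (by omega)
      nlinarith
    · have := (binomCoeff_pos hκ n).le
      have : 0 ≤ M * binomCoeff κ n := by positivity
      nlinarith

/-! ### First-order recursions with a dominant root -/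

/-- The product is `(1+λ/n)(1+1/n)^(-λ)`, whose first-order terms cancel. It is the multiplier of
the recursion after division by `n^(λ-1)`. -/
theorem norm_ratio_sub_one_le {R : ℝ} (hR : 0 ≤ R) :
    ∃ C, 0 ≤ C ∧ ∀ (lam : ℂ) (n : ℕ), ‖lam‖ ≤ R → 1 ≤ n →
      ‖((n : ℂ) + lam) * ((n : ℂ) + 1) ^ (-lam) * (n : ℂ) ^ (lam - 1) - 1‖ ≤ C / (n : ℝ) ^ 2 := by
  refine ⟨R ^ 2 + (1 + R) * (R ^ 2 * Real.exp R) + R, by positivity, fun lam n hlam hn => ?_⟩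
  have hn0 : (0 : ℝ) < n := by exact_mod_cast hn
  have hnC : (n : ℂ) ≠ 0 := by exact_mod_cast hn0.ne'
  set ℓ : ℝ := Real.log (1 + 1 / n) with hℓ
  have hx : (0 : ℝ) < 1 / n := by positivity
  have hx1 : 1 / (n : ℝ) ≤ 1 := by rw [div_le_one hn0]; exact_mod_cast hn
  have hℓ1 : ℓ ≤ 1 / n := by
    have := Real.log_le_sub_one_of_pos (show (0 : ℝ) < 1 + 1 / n by positivity)
    linarith
  have hℓ0 : 0 ≤ ℓ := Real.log_nonneg (by linarith)
  have hℓ2 : 1 / n - ℓ ≤ 1 / (n : ℝ) ^ 2 := by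
    have h := Real.one_sub_inv_le_log_of_pos (show (0 : ℝ) < 1 + 1 / n by positivity)
    have h' : 1 / (n : ℝ) - (1 - (1 + 1 / (n : ℝ))⁻¹) ≤ 1 / (n : ℝ) ^ 2 := by
      have : 1 / (n : ℝ) - (1 - (1 + 1 / (n : ℝ))⁻¹) = 1 / (n * (n + 1)) := by
        field_simp
        ring
      rw [this]
      apply one_div_le_one_div_of_le (by positivity)
      nlinarith
    linarith
  have hpow : ((n : ℂ) + lam) * ((n : ℂ) + 1) ^ (-lam) * (n : ℂ) ^ (lam - 1) =
      (1 + lam / n) * Complex.exp (-(lam * ℓ)) := by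
    have h1 : ((n : ℂ) + 1) = ((n : ℝ) : ℂ) * (((1 + 1 / n : ℝ)) : ℂ) := by
      push_cast; field_simp
    rw [h1, Complex.mul_cpow_ofReal_nonneg hn0.le (by positivity),
      Complex.cpow_def_of_ne_zero (x := ((1 + 1 / n : ℝ) : ℂ))
        (by exact_mod_cast (show (1 + 1 / (n : ℝ)) ≠ 0 by positivity)),
      ← Complex.ofReal_log (by positivity), ← hℓ, Complex.cpow_sub _ _ hnC, Complex.cpow_one,
      Complex.cpow_neg, Complex.ofReal_natCast]
    have h2 : (n : ℂ) ^ lam ≠ 0 := by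
      rw [Complex.cpow_def_of_ne_zero hnC]; exact Complex.exp_ne_zero _
    rw [show (ℓ : ℂ) * -lam = -(lam * ℓ) by ring]
    field_simp
  rw [hpow]
  have hy : ‖lam * (ℓ : ℂ)‖ ≤ R / n := by
    rw [norm_mul, Complex.norm_real, Real.norm_eq_abs, abs_of_nonneg hℓ0]
    calc _ ≤ R * (1 / n) := by gcongr
      _ = _ := by ring
  have hyR : R / n ≤ R := div_le_self hR (by exact_mod_cast hn)
  have hexp : ‖Complex.exp (-(lam * ℓ)) - 1 + lam * ℓ‖ ≤ (R / n) ^ 2 * Real.exp R := by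
    have := Complex.norm_exp_sub_sum_le_norm_mul_exp (-(lam * (ℓ : ℂ))) 2
    simp only [Finset.sum_range_succ, Finset.sum_range_zero] at this
    norm_num at this
    rw [sub_add_eq_sub_sub, sub_neg_eq_add] at this
    rw [norm_mul, Complex.norm_real, Real.norm_eq_abs] at hy
    refine this.trans ?_
    gcongr
    exact hy.trans hyR
  have hlin : ‖lam / n - lam * ℓ‖ ≤ R * (1 / (n : ℝ) ^ 2) := by
    have : lam / n - lam * ℓ = lam * ((1 / n - ℓ : ℝ) : ℂ) := by push_cast; ring
    rw [this, norm_mul, Complex.norm_real, Real.norm_eq_abs, abs_of_nonneg (by linarith)]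
    gcongr
  have hlamn : ‖lam / (n : ℂ)‖ ≤ R / n := by
    rw [norm_div, Complex.norm_natCast]; gcongr
  have hid : (1 + lam / n) * Complex.exp (-(lam * ℓ)) - 1 =
      (1 + lam / n) * (Complex.exp (-(lam * ℓ)) - 1 + lam * ℓ) +
        (lam / n - lam * ℓ) - (lam / n) * (lam * ℓ) := by ring
  rw [hid]
  have h1 : ‖1 + lam / (n : ℂ)‖ ≤ 1 + R := by
    refine (norm_add_le _ _).trans ?_
    rw [norm_one]; linarith
  calc _ ≤ (1 + R) * ((R / n) ^ 2 * Real.exp R) + R * (1 / (n : ℝ) ^ 2) + R / n * (R / n) := by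
        refine (norm_sub_le _ _).trans (add_le_add ((norm_add_le _ _).trans (add_le_add ?_ hlin)) ?_)
        · rw [norm_mul]; gcongr
        · rw [norm_mul]; gcongr
    _ = (R ^ 2 + (1 + R) * (R ^ 2 * Real.exp R) + R) / (n : ℝ) ^ 2 := by
        field_simp
        ring

/-- Bounds `n^(-1-δ)` by a telescoping difference, so that sums of such terms need no comparison
with an integral. -/
theorem rpow_neg_one_sub_le {δ : ℝ} (hδ : 0 < δ) (hδ1 : δ ≤ 1) {n : ℕ} (hn : 1 ≤ n) :
    (n : ℝ) ^ (-1 - δ) ≤ 4 / δ * ((n : ℝ) ^ (-δ) - ((n : ℝ) + 1) ^ (-δ)) := by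
  have hn0 : (0 : ℝ) < n := by exact_mod_cast hn
  have hx : (0 : ℝ) < 1 / n := by positivity
  have hx1 : 1 / (n : ℝ) ≤ 1 := by rw [div_le_one hn0]; exact_mod_cast hn
  have h1 : ((n : ℝ) + 1) ^ (-δ) = (n : ℝ) ^ (-δ) * (1 + 1 / (n : ℝ)) ^ (-δ) := by
    rw [← Real.mul_rpow hn0.le (by positivity)]
    congr 1; field_simp
  have h2 : (1 + 1 / (n : ℝ)) ^ (-δ) ≤ 1 - δ / (4 * n) := by
    rw [Real.rpow_def_of_pos (by positivity)]
    have hlog : 1 / (2 * (n : ℝ)) ≤ Real.log (1 + 1 / n) := by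
      have h := Real.one_sub_inv_le_log_of_pos (show (0 : ℝ) < 1 + 1 / n by positivity)
      refine le_trans ?_ h
      have : 1 - (1 + 1 / (n : ℝ))⁻¹ = 1 / (n + 1) := by field_simp; ring
      rw [this]
      apply one_div_le_one_div_of_le (by positivity)
      have : (1 : ℝ) ≤ n := by exact_mod_cast hn
      linarith
    set y : ℝ := δ / (2 * n) with hy
    have hy0 : 0 < y := by positivity
    have hy1 : y ≤ 1 := by
      rw [hy, div_le_one (by positivity)]
      have : (1 : ℝ) ≤ n := by exact_mod_cast hn
      linarith
    have h3 : Real.log (1 + 1 / n) * -δ ≤ -y := by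
      have : δ * (1 / (2 * (n : ℝ))) ≤ δ * Real.log (1 + 1 / n) := by gcongr
      have e : δ * (1 / (2 * (n : ℝ))) = y := by rw [hy]; ring
      linarith
    refine (Real.exp_le_exp.2 h3).trans ?_
    have h4 : Real.exp (-y) ≤ 1 / (1 + y) := by
      rw [Real.exp_neg, ← one_div]
      apply one_div_le_one_div_of_le (by positivity)
      linarith [Real.add_one_le_exp y]
    refine h4.trans ?_
    have e : δ / (4 * n) = y / 2 := by rw [hy]; field_simp; norm_num
    rw [e, div_le_iff₀ (by positivity)]
    nlinarith
  have h5 : 0 < (n : ℝ) ^ (-δ) := Real.rpow_pos_of_pos hn0 _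
  have h6 : (n : ℝ) ^ (-1 - δ) = (n : ℝ) ^ (-δ) * (1 / n) := by
    rw [show -1 - δ = -δ - 1 by ring, Real.rpow_sub_one hn0.ne']; ring
  rw [h1, h6]
  have h7 : 4 / δ * ((n : ℝ) ^ (-δ) * (δ / (4 * n))) = (n : ℝ) ^ (-δ) * (1 / n) := by
    field_simp
  rw [← h7]
  have : 0 < 4 / δ := by positivity
  gcongr
  nlinarith

/-- A discrete Gronwall inequality bounds `p`. The increments are then dominated by telescoping
differences of `n^(-δ)`, so `p` is a Cauchy sequence with tail of that order. The constant depends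
only on `A`, `M`, `δ`, which later makes the limit locally uniform in `z`. -/
theorem limit_of_almost_constant {δ : ℝ} (hδ : 0 < δ) (hδ1 : δ ≤ 1) {A M : ℝ} (hA : 0 ≤ A)
    {N : ℕ} (hN : 1 ≤ N) {p : ℕ → ℂ}
    (hp : ∀ n, N ≤ n → ‖p (n + 1) - p n‖ ≤ A * (n : ℝ) ^ (-1 - δ) * (‖p n‖ + 1))
    (h0 : ‖p N‖ ≤ M) :
    ∃ E : ℂ, ∀ n, N ≤ n → ‖p n - E‖ ≤
      A * (Real.exp (A * (4 / δ)) * (M + 1)) * (4 / δ) * (n : ℝ) ^ (-δ) := by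
  set v : ℕ → ℝ := fun n => (n : ℝ) ^ (-δ) with hv
  have hv0 : ∀ n, 0 ≤ v n := fun n => by positivity
  have hstep : ∀ n, N ≤ n → (n : ℝ) ^ (-1 - δ) ≤ 4 / δ * (v n - v (n + 1)) := by
    intro n hn
    have := rpow_neg_one_sub_le hδ hδ1 (hN.trans hn)
    simpa [hv] using this
  have hvN : v N ≤ 1 := Real.rpow_le_one_of_one_le_of_nonpos (by exact_mod_cast hN) (by linarith)
  have hδ4 : 0 < 4 / δ := by positivity
  have hM0 : 0 ≤ M := (norm_nonneg _).trans h0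
  -- The Gronwall step: `‖p n‖ + 1` is multiplied by at most `1 + y ≤ exp y`, and the exponents `y`
  -- telescope.
  have hq : ∀ n, N ≤ n → ‖p n‖ + 1 ≤ Real.exp (A * (4 / δ) * (v N - v n)) * (M + 1) := by
    intro n hn
    induction n, hn using Nat.le_induction with
    | base => simpa using h0
    | succ n hn ih =>
      have h1 := hp n hn
      have h2 : ‖p (n + 1)‖ ≤ ‖p n‖ + ‖p (n + 1) - p n‖ := by
        have := norm_add_le (p n) (p (n + 1) - p n)
        rwa [add_sub_cancel] at this
      have h3 : A * (n : ℝ) ^ (-1 - δ) ≤ A * (4 / δ) * (v n - v (n + 1)) := by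
        rw [mul_assoc]; exact mul_le_mul_of_nonneg_left (hstep n hn) hA
      have h4 : ‖p (n + 1)‖ + 1 ≤ (‖p n‖ + 1) * (A * (4 / δ) * (v n - v (n + 1)) + 1) := by
        have : A * (n : ℝ) ^ (-1 - δ) * (‖p n‖ + 1) ≤
            A * (4 / δ) * (v n - v (n + 1)) * (‖p n‖ + 1) := by gcongr
        nlinarith
      calc _ ≤ _ := h4
        _ ≤ (‖p n‖ + 1) * Real.exp (A * (4 / δ) * (v n - v (n + 1))) := by
          gcongr
          exact Real.add_one_le_exp _
        _ ≤ (Real.exp (A * (4 / δ) * (v N - v n)) * (M + 1)) *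
            Real.exp (A * (4 / δ) * (v n - v (n + 1))) := by gcongr
        _ = _ := by
          rw [mul_right_comm, ← Real.exp_add]
          congr 2; ring
  set Q : ℝ := Real.exp (A * (4 / δ)) * (M + 1) with hQ
  have hQ0 : 0 ≤ Q := by positivity
  have hq' : ∀ n, N ≤ n → ‖p n‖ + 1 ≤ Q := by
    intro n hn
    refine (hq n hn).trans ?_
    have : v N - v n ≤ 1 := by linarith [hv0 n]
    have h5 : 0 ≤ A * (4 / δ) := by positivity
    exact mul_le_mul_of_nonneg_right (Real.exp_le_exp.2 (mul_le_of_le_one_right h5 this))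
      (by positivity)
  have hd : ∀ n, N ≤ n → ‖p (n + 1) - p n‖ ≤ A * Q * (4 / δ) * (v n - v (n + 1)) := by
    intro n hn
    calc _ ≤ A * (n : ℝ) ^ (-1 - δ) * (‖p n‖ + 1) := hp n hn
      _ ≤ A * (4 / δ * (v n - v (n + 1))) * Q := by
        have h6 : 0 ≤ 4 / δ * (v n - v (n + 1)) := le_trans (by positivity) (hstep n hn)
        gcongr
        · exact hstep n hn
        · exact hq' n hn
      _ = _ := by ring
  have hcauchy : ∀ n k, N ≤ n → n ≤ k → ‖p k - p n‖ ≤ A * Q * (4 / δ) * (v n - v k) := by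
    intro n k hn hk
    induction k, hk using Nat.le_induction with
    | base => simp
    | succ k hk ih =>
      calc _ = ‖(p k - p n) + (p (k + 1) - p k)‖ := by congr 1; ring
        _ ≤ _ := norm_add_le _ _
        _ ≤ _ := add_le_add ih (hd k (hn.trans hk))
        _ = _ := by ring
  have hvt : Tendsto v atTop (𝓝 0) :=
    (tendsto_rpow_neg_atTop hδ).comp tendsto_natCast_atTop_atTop
  have hcs : CauchySeq fun n => p (n + N) := by
    refine cauchySeq_of_le_tendsto_0' (fun n => A * Q * (4 / δ) * v (n + N)) ?_ ?_
    · intro n k hnk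
      rw [dist_comm, dist_eq_norm]
      refine (hcauchy (n + N) (k + N) (by omega) (by omega)).trans ?_
      have : 0 ≤ A * Q * (4 / δ) := by positivity
      nlinarith [hv0 (k + N)]
    · simpa using ((tendsto_add_atTop_iff_nat N).2 hvt).const_mul (A * Q * (4 / δ))
  obtain ⟨E, hE⟩ := cauchySeq_tendsto_of_complete hcs
  rw [tendsto_add_atTop_iff_nat (f := p)] at hE
  refine ⟨E, fun n hn => ?_⟩
  have h8 : Tendsto (fun k => ‖p n - p k‖) atTop (𝓝 ‖p n - E‖) := (tendsto_const_nhds.sub hE).norm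
  refine le_of_tendsto h8 ?_
  filter_upwards [eventually_ge_atTop n] with k hk
  rw [norm_sub_rev]
  refine (hcauchy n k hn hk).trans ?_
  have : 0 ≤ A * Q * (4 / δ) := by positivity
  have h9 := hv0 k
  show _ ≤ A * Q * (4 / δ) * v n
  nlinarith

/-! ### The characteristic polynomial -/

theorem ascPochhammer_eq_prod (d : ℕ) :
    ascPochhammer ℂ d = ∏ i ∈ Finset.range d, (Polynomial.X + Polynomial.C (i : ℂ)) := by
  induction d with
  | zero => simp
  | succ d ih => rw [ascPochhammer_succ_right, Finset.prod_range_succ, ih]; simp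

theorem scale_ne_zero {m : ℕ} (hm : 2 ≤ m) (t : ℕ) : scale m t ≠ 0 := by
  unfold scale
  have : (m : ℂ) ≠ 0 := by exact_mod_cast (by omega : m ≠ 0)
  have h1 : ((m * t + m - 1).factorial : ℂ) ≠ 0 := by exact_mod_cast Nat.factorial_ne_zero _
  have h2 : (t.factorial : ℂ) ≠ 0 := by exact_mod_cast Nat.factorial_ne_zero _
  positivity

theorem F_eq_comp {m : ℕ} (hm : 2 ≤ m) (t : ℕ) :
    F m t = Polynomial.C (scale m t)⁻¹ *
      (ascPochhammer ℂ (deg m t)).comp (Polynomial.X + Polynomial.C (t : ℂ)) := by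
  unfold F
  congr 1
  · congr 1; unfold scale; rw [inv_div]
  · have hd := deg_pos hm (t := t)
    have ha := add_deg hm (t := t)
    have : Finset.Icc t (m * t + m - 2) = Finset.Ico t (m * t + m - 1) := by
      ext i; simp only [Finset.mem_Icc, Finset.mem_Ico]; omega
    rw [this, Finset.prod_Ico_eq_prod_range, ascPochhammer_eq_prod, Polynomial.prod_comp]
    refine Finset.prod_congr rfl fun i _ => ?_
    simp only [Polynomial.add_comp, Polynomial.X_comp, Polynomial.C_comp]
    push_cast
    rw [Polynomial.C_add]
    ring

/-- The characteristic polynomial of the Euler equation, in the variable `θ + t`. -/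
def charPoly (m t : ℕ) (z : ℂ) : Polynomial ℂ :=
  ascPochhammer ℂ (deg m t) - Polynomial.C (z * scale m t)

theorem charPoly_natDegree (m t : ℕ) (z : ℂ) : (charPoly m t z).natDegree = deg m t := by
  unfold charPoly
  rw [Polynomial.natDegree_sub_C, ascPochhammer_natDegree]

theorem charPoly_card_roots (m t : ℕ) (z : ℂ) : (charPoly m t z).roots.card = deg m t := by
  rw [Polynomial.splits_iff_card_roots.1 (IsAlgClosed.splits _), charPoly_natDegree]

section charPoly

variable {m : ℕ} (hm : 2 ≤ m) (t : ℕ)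

include hm

theorem charPoly_eval (z s : ℂ) :
    (charPoly m t z).eval s = scale m t * ((F m t).eval (s - t) - z) := by
  have := scale_ne_zero hm t
  rw [F_eq_comp hm, charPoly]
  simp
  field_simp

theorem charPoly_derivative_eval (z s : ℂ) :
    (charPoly m t z).derivative.eval s = scale m t * (F m t).derivative.eval (s - t) := by
  have := scale_ne_zero hm t
  rw [F_eq_comp hm, charPoly]
  simp [Polynomial.derivative_comp]
  field_simp

theorem charPoly_monic (z : ℂ) : (charPoly m t z).Monic := by
  unfold charPoly
  refine (monic_ascPochhammer ℂ _).sub_of_left ?_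
  refine Polynomial.degree_C_le.trans_lt ?_
  rw [Polynomial.degree_eq_natDegree (monic_ascPochhammer ℂ _).ne_zero, ascPochhammer_natDegree]
  exact_mod_cast deg_pos hm

theorem charPoly_eq_prod (z : ℂ) : charPoly m t z =
    ((charPoly m t z).roots.map fun a => Polynomial.X - Polynomial.C a).prod :=
  (IsAlgClosed.splits _).eq_prod_roots_of_monic (charPoly_monic hm t z)

theorem mem_charPoly_roots {z s : ℂ} : s ∈ (charPoly m t z).roots ↔ (F m t).eval (s - t) = z := by
  rw [Polynomial.mem_roots (charPoly_monic hm t z).ne_zero, Polynomial.IsRoot, charPoly_eval hm,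
    mul_eq_zero, or_iff_right (scale_ne_zero hm t), sub_eq_zero]

end charPoly

/-! ### Asymptotics of the mean with constants uniform in `z` -/

/-- A bound for the `t`-th derivative of a power series bounds its coefficients. -/
theorem coeff_bound_of_derivative {κ : ℝ} (hκ : 1 ≤ κ) (t : ℕ) :
    ∃ C, 0 ≤ C ∧ ∀ (h : ℕ → ℂ) (M : ℝ), 0 ≤ M →
      (∀ n, ‖(t.factorial * (n + t).choose t : ℂ) * h (n + t)‖ ≤ M * binomCoeff (κ + t) n) →
      ∀ j, max t 1 ≤ j → ‖h j‖ ≤ C * M * (j : ℝ) ^ (κ - 1) := by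
  obtain ⟨C, hC0, hC⟩ := binomCoeff_le (κ := κ + t) (by positivity)
  refine ⟨C * 2 ^ (κ - 1), by positivity, fun h M hM hh j hj => ?_⟩
  obtain ⟨n, rfl⟩ : ∃ n, j = n + t := ⟨j - t, by omega⟩
  have h1 := (hh n).trans (mul_le_mul_of_nonneg_left (hC n) hM)
  have hn : (0 : ℝ) < (n : ℝ) + 1 := by positivity
  -- Differentiating `t` times multiplies the coefficient by at least `(n+1)^t`, which is exactly
  -- the surplus of the index `κ+t` over `κ`. Nothing is learnt about indices below `t`, hence the
  -- condition `max t 1 ≤ j`.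
  have h2 : ((n : ℝ) + 1) ^ t ≤ ‖(t.factorial * (n + t).choose t : ℂ)‖ := by
    rw [← Nat.cast_mul, ← Nat.ascFactorial_eq_factorial_mul_choose, Complex.norm_natCast]
    exact_mod_cast Nat.pow_succ_le_ascFactorial (n + 1) t
  have h3 : ((n : ℝ) + 1) ^ (κ + t - 1) = ((n : ℝ) + 1) ^ (κ - 1) * ((n : ℝ) + 1) ^ t := by
    rw [← Real.rpow_natCast, ← Real.rpow_add hn]; congr 1; ring
  rw [norm_mul, h3] at h1
  have h4 : ((n : ℝ) + 1) ^ t * ‖h (n + t)‖ ≤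
      ((n : ℝ) + 1) ^ t * (M * (C * ((n : ℝ) + 1) ^ (κ - 1))) := by
    calc _ ≤ _ := mul_le_mul_of_nonneg_right h2 (norm_nonneg _)
      _ ≤ _ := h1
      _ = _ := by ring
  have h5 := le_of_mul_le_mul_left h4 (by positivity)
  have h6 : ((n : ℝ) + 1) ^ (κ - 1) ≤ 2 ^ (κ - 1) * ((n + t : ℕ) : ℝ) ^ (κ - 1) := by
    rw [← Real.mul_rpow (by norm_num) (by positivity)]
    refine Real.rpow_le_rpow hn.le ?_ (by linarith)
    have : 1 ≤ n + t := by omega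
    have : n + 1 ≤ 2 * (n + t) := by omega
    exact_mod_cast this
  calc _ ≤ _ := h5
    _ ≤ M * (C * (2 ^ (κ - 1) * ((n + t : ℕ) : ℝ) ^ (κ - 1))) := by gcongr
    _ = _ := by ring

section mean

variable {m t : ℕ} (hm : 2 ≤ m) (rule : SupplementaryRule m t)

theorem norm_coeff_meanSeries_le (t : ℕ) (d : ℕ) : ∃ C : ℝ, 0 ≤ C ∧ ∀ (a : ℕ → ℂ) (M : ℝ), 0 ≤ M →
    (∀ j < t + d, ‖a j‖ ≤ M) → ∀ n < d,
      ‖(t.factorial * (n + t).choose t : ℂ) * a (n + t)‖ ≤ C * M := by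
  refine ⟨∑ n ∈ Finset.range d, t.factorial * (n + t).choose t, by positivity,
    fun a M hM ha n hn => ?_⟩
  rw [norm_mul, ← Nat.cast_mul, Complex.norm_natCast]
  refine mul_le_mul ?_ (ha _ (by omega)) (norm_nonneg _) (by positivity)
  push_cast
  exact Finset.single_le_sum (f := fun n => (t.factorial * (n + t).choose t : ℝ))
    (fun _ _ => by positivity) (Finset.mem_range.2 hn)

/-- Used away from the positive half-line, where only an upper bound on the growth is needed. The
roots of `charPoly` are `θ+t`, so `euler_product_bound` is applied with index `κ+t`. -/
theorem shiftedMean_bound {κ δ R M : ℝ} (hκ : 1 ≤ κ) (hδ : 0 < δ) (hR : 0 ≤ R) (hM : 0 ≤ M) :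
    ∃ C, 0 ≤ C ∧ ∀ z : ℂ, z * m ≠ 1 →
      (∀ θ, (F m t).eval θ = z → ‖θ‖ ≤ R ∧ θ.re ≤ κ - δ) →
      (∀ j < m * t + m - 1, ‖shiftedMean hm rule z j‖ ≤ M) →
      ∀ n, max t 1 ≤ n → ‖shiftedMean hm rule z n‖ ≤ C * (n : ℝ) ^ (κ - 1) := by
  obtain ⟨C₁, hC₁, h₁⟩ := euler_product_bound (κ := κ + t) (δ := δ) (R := R + t) (by positivity) hδ
    (by positivity) (deg m t)
  obtain ⟨C₂, hC₂, h₂⟩ := coeff_bound_of_derivative hκ t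
  obtain ⟨C₃, hC₃, h₃⟩ := norm_coeff_meanSeries_le t (deg m t)
  refine ⟨C₂ * (C₁ * (C₃ * M)), by positivity, fun z hz hroots hinit n hn => ?_⟩
  refine h₂ _ (C₁ * (C₃ * M)) (by positivity) (fun n => ?_) n hn
  rw [← coeff_meanSeries]
  refine h₁ (charPoly m t z).roots (charPoly_card_roots m t z) (fun r hr => ?_) _ ?_ (C₃ * M)
    (by positivity) (fun n hn => ?_) n
  · obtain ⟨e1, e2⟩ := hroots _ ((mem_charPoly_roots hm t).1 hr)
    constructor
    · have := norm_add_le (r - t) (t : ℂ)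
      rw [sub_add_cancel, Complex.norm_natCast] at this
      linarith
    · simp at e2; linarith
  · rw [← charPoly_eq_prod hm]
    exact meanSeries_aeval hm rule hz
  · rw [coeff_meanSeries]
    exact h₃ _ M hM (by rwa [add_deg hm]) n hn

/-- Applying `eulerOp - s` with `s = lam + t` to the mean series removes the root `lam`. What
remains is annihilated by the factors of the other roots, so it grows only with index `κ`. -/
theorem shiftedMean_first_order {κ δ R M : ℝ} (hκ : 1 ≤ κ) (hδ : 0 < δ) (hR : 0 ≤ R)
    (hM : 0 ≤ M) :
    ∃ C, 0 ≤ C ∧ ∀ z lam : ℂ, z * m ≠ 1 → (F m t).eval lam = z → ‖lam‖ ≤ R →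
      (F m t).derivative.eval lam ≠ 0 →
      (∀ θ, θ ≠ lam → (F m t).eval θ = z → ‖θ‖ ≤ R ∧ θ.re ≤ κ - δ) →
      (∀ j < m * t + m - 1, ‖shiftedMean hm rule z j‖ ≤ M) →
      ∀ n, max t 1 ≤ n → ‖(n + 1) * shiftedMean hm rule z (n + 1) -
        (n + lam) * shiftedMean hm rule z n‖ ≤ C * (n : ℝ) ^ (κ - 1) := by
  obtain ⟨C₁, hC₁, h₁⟩ := euler_product_bound (κ := κ + t) (δ := δ) (R := R + t) (by positivity) hδ
    (by positivity) (deg m t - 1)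
  obtain ⟨C₂, hC₂, h₂⟩ := coeff_bound_of_derivative hκ t
  obtain ⟨C₃, hC₃, h₃⟩ := norm_coeff_meanSeries_le t (deg m t)
  refine ⟨C₂ * (C₁ * ((2 * deg m t + 1 + (R + t)) * (C₃ * M))), by positivity,
    fun z lam hz hlam hlamR hder hroots hinit n hn => ?_⟩
  refine h₂ (fun n => (n + 1) * shiftedMean hm rule z (n + 1) - (n + lam) * shiftedMean hm rule z n)
    _ (by positivity) (fun n => ?_) n hn
  set s : ℂ := lam + t with hs
  have hsn : ‖s‖ ≤ R + t := by
    refine (norm_add_le _ _).trans ?_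
    rw [Complex.norm_natCast]; linarith
  set B := meanSeries hm rule z with hB
  have hcoeff : ∀ n, PowerSeries.coeff n ((eulerOp - algebraMap ℂ _ s) B) =
      (t.factorial * (n + t).choose t : ℂ) * (((n + t : ℕ) + 1) * shiftedMean hm rule z (n + t + 1) -
        ((n + t : ℕ) + lam) * shiftedMean hm rule z (n + t)) := by
    intro n
    rw [coeff_eulerOp_sub, hB, coeff_meanSeries, coeff_meanSeries]
    -- This identity turns the recursion with `s` for the `t`-th derivative into the recursion with
    -- `lam` for the original coefficients, at index `n+t`.
    have h4 : ((n + 1 : ℕ) : ℂ) * ((n + 1 + t).choose t : ℕ) =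
        ((n + t + 1 : ℕ) : ℂ) * ((n + t).choose t : ℕ) := by
      have := Nat.add_one_mul_choose_eq (n + t) n
      have e1 : (n + 1 + t).choose t = (n + t + 1).choose (n + 1) := by
        rw [show n + 1 + t = n + t + 1 by ring]
        exact (Nat.choose_symm_of_eq_add (by ring))
      have e2 : (n + t).choose t = (n + t).choose n := Nat.choose_symm_of_eq_add (by ring)
      rw [e1, e2]
      have h5 : (n + 1) * (n + t + 1).choose (n + 1) = (n + t + 1) * (n + t).choose n := by
        rw [this]; ring
      exact_mod_cast h5
    push_cast at h4 ⊢
    rw [show n + 1 + t = n + t + 1 by ring] at h4 ⊢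
    linear_combination (t.factorial : ℂ) * shiftedMean hm rule z (n + t + 1) * h4
  rw [← hcoeff n]
  have hsroot : s ∈ (charPoly m t z).roots := by
    rw [mem_charPoly_roots hm, hs, add_sub_cancel_right, hlam]
  have hfac : charPoly m t z = (((charPoly m t z).roots.erase s).map
      fun a => Polynomial.X - Polynomial.C a).prod * (Polynomial.X - Polynomial.C s) := by
    conv_lhs => rw [charPoly_eq_prod hm t z, ← Multiset.cons_erase hsroot, Multiset.map_cons,
      Multiset.prod_cons, mul_comm]
  have hzero := meanSeries_aeval hm rule hz
  change Polynomial.aeval eulerOp (charPoly m t z) B = 0 at hzero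
  rw [hfac, map_mul, Module.End.mul_apply, map_sub, Polynomial.aeval_X, Polynomial.aeval_C] at hzero
  refine h₁ _ ?_ (fun r hr => ?_) _ hzero _ (by positivity) (fun n hn => ?_) n
  · rw [Multiset.card_erase_of_mem hsroot, charPoly_card_roots]; rfl
  -- A second copy of `s` among the roots would make the derivative vanish there, so the remaining
  -- roots satisfy the hypothesis on `θ ≠ lam`.
  · have hne : r ≠ s := by
      rintro rfl
      have h6 := charPoly_derivative_eval hm t z s
      rw [hfac, Polynomial.derivative_mul, Polynomial.eval_add, Polynomial.eval_mul,
        Polynomial.eval_mul] at h6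
      have h7 : Polynomial.eval s (((charPoly m t z).roots.erase s).map
          fun a => Polynomial.X - Polynomial.C a).prod = 0 := by
        rw [← Multiset.cons_erase hr, Multiset.map_cons, Multiset.prod_cons, Polynomial.eval_mul]
        simp
      rw [h7, hs, add_sub_cancel_right] at h6
      simp at h6
      exact h6.elim (scale_ne_zero hm t) hder
    have hr' := (mem_charPoly_roots hm t).1 (Multiset.mem_of_mem_erase hr)
    obtain ⟨e1, e2⟩ := hroots (r - t) (fun h => hne (by rw [hs, ← h]; ring)) hr'
    constructor
    · have := norm_add_le (r - t) (t : ℂ)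
      rw [sub_add_cancel, Complex.norm_natCast] at this
      linarith
    · simp at e2; linarith
  · have hb := h₃ _ M hM (by rwa [add_deg hm])
    have hb1 : ∀ n < deg m t, ‖PowerSeries.coeff n B‖ ≤ C₃ * M := by
      intro n hn
      rw [hB, coeff_meanSeries]
      exact hb n hn
    rw [coeff_eulerOp_sub]
    have e1 := hb1 n (by omega)
    have e2 := hb1 (n + 1) (by omega)
    have hnk : (n : ℝ) ≤ deg m t := by exact_mod_cast (by omega : n ≤ deg m t)
    have e3 : ‖(n : ℂ) + 1‖ = n + 1 := by
      rw [← Nat.cast_succ, Complex.norm_natCast]; push_cast; rfl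
    have e4 : ‖(n : ℂ) + s‖ ≤ n + (R + t) := by
      refine (norm_add_le _ _).trans ?_
      rw [Complex.norm_natCast]; linarith
    have hCM : 0 ≤ C₃ * M := by positivity
    calc _ ≤ ‖((n : ℂ) + 1) * PowerSeries.coeff (n + 1) B‖ +
          ‖((n : ℂ) + s) * PowerSeries.coeff n B‖ := norm_sub_le _ _
      _ ≤ (n + 1) * (C₃ * M) + (n + (R + t)) * (C₃ * M) := by
        rw [norm_mul, norm_mul, e3]
        gcongr
      _ ≤ _ := by nlinarith

/-- First-order asymptotics of the mean with a polynomial rate, uniform in the parameters. -/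
theorem mean_limit {κ δ R M : ℝ} (hκ : 1 ≤ κ) (hδ : 0 < δ) (hδ1 : δ ≤ 1) (hR : 0 ≤ R)
    (hM : 0 ≤ M) :
    ∃ C, 0 ≤ C ∧ ∀ z lam : ℂ, z * m ≠ 1 → (F m t).eval lam = z → ‖lam‖ ≤ R → κ + δ ≤ lam.re →
      (F m t).derivative.eval lam ≠ 0 →
      (∀ θ, θ ≠ lam → (F m t).eval θ = z → ‖θ‖ ≤ R ∧ θ.re ≤ κ - δ) →
      (∀ j ≤ m * t + m, ‖shiftedMean hm rule z j‖ ≤ M) → ‖((m : ℂ) - 1) / (z * m - 1)‖ ≤ M →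
      ∃ E : ℂ, ∀ n : ℕ, max t 1 ≤ n →
        ‖expProfilePoly hm rule n z / (n : ℂ) ^ (lam - 1) - E‖ ≤ C * (n : ℝ) ^ (-δ) := by
  obtain ⟨C₁, hC₁, h₁⟩ := shiftedMean_first_order (t := t) hm rule hκ hδ hR hM
  obtain ⟨C₂, hC₂, h₂⟩ := norm_ratio_sub_one_le hR
  set A := C₂ + C₁ with hA
  refine ⟨A * (Real.exp (A * (4 / δ)) * (M + 1)) * (4 / δ) + M, by positivity,
    fun z lam hz hlam hlamR hre hder hroots hinit hγ => ?_⟩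
  have hN1 : 1 ≤ max t 1 := le_max_right _ _
  have hcpow : ∀ (n : ℕ) (w : ℂ), 1 ≤ n → ‖(n : ℂ) ^ w‖ = (n : ℝ) ^ w.re := by
    intro n w hn
    rw [← Complex.ofReal_natCast, Complex.norm_cpow_eq_rpow_re_of_pos (by exact_mod_cast hn)]
  have hdec : ∀ n : ℕ, 1 ≤ n → ‖(n : ℂ) ^ (1 - lam)‖ ≤ (n : ℝ) ^ (-δ) := by
    intro n hn
    rw [hcpow n _ hn]
    refine Real.rpow_le_rpow_of_exponent_le (by exact_mod_cast hn) ?_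
    simp; linarith
  have main := limit_of_almost_constant hδ hδ1 (A := A) (M := M) (by positivity) hN1
    (p := fun n => shiftedMean hm rule z n * (n : ℂ) ^ (1 - lam))
  refine (main (fun n hn => ?_) ?_).elim fun E hE => ?_
  rotate_left 2
  · refine ⟨E, fun n hn => ?_⟩
    have hn1 : 1 ≤ n := hN1.trans hn
    have hnC : (n : ℂ) ≠ 0 := by exact_mod_cast (by omega : n ≠ 0)
    have e : expProfilePoly hm rule n z / (n : ℂ) ^ (lam - 1) - E =
        (shiftedMean hm rule z n * (n : ℂ) ^ (1 - lam) - E) -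
          ((m : ℂ) - 1) / (z * m - 1) * (n : ℂ) ^ (1 - lam) := by
      unfold shiftedMean
      rw [show 1 - lam = -(lam - 1) by ring, Complex.cpow_neg]
      ring
    rw [e, add_mul]
    refine (norm_sub_le _ _).trans (add_le_add (hE n hn) ?_)
    rw [norm_mul]
    exact mul_le_mul hγ (hdec n hn1) (norm_nonneg _) hM
  · have hn1 : 1 ≤ n := hN1.trans hn
    have hnC : (n : ℂ) ≠ 0 := by exact_mod_cast (by omega : n ≠ 0)
    have hnC1 : (n : ℂ) + 1 ≠ 0 := by exact_mod_cast (by omega : n + 1 ≠ 0)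
    have hn0 : (0 : ℝ) < n := by exact_mod_cast hn1
    set c := (n + 1) * shiftedMean hm rule z (n + 1) - (n + lam) * shiftedMean hm rule z n with hc
    have hcb : ‖c‖ ≤ C₁ * (n : ℝ) ^ (κ - 1) :=
      h₁ z lam hz hlam hlamR hder hroots (fun j hj => hinit j (by omega)) n hn
    have hP0 : (n : ℂ) ^ (1 - lam) ≠ 0 := by
      rw [Complex.cpow_def_of_ne_zero hnC]; exact Complex.exp_ne_zero _
    -- The increment of the normalised sequence: a multiplier close to `1`, plus the first-order
    -- remainder `c`, which is small because `κ + δ ≤ Re lam`.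
    have e : shiftedMean hm rule z (n + 1) * ((n + 1 : ℕ) : ℂ) ^ (1 - lam) -
        shiftedMean hm rule z n * (n : ℂ) ^ (1 - lam) =
        (((n : ℂ) + lam) * ((n : ℂ) + 1) ^ (-lam) * (n : ℂ) ^ (lam - 1) - 1) *
          (shiftedMean hm rule z n * (n : ℂ) ^ (1 - lam)) + c * ((n : ℂ) + 1) ^ (-lam) := by
      have e1 : (n : ℂ) ^ (lam - 1) * (n : ℂ) ^ (1 - lam) = 1 := by
        rw [← Complex.cpow_add _ _ hnC]; simp
      have e2 : ((n + 1 : ℕ) : ℂ) ^ (1 - lam) = ((n : ℂ) + 1) * ((n : ℂ) + 1) ^ (-lam) := by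
        push_cast
        rw [sub_eq_add_neg, Complex.cpow_add _ _ hnC1, Complex.cpow_one]
      rw [e2, hc]
      linear_combination -((n : ℂ) + lam) * ((n : ℂ) + 1) ^ (-lam) * shiftedMean hm rule z n * e1
    rw [e]
    have hb1 := h₂ lam n hlamR hn1
    -- The condition `δ ≤ 1` lets the error `n^(-2)` be absorbed.
    have hsq : C₂ / (n : ℝ) ^ 2 ≤ C₂ * (n : ℝ) ^ (-1 - δ) := by
      rw [div_eq_mul_inv, ← Real.rpow_natCast, ← Real.rpow_neg hn0.le]
      refine mul_le_mul_of_nonneg_left ?_ hC₂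
      refine Real.rpow_le_rpow_of_exponent_le (by exact_mod_cast hn1) ?_
      push_cast; linarith
    have hb2 : ‖c * ((n : ℂ) + 1) ^ (-lam)‖ ≤ C₁ * (n : ℝ) ^ (-1 - δ) := by
      rw [norm_mul]
      have e3 : ‖((n : ℂ) + 1) ^ (-lam)‖ ≤ (n : ℝ) ^ (-κ - δ) := by
        rw [← Nat.cast_succ, hcpow _ _ (by omega)]
        calc _ ≤ (n : ℝ) ^ (-lam).re := by
              refine Real.rpow_le_rpow_of_nonpos hn0 (by push_cast; linarith) ?_
              simp; linarith
          _ ≤ _ := by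
              refine Real.rpow_le_rpow_of_exponent_le (by exact_mod_cast hn1) ?_
              simp; linarith
      calc _ ≤ C₁ * (n : ℝ) ^ (κ - 1) * (n : ℝ) ^ (-κ - δ) :=
            mul_le_mul hcb e3 (norm_nonneg _) (by positivity)
        _ = _ := by
            rw [mul_assoc, ← Real.rpow_add hn0]; congr 2; ring
    have hv : 0 ≤ (n : ℝ) ^ (-1 - δ) := by positivity
    calc _ ≤ ‖((n : ℂ) + lam) * ((n : ℂ) + 1) ^ (-lam) * (n : ℂ) ^ (lam - 1) - 1‖ *
          ‖shiftedMean hm rule z n * (n : ℂ) ^ (1 - lam)‖ + C₁ * (n : ℝ) ^ (-1 - δ) := by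
            refine (norm_add_le _ _).trans ?_
            rw [norm_mul (_ - 1)]
            gcongr
      _ ≤ C₂ * (n : ℝ) ^ (-1 - δ) * ‖shiftedMean hm rule z n * (n : ℂ) ^ (1 - lam)‖ +
          C₁ * (n : ℝ) ^ (-1 - δ) := by
            gcongr
            exact hb1.trans hsq
      _ ≤ _ := by
            have h8 := norm_nonneg (shiftedMean hm rule z n * (n : ℂ) ^ (1 - lam))
            have h9 : 0 ≤ C₁ * (n : ℝ) ^ (-1 - δ) := by positivity
            have h10 : 0 ≤ C₂ * (n : ℝ) ^ (-1 - δ) := by positivity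
            rw [hA]
            nlinarith [mul_nonneg h9 h8]
  · have hd := deg_pos hm (t := t)
    have ha := add_deg hm (t := t)
    rw [norm_mul]
    have h1 := hinit (max t 1) (by omega)
    have h2 : ‖((max t 1 : ℕ) : ℂ) ^ (1 - lam)‖ ≤ 1 := by
      refine (hdec _ hN1).trans ?_
      exact Real.rpow_le_one_of_one_le_of_nonpos (by exact_mod_cast hN1) (by linarith)
    calc _ ≤ M * 1 := mul_le_mul h1 h2 (norm_nonneg _) hM
      _ = M := mul_one M

end mean

/-! ### The roots of `F(θ) = z` and the dominant root -/

section roots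

variable {m : ℕ} (hm : 2 ≤ m) (t : ℕ)

include hm

theorem F_eval (θ : ℂ) :
    (F m t).eval θ = (scale m t)⁻¹ * ∏ i ∈ Finset.range (deg m t), (θ + t + i) := by
  rw [F_eq_comp hm, ascPochhammer_eq_prod, Polynomial.prod_comp, Polynomial.eval_mul,
    Polynomial.eval_prod]
  simp

theorem exists_root (z : ℂ) : ∃ θ, (F m t).eval θ = z := by
  have : (charPoly m t z).degree ≠ 0 := by
    rw [Polynomial.degree_eq_natDegree (charPoly_monic hm t z).ne_zero, charPoly_natDegree]
    exact_mod_cast (deg_pos hm).ne'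
  obtain ⟨s, hs⟩ := IsAlgClosed.exists_root _ this
  rw [Polynomial.IsRoot, charPoly_eval hm, mul_eq_zero, or_iff_right (scale_ne_zero hm t),
    sub_eq_zero] at hs
  exact ⟨_, hs⟩

theorem finite_roots (z : ℂ) : {θ | (F m t).eval θ = z}.Finite := by
  refine ((charPoly m t z).roots.toFinset.image fun s => s - (t : ℂ)).finite_toSet.subset ?_
  intro θ hθ
  rw [Finset.mem_coe, Finset.mem_image]
  refine ⟨θ + t, ?_, by ring⟩
  rw [Multiset.mem_toFinset, mem_charPoly_roots hm, add_sub_cancel_right]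
  exact hθ

theorem lambdaOne_spec (z : ℂ) : (F m t).eval (lambdaOne m t z) = z ∧
    ∀ θ, (F m t).eval θ = z → θ.re ≤ (lambdaOne m t z).re := by
  unfold lambdaOne
  refine Classical.epsilon_spec (p := fun θ => (F m t).eval θ = z ∧
    ∀ θ', (F m t).eval θ' = z → θ'.re ≤ θ.re) ?_
  obtain ⟨θ, hθ, hmax⟩ := Set.exists_max_image _ Complex.re (finite_roots hm t z)
    (exists_root hm t z)
  exact ⟨θ, hθ, fun θ' h => hmax θ' h⟩

/-- The roots of `F(θ) = z` depend continuously on `z`. -/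
theorem exists_near_root {ε : ℝ} (hε : 0 < ε) : ∃ η > 0, ∀ z z' : ℂ, ‖z - z'‖ < η →
    ∀ θ, (F m t).eval θ = z → ∃ θ', (F m t).eval θ' = z' ∧ ‖θ - θ'‖ < ε := by
  have hK := norm_pos_iff.2 (scale_ne_zero hm t)
  -- At `θ + t` the monic polynomial `charPoly m t z'` has absolute value `‖scale m t‖ ‖z - z'‖`. If
  -- all its roots were at distance at least `ε`, this value would be at least `ε ^ deg m t`.
  refine ⟨ε ^ deg m t / ‖scale m t‖, by positivity, fun z z' hz θ hθ => ?_⟩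
  by_contra! hcon
  have h1 := charPoly_eval hm t z' (θ + t)
  rw [add_sub_cancel_right, hθ, (IsAlgClosed.splits _).eval_eq_prod_roots,
    (charPoly_monic hm t z').leadingCoeff, one_mul] at h1
  have h2 : ∀ S : Multiset ℂ, (∀ r ∈ S, ε ≤ ‖θ + t - r‖) →
      ε ^ S.card ≤ ‖(S.map (θ + t - ·)).prod‖ := by
    intro S
    induction S using Multiset.induction_on with
    | empty => intro _; simp
    | cons a S ih =>
      intro h
      rw [Multiset.card_cons, Multiset.map_cons, Multiset.prod_cons, norm_mul, pow_succ']
      exact mul_le_mul (h a (Multiset.mem_cons_self _ _))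
        (ih fun r hr => h r (Multiset.mem_cons_of_mem hr)) (by positivity) (norm_nonneg _)
  have h3 := h2 (charPoly m t z').roots fun r hr => by
    have := hcon _ ((mem_charPoly_roots hm t).1 hr)
    rwa [sub_sub_eq_add_sub] at this
  rw [h1, charPoly_card_roots, norm_mul] at h3
  rw [lt_div_iff₀ hK, mul_comm] at hz
  exact absurd h3 (not_le.2 hz)

theorem continuous_lambdaOne_re : Continuous fun z => (lambdaOne m t z).re := by
  rw [Metric.continuous_iff]
  intro z ε hε
  obtain ⟨η, hη, h⟩ := exists_near_root hm t hε
  refine ⟨η, hη, fun z' hz' => ?_⟩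
  rw [dist_eq_norm] at hz'
  rw [Real.dist_eq, abs_lt]
  obtain ⟨e1, e2⟩ := lambdaOne_spec hm t z
  obtain ⟨e1', e2'⟩ := lambdaOne_spec hm t z'
  obtain ⟨θ, h1, h2⟩ := h _ _ hz' _ e1'
  obtain ⟨θ', h1', h2'⟩ := h _ _ (by rwa [norm_sub_rev]) _ e1
  have a1 := (abs_lt.1 ((Complex.abs_re_le_norm _).trans_lt h2)).2
  have a2 := (abs_lt.1 ((Complex.abs_re_le_norm _).trans_lt h2')).2
  rw [Complex.sub_re] at a1 a2
  constructor <;> linarith [e2 θ h1, e2' θ' h1']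

/-- After one copy of `λ₁` is erased from the multiset of roots, it is still present exactly when it
is a multiple root. The count with multiplicities thus becomes nonvanishing of `F'`. -/
theorem mem_D_iff {s : ℝ} {z : ℂ} : z ∈ D m t s ↔ s < (lambdaOne m t z).re ∧
    (F m t).derivative.eval (lambdaOne m t z) ≠ 0 ∧
    ∀ θ, θ ≠ lambdaOne m t z → (F m t).eval θ = z → θ.re < (lambdaOne m t z).re := by
  have hne : F m t - Polynomial.C z ≠ 0 := by
    intro h
    obtain ⟨θ, hθ⟩ := exists_root hm t (z + 1)
    have := congrArg (Polynomial.eval θ) h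
    simp [hθ] at this
  set l := lambdaOne m t z with hl
  have hroot : (F m t).eval l = z := (lambdaOne_spec hm t z).1
  have hderiv : (F m t - Polynomial.C z).derivative = (F m t).derivative := by simp
  have hmem : ∀ θ, θ ∈ (F m t - Polynomial.C z).roots ↔ (F m t).eval θ = z := by
    intro θ
    rw [Polynomial.mem_roots hne, Polynomial.IsRoot, Polynomial.eval_sub, Polynomial.eval_C,
      sub_eq_zero]
  have hl1 : l ∈ (F m t - Polynomial.C z).roots := (hmem l).2 hroot
  have hsimple : (F m t).derivative.eval l ≠ 0 ↔ l ∉ (F m t - Polynomial.C z).roots.erase l := by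
    rw [← Multiset.count_eq_zero, Multiset.count_erase_self, Polynomial.count_roots, ← hderiv]
    have hpos := (Polynomial.rootMultiplicity_pos hne).2 ((Polynomial.mem_roots hne).1 hl1)
    rw [← not_iff_not, not_not]
    have := Polynomial.one_lt_rootMultiplicity_iff_isRoot hne (t := l)
    have h2 : (F m t - Polynomial.C z).IsRoot l := (Polynomial.mem_roots hne).1 hl1
    rw [Polynomial.IsRoot] at this
    constructor
    · intro h
      have := this.2 ⟨h2, h⟩
      omega
    · intro h
      exact (this.1 (by omega)).2
  show (s < l.re ∧ _) ↔ _
  rw [hsimple]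
  constructor
  · rintro ⟨h1, h2⟩
    refine ⟨h1, fun h => lt_irrefl _ (h2 l h), fun θ hθ h => h2 θ ?_⟩
    rw [Multiset.mem_erase_of_ne hθ, hmem]; exact h
  · rintro ⟨h1, h2, h3⟩
    refine ⟨h1, fun θ hθ => h3 θ ?_ ((hmem θ).1 (Multiset.mem_of_mem_erase hθ))⟩
    rintro rfl
    exact h2 hθ

/-- Near a point of `D`, the dominant root varies continuously, stays simple, and stays separated
from the other roots. -/
theorem D_local {s : ℝ} {z₀ : ℂ} (hz : z₀ ∈ D m t s) :
    ∃ κ < (lambdaOne m t z₀).re, ∀ ε > 0, ∀ᶠ z in 𝓝 z₀,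
      ‖lambdaOne m t z - lambdaOne m t z₀‖ < ε ∧
      (F m t).derivative.eval (lambdaOne m t z) ≠ 0 ∧
      ∀ θ, θ ≠ lambdaOne m t z → (F m t).eval θ = z → θ.re < κ := by
  rw [mem_D_iff hm] at hz
  obtain ⟨-, hder, hoth⟩ := hz
  obtain ⟨hroot, -⟩ := lambdaOne_spec hm t z₀
  set l := lambdaOne m t z₀ with hl
  obtain ⟨κ₀, hκ₀, hκ₁⟩ : ∃ κ₀ < l.re, ∀ θ, θ ≠ l → (F m t).eval θ = z₀ → θ.re ≤ κ₀ := by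
    have hfin : {θ | (F m t).eval θ = z₀ ∧ θ ≠ l}.Finite :=
      (finite_roots hm t z₀).subset fun θ h => h.1
    rcases Set.eq_empty_or_nonempty {θ | (F m t).eval θ = z₀ ∧ θ ≠ l} with h0 | h0
    · refine ⟨l.re - 1, by linarith, fun θ h1 h2 => ?_⟩
      have : θ ∈ {θ | (F m t).eval θ = z₀ ∧ θ ≠ l} := ⟨h2, h1⟩
      rw [h0] at this; exact this.elim
    · obtain ⟨θ, hθ, hmax⟩ := Set.exists_max_image _ Complex.re hfin h0
      exact ⟨θ.re, hoth θ hθ.2 hθ.1, fun θ' h1 h2 => hmax θ' ⟨h2, h1⟩⟩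
  have hstrict : HasStrictDerivAt (fun x => (F m t).eval x) ((F m t).derivative.eval l) l :=
    (F m t).hasStrictDerivAt l
  have hinj := (hstrict.hasStrictFDerivAt_equiv hder).eventually_left_inverse
  have hne : ∀ᶠ x in 𝓝 l, (F m t).derivative.eval x ≠ 0 :=
    (F m t).derivative.continuous.continuousAt.eventually_ne hder
  obtain ⟨r, hr, hball⟩ := Metric.eventually_nhds_iff_ball.1 (hinj.and hne)
  -- The separating abscissa is the midpoint between `Re l` and the bound `κ₀` for the other roots.
  -- Shifts below a quarter of the gap keep the two groups apart.
  refine ⟨(l.re + κ₀) / 2, by linarith, fun ε hε => ?_⟩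
  set ε' := min (min ε r) ((l.re - κ₀) / 4) with hε'
  have hε'0 : 0 < ε' := lt_min (lt_min hε hr) (by linarith)
  have h1 : ε' ≤ ε := (min_le_left _ _).trans (min_le_left _ _)
  have h2 : ε' ≤ r := (min_le_left _ _).trans (min_le_right _ _)
  have h3 : ε' ≤ (l.re - κ₀) / 4 := min_le_right _ _
  obtain ⟨η, hη, h⟩ := exists_near_root hm t hε'0
  filter_upwards [Metric.ball_mem_nhds z₀ hη] with z hz
  rw [Metric.mem_ball, dist_eq_norm] at hz
  obtain ⟨e1, e2⟩ := lambdaOne_spec hm t z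
  have hreal : ∀ a b : ℂ, ‖a - b‖ < ε' → a.re < b.re + ε' := by
    intro a b hab
    have := (abs_lt.1 ((Complex.abs_re_le_norm _).trans_lt hab)).2
    rw [Complex.sub_re] at this
    linarith
  -- If `λ₁(z)` were close to another root of `F(θ) = z₀`, its real part would be smaller than that
  -- of the root of `F(θ) = z` close to `l`.
  have hnear : ‖lambdaOne m t z - l‖ < ε' := by
    obtain ⟨θ, hθ1, hθ2⟩ := h _ _ hz _ e1
    by_cases hθl : θ = l
    · rwa [hθl] at hθ2
    · exfalso
      obtain ⟨θ', hθ1', hθ2'⟩ := h z₀ z (by rwa [norm_sub_rev]) l hroot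
      have a1 := hreal _ _ hθ2
      have a2 := hreal _ _ hθ2'
      have a3 := e2 θ' hθ1'
      have a4 := hκ₁ θ hθl hθ1
      linarith
  have hb : lambdaOne m t z ∈ Metric.ball l r := by
    rw [Metric.mem_ball, dist_eq_norm]; exact hnear.trans_le h2
  refine ⟨hnear.trans_le h1, (hball _ hb).2, fun θ hθ hθz => ?_⟩
  obtain ⟨θ', hθ1', hθ2'⟩ := h _ _ hz _ hθz
  -- Two distinct roots for the same `z` cannot both be near `l`, since `F` is injective there.
  by_cases hθl : θ' = l
  · exfalso
    rw [hθl] at hθ2'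
    have hb' : θ ∈ Metric.ball l r := by
      rw [Metric.mem_ball, dist_eq_norm]; exact hθ2'.trans_le h2
    have i1 := (hball _ hb).1
    have i2 := (hball _ hb').1
    simp only [e1, hθz] at i1 i2
    exact hθ (i2.symm.trans i1)
  · have a1 := hreal _ _ hθ2'
    have a2 := hκ₁ θ' hθl hθ1'
    linarith

theorem isOpen_D (s : ℝ) : IsOpen (D m t s) := by
  rw [isOpen_iff_mem_nhds]
  intro z₀ hz
  obtain ⟨κ, hκ, h⟩ := D_local hm t hz
  have hs : s < (lambdaOne m t z₀).re := hz.1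
  filter_upwards [h (min ((lambdaOne m t z₀).re - κ) ((lambdaOne m t z₀).re - s))
    (lt_min (by linarith) (by linarith))] with z hz'
  obtain ⟨h1, h2, h3⟩ := hz'
  rw [mem_D_iff hm]
  have := (abs_lt.1 ((Complex.abs_re_le_norm _).trans_lt h1)).1
  rw [Complex.sub_re] at this
  have a1 := min_le_left ((lambdaOne m t z₀).re - κ) ((lambdaOne m t z₀).re - s)
  have a2 := min_le_right ((lambdaOne m t z₀).re - κ) ((lambdaOne m t z₀).re - s)
  exact ⟨by linarith, h2, fun θ hθ hθz => (h3 θ hθ hθz).trans (by linarith)⟩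

theorem continuousAt_lambdaOne {s : ℝ} {z : ℂ} (hz : z ∈ D m t s) :
    ContinuousAt (lambdaOne m t) z := by
  obtain ⟨κ, hκ, h⟩ := D_local hm t hz
  rw [Metric.continuousAt_iff']
  intro ε hε
  filter_upwards [h ε hε] with z' hz'
  rw [dist_eq_norm]; exact hz'.1

theorem hasDerivAt_lambdaOne {s : ℝ} {z : ℂ} (hz : z ∈ D m t s) :
    HasDerivAt (lambdaOne m t) ((F m t).derivative.eval (lambdaOne m t z))⁻¹ z :=
  HasDerivAt.of_local_left_inverse (continuousAt_lambdaOne hm t hz)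
    ((F m t).hasDerivAt (lambdaOne m t z)) ((mem_D_iff hm t).1 hz).2.1
    (Eventually.of_forall fun z' => (lambdaOne_spec hm t z').1)

theorem analyticOnNhd_lambdaOne (s : ℝ) : AnalyticOnNhd ℂ (lambdaOne m t) (D m t s) :=
  DifferentiableOn.analyticOnNhd
    (fun _ hz => (hasDerivAt_lambdaOne hm t hz).differentiableAt.differentiableWithinAt)
    (isOpen_D hm t s)

/-- `F` on the real line. -/
def realF (m t : ℕ) (θ : ℝ) : ℝ :=
  t.factorial / (m * (m * t + m - 1).factorial) * ∏ i ∈ Finset.range (deg m t), (θ + t + i)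

omit hm in
theorem scale_inv_eq (m t : ℕ) :
    (scale m t)⁻¹ = ((t.factorial / (m * (m * t + m - 1).factorial) : ℝ) : ℂ) := by
  unfold scale; push_cast; rw [inv_div]

theorem F_eval_ofReal (θ : ℝ) : (F m t).eval (θ : ℂ) = (realF m t θ : ℂ) := by
  rw [F_eval hm, scale_inv_eq, realF]; push_cast; rfl

omit hm in
/-- The logarithmic derivative of `F`. -/
def logDerivF (m t : ℕ) (θ : ℝ) : ℝ := ∑ i ∈ Finset.range (deg m t), 1 / (θ + t + i)

theorem factor_pos : (0 : ℝ) < t.factorial / (m * (m * t + m - 1).factorial) := by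
  have : (0 : ℝ) < m := by exact_mod_cast (by omega : 0 < m)
  positivity

theorem realF_pos {θ : ℝ} (hθ : -t < θ) : 0 < realF m t θ :=
  mul_pos (factor_pos hm t) (Finset.prod_pos fun i _ => by
    have : (0 : ℝ) ≤ i := Nat.cast_nonneg i
    linarith)

theorem logDerivF_pos {θ : ℝ} (hθ : -t < θ) : 0 < logDerivF m t θ :=
  Finset.sum_pos (fun i _ => by
    have : (0 : ℝ) ≤ i := Nat.cast_nonneg i
    have : 0 < θ + t + i := by linarith
    positivity) (Finset.nonempty_range_iff.2 (deg_pos hm).ne')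

theorem derivative_F_eval {θ : ℝ} (hθ : -t < θ) :
    (F m t).derivative.eval (θ : ℂ) = ((realF m t θ * logDerivF m t θ : ℝ) : ℂ) := by
  have h1 : HasDerivAt (fun x : ℂ => (F m t).eval x) ((F m t).derivative.eval (θ : ℂ)) θ :=
    (F m t).hasDerivAt _
  have hne : ∀ i ∈ Finset.range (deg m t), ((θ : ℂ) + t + i) ≠ 0 := by
    intro i _
    have : (0 : ℝ) ≤ i := Nat.cast_nonneg i
    have : θ + t + i ≠ 0 := by linarith
    exact_mod_cast this
  have h2 : HasDerivAt (fun x : ℂ => (F m t).eval x)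
      ((scale m t)⁻¹ * ∑ i ∈ Finset.range (deg m t),
        (∏ j ∈ (Finset.range (deg m t)).erase i, ((θ : ℂ) + t + j)) • (1 : ℂ)) θ := by
    simp only [F_eval hm]
    refine HasDerivAt.const_mul _ (HasDerivAt.fun_finsetProd
      (f' := fun _ => (1 : ℂ)) fun i _ => ?_)
    exact ((hasDerivAt_id _).add_const _).add_const _
  rw [h1.unique h2, realF, logDerivF, scale_inv_eq]
  push_cast
  rw [mul_assoc]
  congr 1
  rw [Finset.mul_sum]
  refine Finset.sum_congr rfl fun i hi => ?_
  rw [← Finset.mul_prod_erase _ _ hi, smul_eq_mul, mul_one]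
  have := hne i hi
  field_simp

/-- On the right of its real zeros, `F` grows with the real part and with the imaginary part. -/
theorem re_lt_of_norm_le {x : ℝ} {θ : ℝ} (hθ : -t < θ) (hx : realF m t θ = x) {z θ' : ℂ}
    (hz : ‖z‖ ≤ x) (hθ' : (F m t).eval θ' = z) (hne : θ' ≠ θ) : θ'.re < θ := by
  -- If `Re θ' ≥ θ`, then `|θ'+t+i| ≥ θ+t+i > 0` for all `i`, strictly for `i = 0` because `θ' ≠ θ`.
  -- Multiplying gives `|F(θ')| > x`.
  by_contra! hcon
  refine absurd hz (not_le.2 ?_)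
  rw [← hθ', ← hx, F_eval hm, norm_mul, scale_inv_eq, Complex.norm_real, Real.norm_eq_abs,
    abs_of_pos (factor_pos hm t), realF, norm_prod]
  refine mul_lt_mul_of_pos_left ?_ (factor_pos hm t)
  have hre : ∀ i : ℕ, (θ' + t + i).re = θ'.re + t + i := by intro i; simp
  have hpos : ∀ i : ℕ, 0 < θ + t + i := by
    intro i
    have : (0 : ℝ) ≤ i := Nat.cast_nonneg i
    linarith
  refine Finset.prod_lt_prod (fun i _ => hpos i) (fun i _ => ?_)
    ⟨0, Finset.mem_range.2 (deg_pos hm), ?_⟩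
  · refine le_trans ?_ (Complex.re_le_norm _)
    rw [hre]; linarith
  · rcases hcon.lt_or_eq with h | h
    · refine lt_of_lt_of_le ?_ (Complex.re_le_norm _)
      rw [hre]; linarith
    · have him : θ'.im ≠ 0 := fun h0 => hne (Complex.ext h.symm (by simpa using h0))
      have h1 : |(θ' + t + (0 : ℕ)).re| < ‖θ' + t + (0 : ℕ)‖ := by
        rw [Complex.abs_re_lt_norm]
        simpa using him
      refine lt_of_le_of_lt ?_ h1
      rw [hre, ← h]
      exact le_abs_self _

omit hm in
theorem continuous_realF (m t : ℕ) : Continuous (realF m t) := by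
  unfold realF; fun_prop

theorem strictMonoOn_realF : StrictMonoOn (realF m t) (Set.Ici (-t : ℝ)) := by
  intro a ha b hb hab
  have ha : -(t : ℝ) ≤ a := ha
  unfold realF
  refine mul_lt_mul_of_pos_left ?_ (factor_pos hm t)
  rcases ha.lt_or_eq with h | h
  · refine Finset.prod_lt_prod (fun i _ => ?_) (fun i _ => by linarith)
      ⟨0, Finset.mem_range.2 (deg_pos hm), by linarith⟩
    have : (0 : ℝ) ≤ i := Nat.cast_nonneg i
    linarith
  · rw [Finset.prod_eq_zero (Finset.mem_range.2 (deg_pos hm (t := t)))]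
    · refine Finset.prod_pos fun i _ => ?_
      have : (0 : ℝ) ≤ i := Nat.cast_nonneg i
      linarith
    · rw [← h]; simp

theorem exists_realF_eq {x : ℝ} (hx : 0 < x) : ∃ θ : ℝ, -t < θ ∧ realF m t θ = x := by
  have h0 : realF m t (-t) = 0 := by
    unfold realF
    rw [Finset.prod_eq_zero (Finset.mem_range.2 (deg_pos hm (t := t))), mul_zero]
    simp
  set c : ℝ := t.factorial / (m * (m * t + m - 1).factorial) with hc
  have hc0 : 0 < c := factor_pos hm t
  -- At `b` the factor with `i = 0` is at least `x/c` and all others are at least `1`, so `F(b) ≥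
  -- x`.
  set b : ℝ := 1 + x / c with hb
  have hb1 : 1 ≤ b := by have : 0 < x / c := by positivity
                         linarith
  have hbx : x ≤ realF m t b := by
    unfold realF
    obtain ⟨d, hd⟩ : ∃ d, deg m t = d + 1 := ⟨deg m t - 1, by have := deg_pos hm (t := t); omega⟩
    rw [hd, Finset.prod_range_succ']
    have h1 : (1 : ℝ) ≤ ∏ k ∈ Finset.range d, (b + t + ((k + 1 : ℕ) : ℝ)) := by
      rw [← Finset.prod_const_one (s := Finset.range d)]
      refine Finset.prod_le_prod (fun _ _ => zero_le_one) fun i _ => ?_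
      have : (0 : ℝ) ≤ (i + 1 : ℕ) := Nat.cast_nonneg _
      have : (0 : ℝ) ≤ t := Nat.cast_nonneg _
      linarith
    have h2 : x / c ≤ b + t + ((0 : ℕ) : ℝ) := by
      have : (0 : ℝ) ≤ t := Nat.cast_nonneg _
      simp; linarith
    calc x = c * (1 * (x / c)) := by field_simp
      _ ≤ _ := by gcongr
  have hivt := intermediate_value_Icc (show (-t : ℝ) ≤ b by
    have : (0 : ℝ) ≤ t := Nat.cast_nonneg _
    linarith) (continuous_realF m t).continuousOn
  obtain ⟨θ, hθ, hθx⟩ := hivt ⟨by rw [h0]; exact hx.le, hbx⟩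
  refine ⟨θ, lt_of_le_of_ne hθ.1 ?_, hθx⟩
  rintro rfl
  rw [h0] at hθx
  exact hx.ne hθx

theorem lambdaOne_realF {θ : ℝ} (hθ : -t < θ) : lambdaOne m t (realF m t θ : ℂ) = θ := by
  by_contra hne
  obtain ⟨h1, h2⟩ := lambdaOne_spec hm t (realF m t θ : ℂ)
  have := re_lt_of_norm_le hm t hθ rfl (by
    rw [Complex.norm_real, Real.norm_eq_abs, abs_of_pos (realF_pos hm t hθ)]) h1 hne
  have h3 := h2 θ (F_eval_ofReal hm t θ)
  rw [Complex.ofReal_re] at h3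
  linarith

theorem realF_mem_D {s θ : ℝ} (hθ : -t < θ) (hs : s < θ) : (realF m t θ : ℂ) ∈ D m t s := by
  rw [mem_D_iff hm, lambdaOne_realF hm t hθ]
  refine ⟨by simpa, ?_, fun θ' h1 h2 => ?_⟩
  · rw [derivative_F_eval hm t hθ]
    exact_mod_cast (mul_pos (realF_pos hm t hθ) (logDerivF_pos hm t hθ)).ne'
  · rw [Complex.ofReal_re]
    exact re_lt_of_norm_le hm t hθ rfl (by
      rw [Complex.norm_real, Real.norm_eq_abs, abs_of_pos (realF_pos hm t hθ)]) h2 h1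

theorem lambdaReal_realF {θ : ℝ} (hθ : -t < θ) : lambdaReal m t (realF m t θ) = θ := by
  unfold lambdaReal
  rw [lambdaOne_realF hm t hθ, Complex.ofReal_re]

theorem lambdaReal_spec {x : ℝ} (hx : 0 < x) :
    -t < lambdaReal m t x ∧ realF m t (lambdaReal m t x) = x ∧
      lambdaOne m t x = lambdaReal m t x := by
  obtain ⟨θ, hθ, rfl⟩ := exists_realF_eq hm t hx
  rw [lambdaReal_realF hm t hθ]
  exact ⟨hθ, rfl, lambdaOne_realF hm t hθ⟩

theorem ofReal_mem_D {x : ℝ} (hx : 0 < x) {s : ℝ} (hs : s < lambdaReal m t x) :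
    (x : ℂ) ∈ D m t s := by
  obtain ⟨h1, h2, -⟩ := lambdaReal_spec hm t hx
  have := realF_mem_D hm t h1 hs
  rwa [h2] at this

/-- This is why only a neighbourhood of the positive axis matters in the Cauchy integral over a
circle. -/
theorem re_lambdaOne_lt {x : ℝ} (hx : 0 < x) {z : ℂ} (hz : ‖z‖ ≤ x) (hne : z ≠ x) :
    (lambdaOne m t z).re < lambdaReal m t x := by
  obtain ⟨h1, h2, -⟩ := lambdaReal_spec hm t hx
  refine re_lt_of_norm_le hm t h1 h2 hz (lambdaOne_spec hm t z).1 fun h => hne ?_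
  have := (lambdaOne_spec hm t z).1
  rw [h, F_eval_ofReal hm, h2] at this
  exact this.symm

theorem lambdaReal_lt {x y : ℝ} (hx : 0 < x) (hxy : x < y) :
    lambdaReal m t x < lambdaReal m t y := by
  obtain ⟨h1, h2, -⟩ := lambdaReal_spec hm t hx
  obtain ⟨h1', h2', -⟩ := lambdaReal_spec hm t (hx.trans hxy)
  refine ((strictMonoOn_realF hm t).lt_iff_lt h1.le h1'.le).1 ?_
  rwa [h2, h2']

theorem realF_one : realF m t 1 = 1 / m := by
  have h0 : (m : ℝ) ≠ 0 := by exact_mod_cast (by omega : m ≠ 0)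
  have h1 : (t.factorial : ℝ) * ∏ i ∈ Finset.range (deg m t), (1 + (t : ℝ) + i) =
      (m * t + m - 1).factorial := by
    rw [← add_deg hm, ← Finset.prod_range_add_one_eq_factorial,
      ← Finset.prod_range_add_one_eq_factorial, Finset.prod_range_add]
    push_cast
    congr 1
    refine Finset.prod_congr rfl fun i _ => by ring
  unfold realF
  have h2 : ((m * t + m - 1).factorial : ℝ) ≠ 0 := by exact_mod_cast Nat.factorial_ne_zero _
  rw [div_mul_eq_mul_div, h1]
  field_simp

/-- The excluded value is `1/m = F(1)`, where `λ₁` equals `1`. So the shift by `(m-1)/(zm-1)` is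
legitimate throughout `D₁`. -/
theorem mul_ne_one_of_mem_D {z : ℂ} (hz : z ∈ D m t 1) : z * m ≠ 1 := by
  intro h
  have hmC : (m : ℂ) ≠ 0 := by exact_mod_cast (by omega : m ≠ 0)
  have hz' : z = ((realF m t 1 : ℝ) : ℂ) := by
    rw [realF_one hm]; push_cast; field_simp; exact h
  have h1 : (-t : ℝ) < 1 := by have : (0 : ℝ) ≤ t := Nat.cast_nonneg _
                               linarith
  have h2 : (1 : ℝ) < (lambdaOne m t z).re := hz.1
  rw [hz', lambdaOne_realF hm t h1, Complex.ofReal_re] at h2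
  exact lt_irrefl _ h2

end roots

/-! ### The parameters `α` and `β`, and the variance -/

/-- The sum of the squares of the terms of `logDerivF`. -/
def squareSum (m t : ℕ) (θ : ℝ) : ℝ := ∑ i ∈ Finset.range (deg m t), 1 / (θ + t + i) ^ 2

/-- `α` as a function of `β`: the value of `β λ₁'(β)`. -/
def alphaOf (m t : ℕ) (x : ℝ) : ℝ := 1 / logDerivF m t (lambdaReal m t x)

/-- The variance `α + β² λ₁''(β)` as a function of `β`. -/
def varOf (m t : ℕ) (x : ℝ) : ℝ :=
  squareSum m t (lambdaReal m t x) / logDerivF m t (lambdaReal m t x) ^ 3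

section beta

variable {m : ℕ} (hm : 2 ≤ m) (t : ℕ)

theorem hasDerivAt_logDerivF {θ : ℝ} (hθ : -t < θ) :
    HasDerivAt (logDerivF m t) (-squareSum m t θ) θ := by
  unfold logDerivF squareSum
  rw [← Finset.sum_neg_distrib]
  refine HasDerivAt.fun_sum fun i _ => ?_
  have : (0 : ℝ) ≤ i := Nat.cast_nonneg i
  have hne : θ + t + i ≠ 0 := by linarith
  have h := (((hasDerivAt_id θ).add_const (t : ℝ)).add_const (i : ℝ)).inv hne
  simp only [one_div]
  refine h.congr_deriv ?_
  simp [neg_div]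

theorem logDerivF_lt {a b : ℝ} (hm : 2 ≤ m) (ha : -t < a) (hab : a < b) :
    logDerivF m t b < logDerivF m t a := by
  unfold logDerivF
  refine Finset.sum_lt_sum_of_nonempty (Finset.nonempty_range_iff.2 (deg_pos hm).ne') fun i _ => ?_
  have : (0 : ℝ) ≤ i := Nat.cast_nonneg i
  exact one_div_lt_one_div_of_lt (by linarith) (by linarith)

include hm

/-- The inverse function rule gives `λ₁' = 1/F'(λ₁)`, and `F' = F · logDerivF` with `F(λ₁(x)) = x`.
-/
theorem hasDerivAt_lambdaReal {x : ℝ} (hx : 0 < x) :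
    HasDerivAt (lambdaReal m t) (alphaOf m t x / x) x := by
  obtain ⟨h1, h2, h3⟩ := lambdaReal_spec hm t hx
  have h := (hasDerivAt_lambdaOne hm t (ofReal_mem_D hm t hx h1)).real_of_complex
  rw [h3, derivative_F_eval hm t h1, h2, ← Complex.ofReal_inv, Complex.ofReal_re] at h
  refine h.congr_deriv ?_
  unfold alphaOf
  rw [mul_inv]
  field_simp

theorem varOf_pos {x : ℝ} (hx : 0 < x) : 0 < varOf m t x := by
  have h1 := (lambdaReal_spec hm t hx).1
  refine div_pos (Finset.sum_pos (fun i _ => ?_)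
    (Finset.nonempty_range_iff.2 (deg_pos hm).ne')) (pow_pos (logDerivF_pos hm t h1) 3)
  have : (0 : ℝ) ≤ i := Nat.cast_nonneg i
  have : 0 < lambdaReal m t x + t + i := by linarith
  positivity

theorem hasDerivAt_alphaOf {x : ℝ} (hx : 0 < x) :
    HasDerivAt (alphaOf m t) (varOf m t x / x) x := by
  obtain ⟨h1, h2, h3⟩ := lambdaReal_spec hm t hx
  have hS := logDerivF_pos hm t h1
  have h := ((hasDerivAt_logDerivF (m := m) t h1).comp x (hasDerivAt_lambdaReal hm t hx)).inv hS.ne'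
  have he : alphaOf m t = (logDerivF m t ∘ lambdaReal m t)⁻¹ := by
    ext y; simp [alphaOf]
  rw [he]
  refine h.congr_deriv ?_
  simp only [Function.comp, varOf, alphaOf]
  have := hS.ne'
  field_simp

theorem deriv_lambdaReal {x : ℝ} (hx : 0 < x) : x * deriv (lambdaReal m t) x = alphaOf m t x := by
  rw [(hasDerivAt_lambdaReal hm t hx).deriv]; field_simp

/-- The left side is `x (x λ₁'(x))'`, that is, `x` times the derivative of `alphaOf`. This makes its
positivity visible. -/
theorem varOf_eq {x : ℝ} (hx : 0 < x) :
    alphaOf m t x + x ^ 2 * iteratedDeriv 2 (lambdaReal m t) x = varOf m t x := by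
  have hev : deriv (lambdaReal m t) =ᶠ[𝓝 x] fun y => alphaOf m t y / y := by
    filter_upwards [lt_mem_nhds hx] with y hy
    exact (hasDerivAt_lambdaReal hm t hy).deriv
  have h := (hasDerivAt_alphaOf hm t hx).div (hasDerivAt_id x) hx.ne'
  rw [iteratedDeriv_succ, iteratedDeriv_one, hev.deriv_eq, HasDerivAt.deriv (f := fun y =>
    alphaOf m t y / y) h]
  simp only [id]
  field_simp
  ring

theorem alphaOf_lt {x y : ℝ} (hx : 0 < x) (hxy : x < y) : alphaOf m t x < alphaOf m t y := by
  have h1 := (lambdaReal_spec hm t hx).1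
  have h2 := (lambdaReal_spec hm t (hx.trans hxy)).1
  exact one_div_lt_one_div_of_lt (logDerivF_pos hm t h2)
    (logDerivF_lt t hm h1 (lambdaReal_lt hm t hx hxy))

theorem isBeta_iff {α β : ℝ} : IsBeta m t α β ↔ 0 < β ∧ alphaOf m t β = α := by
  unfold IsBeta
  constructor
  · rintro ⟨h1, h2⟩; exact ⟨h1, by rw [← deriv_lambdaReal hm t h1, h2]⟩
  · rintro ⟨h1, h2⟩; exact ⟨h1, by rw [deriv_lambdaReal hm t h1, h2]⟩

/-- The equation is `logDerivF = 1/α`. At `θ = -t+α` the term `i = 0` alone is `1/α`; at `θ =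
-t+(d+1)α` each of the `d+1` terms is at most `1/((d+1)α)`. -/
theorem exists_alphaOf_eq {α : ℝ} (hα : 0 < α) : ∃ x, 0 < x ∧ alphaOf m t x = α := by
  obtain ⟨d, hd⟩ : ∃ d, deg m t = d + 1 := ⟨deg m t - 1, by have := deg_pos hm (t := t); omega⟩
  have hle : -(t : ℝ) + α ≤ -t + (d + 1) * α := by
    have : (0 : ℝ) ≤ d * α := by positivity
    linarith
  have hcont : ContinuousOn (logDerivF m t) (Set.Icc (-(t : ℝ) + α) (-t + (d + 1) * α)) :=
    fun θ hθ => (hasDerivAt_logDerivF (m := m) t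
      (by linarith [hθ.1])).continuousAt.continuousWithinAt
  have hl : 1 / α ≤ logDerivF m t (-(t : ℝ) + α) := by
    unfold logDerivF
    refine le_trans (le_of_eq ?_) (Finset.single_le_sum (f := fun i : ℕ => 1 / (-(t : ℝ) + α + t + i))
      (fun i _ => ?_) (Finset.mem_range.2 (deg_pos hm (t := t))))
    · congr 1; push_cast; ring
    · have : (0 : ℝ) ≤ i := Nat.cast_nonneg i
      have : 0 < -(t : ℝ) + α + t + i := by linarith
      positivity
  have hr : logDerivF m t (-t + (d + 1) * α) ≤ 1 / α := by
    unfold logDerivF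
    rw [hd]
    calc _ ≤ ∑ _i ∈ Finset.range (d + 1), 1 / ((d + 1) * α) := by
          refine Finset.sum_le_sum fun i _ => ?_
          have : (0 : ℝ) ≤ i := Nat.cast_nonneg i
          exact one_div_le_one_div_of_le (by positivity) (by linarith)
      _ = _ := by
          rw [Finset.sum_const, Finset.card_range, nsmul_eq_mul]
          push_cast
          field_simp
  obtain ⟨θ, hθ, hθα⟩ := intermediate_value_Icc' hle hcont ⟨hr, hl⟩
  have hθt : -(t : ℝ) < θ := by linarith [hθ.1]
  refine ⟨realF m t θ, realF_pos hm t hθt, ?_⟩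
  rw [alphaOf, lambdaReal_realF hm t hθt, hθα, one_div_one_div]

theorem existsUnique_isBeta {α : ℝ} (hα : 0 < α) : ∃! β, IsBeta m t α β := by
  obtain ⟨x, hx, hxα⟩ := exists_alphaOf_eq hm t hα
  refine ⟨x, (isBeta_iff hm t).2 ⟨hx, hxα⟩, fun y hy => ?_⟩
  obtain ⟨h1, h2⟩ := (isBeta_iff hm t).1 hy
  rcases lt_trichotomy y x with h | h | h
  · have := alphaOf_lt hm t h1 h
    linarith
  · exact h
  · have := alphaOf_lt hm t hx h
    linarith

theorem beta_spec {α : ℝ} (hα : 0 < α) : 0 < beta m t α ∧ alphaOf m t (beta m t α) = α :=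
  (isBeta_iff hm t).1 (Classical.epsilon_spec (existsUnique_isBeta hm t hα).exists)

theorem beta_le {α α' : ℝ} (hα : 0 < α) (h : α ≤ α') : beta m t α ≤ beta m t α' := by
  obtain ⟨h1, h2⟩ := beta_spec hm t hα
  obtain ⟨h1', h2'⟩ := beta_spec hm t (hα.trans_le h)
  by_contra! hcon
  have := alphaOf_lt hm t h1' hcon
  linarith

/-- Identifies `α₀` as the value of `β λ₁'(β)` at the point where `λ₁ = 1`. Since `logDerivF`
decreases, `α > α₀` is then equivalent to `λ₁(β(α)) > 1`. -/
theorem alphaZero_eq : alphaZero m t = 1 / logDerivF m t 1 := by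
  unfold alphaZero logDerivF
  rw [one_div]
  congr 1
  have hd := add_deg hm (t := t)
  have hp := deg_pos hm (t := t)
  have : Finset.Icc (t + 1) ((t + 1) * m - 1) = Finset.Ico (t + 1) (t + 1 + deg m t) := by
    ext i
    have : (t + 1) * m = m * t + m := by ring
    simp only [Finset.mem_Icc, Finset.mem_Ico]; omega
  rw [this, Finset.sum_Ico_eq_sum_range]
  refine Finset.sum_congr (by congr 1; omega) fun i _ => ?_
  push_cast
  congr 1; ring

theorem alphaZero_pos : 0 < alphaZero m t := by
  rw [alphaZero_eq hm]
  refine one_div_pos.2 (logDerivF_pos hm t ?_)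
  have : (0 : ℝ) ≤ t := Nat.cast_nonneg t
  linarith

theorem one_lt_lambdaReal_beta {α : ℝ} (hα : alphaZero m t < α) :
    1 < lambdaReal m t (beta m t α) := by
  obtain ⟨h1, h2⟩ := beta_spec hm t ((alphaZero_pos hm t).trans hα)
  have ht : (0 : ℝ) ≤ t := Nat.cast_nonneg t
  have h3 := (lambdaReal_spec hm t h1).1
  by_contra! hcon
  rw [alphaZero_eq hm, ← h2, alphaOf, one_div_lt_one_div (logDerivF_pos hm t (by linarith))
    (logDerivF_pos hm t h3)] at hα
  rcases hcon.lt_or_eq with h | h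
  · exact lt_asymm hα (logDerivF_lt t hm h3 h)
  · rw [h] at hα; exact lt_irrefl _ hα

theorem beta_mem_D {α : ℝ} (hα : alphaZero m t < α) : ((beta m t α : ℝ) : ℂ) ∈ D m t 1 :=
  ofReal_mem_D hm t (beta_spec hm t ((alphaZero_pos hm t).trans hα)).1
    (one_lt_lambdaReal_beta hm t hα)

/-- A real `x` with `λ₁(x) > 1` is larger than `1 / m`. -/
theorem one_lt_mul_of_one_lt_lambdaReal {x : ℝ} (hx : 0 < x) (h : 1 < lambdaReal m t x) :
    1 < x * m := by
  obtain ⟨h1, h2, -⟩ := lambdaReal_spec hm t hx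
  have ht : (0 : ℝ) ≤ t := Nat.cast_nonneg t
  have h3 := strictMonoOn_realF hm t (show (1 : ℝ) ∈ Set.Ici (-t : ℝ) from by
    simp only [Set.mem_Ici]; linarith) (show lambdaReal m t x ∈ Set.Ici (-t : ℝ) from h1.le) h
  rw [realF_one hm, h2] at h3
  have hm0 : (0 : ℝ) < m := by exact_mod_cast (by omega : 0 < m)
  rwa [div_lt_iff₀ hm0] at h3

end beta

/-! ### The leading coefficient `E`: existence, analyticity, positivity -/

section leading

variable {m t : ℕ} (hm : 2 ≤ m) (rule : SupplementaryRule m t)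

theorem roots_bounded_near (hm : 2 ≤ m) (t : ℕ) (z₀ : ℂ) :
    ∃ R, 0 ≤ R ∧ ∀ᶠ z in 𝓝 z₀, ∀ θ, (F m t).eval θ = z → ‖θ‖ ≤ R := by
  obtain ⟨R, hR⟩ := (finite_roots hm t z₀).isBounded.exists_norm_le
  obtain ⟨η, hη, h⟩ := exists_near_root hm t one_pos
  refine ⟨|R| + 1, by positivity, ?_⟩
  filter_upwards [Metric.ball_mem_nhds z₀ hη] with z hz θ hθ
  rw [Metric.mem_ball, dist_eq_norm] at hz
  obtain ⟨θ', h1, h2⟩ := h _ _ hz θ hθ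
  have h3 := (hR θ' h1).trans (le_abs_self R)
  have := norm_add_le (θ - θ') θ'
  rw [sub_add_cancel] at this
  linarith

theorem continuousAt_shift {z₀ : ℂ} (hz : z₀ * m ≠ 1) :
    ContinuousAt (fun z : ℂ => ((m : ℂ) - 1) / (z * m - 1)) z₀ :=
  continuousAt_const.div (by fun_prop) (sub_ne_zero.2 hz)

theorem shiftedMean_bounded_near {z₀ : ℂ} (hz : z₀ * m ≠ 1) (J : ℕ) :
    ∃ M : ℝ, 0 ≤ M ∧ ∀ᶠ z : ℂ in 𝓝 z₀, z * m ≠ 1 ∧ (∀ j ≤ J, ‖shiftedMean hm rule z j‖ ≤ M) ∧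
      ‖((m : ℂ) - 1) / (z * m - 1)‖ ≤ M := by
  have hγ := (continuousAt_shift hz).norm
  have hb : ∀ j, ContinuousAt (fun z => ‖shiftedMean hm rule z j‖) z₀ := fun j =>
    ((continuous_expProfilePoly hm rule j).continuousAt.add (continuousAt_shift hz)).norm
  set M : ℝ := ∑ j ∈ Finset.range (J + 1), (‖shiftedMean hm rule z₀ j‖ + 1) +
    (‖((m : ℂ) - 1) / (z₀ * m - 1)‖ + 1) with hM
  have hne : ∀ᶠ z : ℂ in 𝓝 z₀, z * m ≠ 1 :=
    (continuous_id.mul continuous_const).continuousAt.eventually_ne hz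
  refine ⟨M, by positivity, ?_⟩
  have h1 : ∀ᶠ z in 𝓝 z₀, ∀ j ∈ Finset.range (J + 1),
      ‖shiftedMean hm rule z j‖ < ‖shiftedMean hm rule z₀ j‖ + 1 := by
    rw [Filter.eventually_all_finset]
    exact fun j _ => (hb j).eventually_lt continuousAt_const (by linarith)
  have h2 : ∀ᶠ z : ℂ in 𝓝 z₀, ‖((m : ℂ) - 1) / (z * m - 1)‖ <
      ‖((m : ℂ) - 1) / (z₀ * m - 1)‖ + 1 :=
    hγ.eventually_lt continuousAt_const (by linarith)
  filter_upwards [hne, h1, h2] with z e1 e2 e3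
  refine ⟨e1, fun j hj => ?_, ?_⟩
  · have hj' : j ∈ Finset.range (J + 1) := Finset.mem_range.2 (by omega)
    have h3 := Finset.single_le_sum (f := fun j => ‖shiftedMean hm rule z₀ j‖ + 1)
      (fun _ _ => by positivity) hj'
    have h4 := e2 j hj'
    have h5 : 0 ≤ ‖((m : ℂ) - 1) / (z₀ * m - 1)‖ := norm_nonneg _
    linarith
  · have : 0 ≤ ∑ j ∈ Finset.range (J + 1), (‖shiftedMean hm rule z₀ j‖ + 1) := by positivity
    linarith

/-- A uniform bound for the mean near a point where the real parts of all roots are less than `κ`. -/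
theorem mean_bound_near {z₀ : ℂ} (hz : z₀ * m ≠ 1) {κ : ℝ} (hκ : 1 ≤ κ)
    (h : (lambdaOne m t z₀).re < κ) :
    ∃ C, 0 ≤ C ∧ ∀ᶠ z in 𝓝 z₀, ∀ n : ℕ, max t 1 ≤ n →
      ‖expProfilePoly hm rule n z‖ ≤ C * (n : ℝ) ^ (κ - 1) := by
  obtain ⟨R, hR, hroots⟩ := roots_bounded_near hm t z₀
  obtain ⟨M, hM, hinit⟩ := shiftedMean_bounded_near hm rule hz (m * t + m)
  set δ := (κ - (lambdaOne m t z₀).re) / 2 with hδ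
  have hδ0 : 0 < δ := by rw [hδ]; linarith
  obtain ⟨C, hC, hbound⟩ := shiftedMean_bound hm rule hκ hδ0 hR hM
  refine ⟨C + M, by positivity, ?_⟩
  have hre : ∀ᶠ z in 𝓝 z₀, (lambdaOne m t z).re < κ - δ :=
    (continuous_lambdaOne_re hm t).continuousAt.eventually_lt continuousAt_const
      (by rw [hδ]; linarith)
  filter_upwards [hroots, hinit, hre] with z h1 ⟨h2, h3, h4⟩ h5 n hn
  have h6 := hbound z h2 (fun θ hθ => ⟨h1 θ hθ, ((lambdaOne_spec hm t z).2 θ hθ).trans h5.le⟩)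
    (fun j hj => h3 j (by omega)) n hn
  have h7 : expProfilePoly hm rule n z = shiftedMean hm rule z n - ((m : ℂ) - 1) / (z * m - 1) := by
    unfold shiftedMean; ring
  have h8 : (1 : ℝ) ≤ (n : ℝ) ^ (κ - 1) :=
    Real.one_le_rpow (by exact_mod_cast (le_max_right t 1).trans hn) (by linarith)
  rw [h7, add_mul]
  refine (norm_sub_le _ _).trans (add_le_add h6 (h4.trans ?_))
  nlinarith

/-- The leading coefficient in the asymptotics of the mean. -/
def leadingCoeff (z : ℂ) : ℂ :=
  limUnder atTop fun n : ℕ => expProfilePoly hm rule n z / (n : ℂ) ^ (lambdaOne m t z - 1)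

/-- Near `z₀` the roots, the initial values and the spectral gap are controlled uniformly, so
`mean_limit` applies with one set of constants. -/
theorem leadingCoeff_near {z₀ : ℂ} (hz : z₀ ∈ D m t 1) :
    ∃ δ C : ℝ, 0 < δ ∧ 0 ≤ C ∧ ∀ᶠ z in 𝓝 z₀, ∀ n : ℕ, max t 1 ≤ n →
      ‖expProfilePoly hm rule n z / (n : ℂ) ^ (lambdaOne m t z - 1) - leadingCoeff hm rule z‖ ≤
        C * (n : ℝ) ^ (-δ) := by
  obtain ⟨R, hR, hroots⟩ := roots_bounded_near hm t z₀
  obtain ⟨M, hM, hinit⟩ := shiftedMean_bounded_near hm rule (mul_ne_one_of_mem_D hm t hz) (m * t + m)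
  obtain ⟨κ₀, hκ₀, hloc⟩ := D_local hm t hz
  have h1 : (1 : ℝ) < (lambdaOne m t z₀).re := hz.1
  set l := (lambdaOne m t z₀).re with hl
  -- The gap between `max κ₀ 1` and `l` is cut into thirds: one below `κ` for the other roots, one
  -- between `κ` and `κ+δ`, one for the motion of `λ₁(z)`. The bound `1` is included because the
  -- shift constant grows like `n^0`.
  set κ := max κ₀ 1 + (l - max κ₀ 1) / 3 with hκ
  have hmax : max κ₀ 1 < l := max_lt hκ₀ h1
  set δ := min ((l - max κ₀ 1) / 3) 1 with hδ
  have hδ0 : 0 < δ := lt_min (by linarith) one_pos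
  have hδ1 : δ ≤ (l - max κ₀ 1) / 3 := min_le_left _ _
  have hκ1 : 1 ≤ κ := by have := le_max_right κ₀ 1; linarith
  obtain ⟨C, hC, hlim⟩ := mean_limit hm rule hκ1 hδ0 (min_le_right _ _) hR hM
  refine ⟨δ, C, hδ0, hC, ?_⟩
  filter_upwards [hroots, hinit, hloc δ hδ0] with z e1 ⟨e2, e3, e4⟩ ⟨e5, e6, e7⟩
  have hsp := (lambdaOne_spec hm t z).1
  have hre := (abs_lt.1 ((Complex.abs_re_le_norm _).trans_lt e5)).1
  rw [Complex.sub_re, ← hl] at hre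
  obtain ⟨E, hE⟩ := hlim z (lambdaOne m t z) e2 hsp (e1 _ hsp) (by linarith) e6
    (fun θ h2 h3 => ⟨e1 θ h3, by
      have := e7 θ h2 h3
      have := le_max_left κ₀ 1
      linarith⟩) e3 e4
  have ht : Tendsto (fun n : ℕ => expProfilePoly hm rule n z / (n : ℂ) ^ (lambdaOne m t z - 1))
      atTop (𝓝 E) := by
    rw [tendsto_iff_norm_sub_tendsto_zero]
    have hv : Tendsto (fun n : ℕ => C * (n : ℝ) ^ (-δ)) atTop (𝓝 0) := by
      simpa using ((tendsto_rpow_neg_atTop hδ0).comp tendsto_natCast_atTop_atTop).const_mul C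
    refine squeeze_zero' (Eventually.of_forall fun _ => norm_nonneg _) ?_ hv
    filter_upwards [eventually_ge_atTop (max t 1)] with n hn
    exact hE n hn
  have : leadingCoeff hm rule z = E := ht.limUnder_eq
  rw [this]
  exact hE

theorem leadingCoeff_tendsto {z : ℂ} (hz : z ∈ D m t 1) :
    Tendsto (fun n : ℕ => expProfilePoly hm rule n z / (n : ℂ) ^ (lambdaOne m t z - 1)) atTop
      (𝓝 (leadingCoeff hm rule z)) := by
  obtain ⟨δ, C, hδ, hC, h⟩ := leadingCoeff_near hm rule hz
  have h := h.self_of_nhds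
  rw [tendsto_iff_norm_sub_tendsto_zero]
  have hv : Tendsto (fun n : ℕ => C * (n : ℝ) ^ (-δ)) atTop (𝓝 0) := by
    simpa using ((tendsto_rpow_neg_atTop hδ).comp tendsto_natCast_atTop_atTop).const_mul C
  refine squeeze_zero' (Eventually.of_forall fun _ => norm_nonneg _) ?_ hv
  filter_upwards [eventually_ge_atTop (max t 1)] with n hn
  exact h n hn

/-- `E` is a locally uniform limit of the holomorphic functions `expProfilePoly / n^(λ₁-1)`. -/
theorem leadingCoeff_analytic : AnalyticOnNhd ℂ (leadingCoeff hm rule) (D m t 1) := by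
  refine DifferentiableOn.analyticOnNhd ?_ (isOpen_D hm t 1)
  refine TendstoLocallyUniformlyOn.differentiableOn (φ := atTop) (F := fun (n : ℕ) z =>
    expProfilePoly hm rule n z / (n : ℂ) ^ (lambdaOne m t z - 1)) ?_ ?_ (isOpen_D hm t 1)
  · rw [Metric.tendstoLocallyUniformlyOn_iff]
    intro ε hε z hz
    obtain ⟨δ, C, hδ, hC, h⟩ := leadingCoeff_near hm rule hz
    refine ⟨_, mem_nhdsWithin_of_mem_nhds h, ?_⟩
    have hv : Tendsto (fun n : ℕ => C * (n : ℝ) ^ (-δ)) atTop (𝓝 0) := by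
      simpa using ((tendsto_rpow_neg_atTop hδ).comp tendsto_natCast_atTop_atTop).const_mul C
    filter_upwards [eventually_ge_atTop (max t 1), hv.eventually_lt_const hε] with n hn hn' y hy
    rw [dist_comm, dist_eq_norm]
    exact (hy n hn).trans_lt hn'
  · filter_upwards [eventually_ge_atTop 1] with n hn
    have hnC : (n : ℂ) ≠ 0 := by exact_mod_cast (by omega : n ≠ 0)
    refine (differentiable_expProfilePoly hm rule n).differentiableOn.div ?_ fun z _ => ?_
    · exact ((analyticOnNhd_lambdaOne hm t 1).differentiableOn.sub_const 1).const_cpow (Or.inl hnC)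
    · rw [Complex.cpow_def_of_ne_zero hnC]; exact Complex.exp_ne_zero _

/-- Solutions of the Euler equation with nonnegative initial coefficients are nonnegative. -/
theorem euler_nonneg {f : PowerSeries ℂ} {d : ℕ} {c : ℝ} (hc : 0 ≤ c) (hd : 0 < d)
    (h : (PowerSeries.derivative ℂ)^[d] f = PowerSeries.C (c : ℂ) *
      ((PowerSeries.mk fun n => ((d - 1 + n).choose (d - 1) : ℂ)) * f))
    (h0 : ∀ n < d, 0 ≤ (PowerSeries.coeff n f).re) (n : ℕ) : 0 ≤ (PowerSeries.coeff n f).re := by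
  induction n using Nat.strong_induction_on with
  | _ n ih =>
    rcases Nat.lt_or_ge n d with hn | hn
    · exact h0 n hn
    · obtain ⟨k, rfl⟩ : ∃ k, n = k + d := ⟨n - d, by omega⟩
      have h1 := congrArg (PowerSeries.coeff k) h
      rw [PowerSeries.coeff_iterate_derivative, PowerSeries.coeff_C_mul, PowerSeries.coeff_mul] at h1
      have h2 := congrArg Complex.re h1
      have hpos : (0 : ℝ) < ((k + 1).ascFactorial d : ℕ) := by
        exact_mod_cast Nat.ascFactorial_pos _ _
      rw [← Complex.ofReal_natCast, Complex.re_ofReal_mul, Complex.re_ofReal_mul, Complex.re_sum] at h2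
      have h4 : 0 ≤ (((k + 1).ascFactorial d : ℕ) : ℝ) * (PowerSeries.coeff (k + d) f).re := by
        rw [h2]
        refine mul_nonneg hc (Finset.sum_nonneg fun p hp => ?_)
        have hp' := Finset.HasAntidiagonal.mem_antidiagonal.1 hp
        rw [PowerSeries.coeff_mk, ← Complex.ofReal_natCast, Complex.re_ofReal_mul]
        exact mul_nonneg (Nat.cast_nonneg _) (ih _ (by omega))
      exact nonneg_of_mul_nonneg_right h4 hpos

/-- The power series `(1 - x)^{-s}`. -/
def binomSeries (s : ℝ) : PowerSeries ℂ := PowerSeries.mk fun n => (binomCoeff s n : ℂ)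

theorem aeval_binomSeries (s : ℝ) (p : Polynomial ℂ) :
    Polynomial.aeval eulerOp p (binomSeries s) = p.eval (s : ℂ) • binomSeries s := by
  refine Module.End.aeval_apply_of_hasEigenvector ⟨?_, ?_⟩
  · rw [Module.End.mem_eigenspace_iff]
    ext n
    rw [coeff_eulerOp, binomSeries, PowerSeries.coeff_mk, PowerSeries.coeff_mk, map_smul,
      PowerSeries.coeff_mk, smul_eq_mul]
    have := congrArg (fun x : ℝ => (x : ℂ)) (binomCoeff_succ s n)
    push_cast at this
    rw [this]; ring
  · intro h
    have := congrArg (PowerSeries.coeff 0) h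
    rw [binomSeries, PowerSeries.coeff_mk, binomCoeff_zero] at this
    simp at this

theorem shiftedMean_re_pos {x : ℝ} (hx : 0 < x) (hxm : 1 < x * m) (n : ℕ) :
    0 < (shiftedMean hm rule x n).re := by
  have h1 : ((m : ℂ) - 1) / (x * m - 1) = ((((m : ℝ) - 1) / (x * m - 1) : ℝ) : ℂ) := by
    push_cast; rfl
  have hm1 : (1 : ℝ) < m := by exact_mod_cast (by omega : 1 < m)
  unfold shiftedMean
  rw [expProfilePoly_ofReal, h1, ← Complex.ofReal_add, Complex.ofReal_re]
  have h2 : 0 ≤ ∑ k ∈ Finset.range n, expProfile hm rule n k * x ^ k :=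
    Finset.sum_nonneg fun k _ => mul_nonneg (expProfile_nonneg hm rule n k) (by positivity)
  have h3 : 0 < ((m : ℝ) - 1) / (x * m - 1) := div_pos (by linarith) (by linarith)
  linarith

/-- Comparison principle: `B - c (1-X)^(-s)` solves the same Euler equation as `B`. It stays
nonnegative by `euler_nonneg` once its first `deg m t` coefficients are. -/
theorem shiftedMean_lower {x : ℝ} (hx : 0 < x) (hl : 1 < lambdaReal m t x) :
    ∃ c > 0, ∀ n, c * binomCoeff (lambdaReal m t x + t) n ≤
      t.factorial * (n + t).choose t * (shiftedMean hm rule x (n + t)).re := by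
  have hxm := one_lt_mul_of_one_lt_lambdaReal hm t hx hl
  obtain ⟨h1, h2, h3⟩ := lambdaReal_spec hm t hx
  set s := lambdaReal m t x + t with hs
  have hs0 : 0 < s := by rw [hs]; linarith
  have hzne : (x : ℂ) * m ≠ 1 := by exact_mod_cast hxm.ne'
  set B := meanSeries hm rule x with hB
  have hBre : ∀ n, (PowerSeries.coeff n B).re =
      t.factorial * (n + t).choose t * (shiftedMean hm rule x (n + t)).re := by
    intro n
    rw [hB, coeff_meanSeries, ← Nat.cast_mul, ← Complex.ofReal_natCast, Complex.re_ofReal_mul]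
    push_cast; rfl
  have hBpos : ∀ n, 0 < (PowerSeries.coeff n B).re := by
    intro n
    rw [hBre]
    have h4 := shiftedMean_re_pos hm rule hx hxm (n + t)
    have h5 : (0 : ℝ) < (n + t).choose t := by
      exact_mod_cast Nat.choose_pos (Nat.le_add_left t n)
    positivity
  -- An explicit positive `c` below all ratios of the initial coefficients of `B` to those of
  -- `(1-X)^(-s)`.
  set c : ℝ := (∑ j ∈ Finset.range (deg m t), binomCoeff s j / (PowerSeries.coeff j B).re)⁻¹ with hc
  have hterm : ∀ j, 0 < binomCoeff s j / (PowerSeries.coeff j B).re :=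
    fun j => div_pos (binomCoeff_pos hs0 j) (hBpos j)
  have hsum : 0 < ∑ j ∈ Finset.range (deg m t), binomCoeff s j / (PowerSeries.coeff j B).re :=
    Finset.sum_pos (fun j _ => hterm j) (Finset.nonempty_range_iff.2 (deg_pos hm).ne')
  refine ⟨c, inv_pos.2 hsum, fun n => ?_⟩
  have hcoeff : ∀ n, (PowerSeries.coeff n (B - (c : ℂ) • binomSeries s)).re =
      (PowerSeries.coeff n B).re - c * binomCoeff s n := by
    intro n
    rw [map_sub, map_smul, binomSeries, PowerSeries.coeff_mk, Complex.sub_re, smul_eq_mul,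
      ← Complex.ofReal_mul, Complex.ofReal_re]
  have hK : scale m t = (((m : ℝ) * (m * t + m - 1).factorial / t.factorial : ℝ) : ℂ) := by
    unfold scale; push_cast; rfl
  have hae : Polynomial.aeval eulerOp (ascPochhammer ℂ (deg m t) - Polynomial.C (x * scale m t))
      (B - (c : ℂ) • binomSeries s) = 0 := by
    rw [map_sub, map_smul, meanSeries_aeval hm rule hzne, aeval_binomSeries]
    have : (ascPochhammer ℂ (deg m t) - Polynomial.C (x * scale m t)).eval (s : ℂ) = 0 := by
      change (charPoly m t x).eval (s : ℂ) = 0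
      rw [charPoly_eval hm, hs]
      push_cast
      rw [add_sub_cancel_right, F_eval_ofReal hm, h2]
      simp
    rw [this]; simp
  have heul := euler_of_aeval_eulerOp (deg_pos hm) hae
  rw [hK, ← Complex.ofReal_mul] at heul
  have := euler_nonneg (by positivity) (deg_pos hm) heul (fun j hj => ?_) n
  · rw [hcoeff, hBre] at this
    linarith
  · rw [hcoeff]
    have h6 := Finset.single_le_sum (f := fun j => binomCoeff s j / (PowerSeries.coeff j B).re)
      (fun j _ => (hterm j).le) (Finset.mem_range.2 hj)
    have h7 : c * (binomCoeff s j / (PowerSeries.coeff j B).re) ≤ 1 := by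
      rw [hc, inv_mul_le_iff₀ hsum, mul_one]; exact h6
    rw [← mul_div_assoc, div_le_one (hBpos j)] at h7
    linarith

/-- The approximating sequence is real. By `shiftedMean_lower` and the growth of `binomCoeff` its
limit is at least a positive multiple of `1/Γ(s)`; the constant shift is negligible because `λ₁ >
1`. -/
theorem leadingCoeff_pos {x : ℝ} (hx : 0 < x) (hxD : (x : ℂ) ∈ D m t 1) :
    (leadingCoeff hm rule x).im = 0 ∧ 0 < (leadingCoeff hm rule x).re := by
  obtain ⟨h1, h2, h3⟩ := lambdaReal_spec hm t hx
  have hl : 1 < lambdaReal m t x := hxD.1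
  have hlim := leadingCoeff_tendsto hm rule hxD
  rw [h3] at hlim
  set l := lambdaReal m t x with hldef
  set b : ℕ → ℝ := fun n => ∑ k ∈ Finset.range n, expProfile hm rule n k * x ^ k with hb
  have hreal : ∀ n : ℕ, expProfilePoly hm rule n x / (n : ℂ) ^ ((l : ℂ) - 1) =
      ((b n / (n : ℝ) ^ (l - 1) : ℝ) : ℂ) := by
    intro n
    rw [expProfilePoly_ofReal, Complex.ofReal_div, Complex.ofReal_cpow (Nat.cast_nonneg n),
      Complex.ofReal_sub, Complex.ofReal_one, Complex.ofReal_natCast]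
  simp only [hreal] at hlim
  have him := (Complex.continuous_im.tendsto _).comp hlim
  have hre := (Complex.continuous_re.tendsto _).comp hlim
  simp only [Function.comp_def, Complex.ofReal_im, Complex.ofReal_re] at him hre
  refine ⟨tendsto_nhds_unique him tendsto_const_nhds |>.symm ▸ rfl, ?_⟩
  obtain ⟨c, hc, hlow⟩ := shiftedMean_lower hm rule hx hl
  set s := l + t with hs
  have hs0 : 0 < s := by rw [hs]; linarith
  set γ : ℝ := ((m : ℝ) - 1) / (x * m - 1) with hγ
  have hshift : ∀ n, (shiftedMean hm rule x n).re = b n + γ := by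
    intro n
    have e : ((m : ℂ) - 1) / (x * m - 1) = (γ : ℂ) := by rw [hγ]; push_cast; rfl
    unfold shiftedMean
    rw [expProfilePoly_ofReal, e, ← Complex.ofReal_add, Complex.ofReal_re]
  have hlow2 : Tendsto (fun n : ℕ => c * (binomCoeff s n / ((n : ℝ) + 1) ^ (s - 1)) /
      ((t : ℝ) + 1) ^ (s - 1) - γ * ((n + t : ℕ) : ℝ) ^ (-(l - 1))) atTop
      (𝓝 (c * (Real.Gamma s)⁻¹ / ((t : ℝ) + 1) ^ (s - 1) - γ * 0)) := by
    refine (((binomCoeff_tendsto hs0).const_mul c).div_const _).sub (Tendsto.const_mul _ ?_)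
    exact ((tendsto_rpow_neg_atTop (by linarith)).comp tendsto_natCast_atTop_atTop).comp
      (tendsto_add_atTop_nat t)
  have hre2 := hre.comp (tendsto_add_atTop_nat t)
  have hge := le_of_tendsto_of_tendsto hlow2 hre2 ?_
  · refine lt_of_lt_of_le ?_ hge
    have := Real.Gamma_pos_of_pos hs0
    rw [mul_zero, sub_zero]
    positivity
  · filter_upwards [eventually_ge_atTop 1] with n hn
    have hn0 : (0 : ℝ) < ((n + t : ℕ) : ℝ) := by exact_mod_cast (by omega : 0 < n + t)
    have e1 := hlow n
    rw [hshift] at e1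
    have hfac : (t.factorial * (n + t).choose t : ℝ) ≤ ((n + t : ℕ) : ℝ) ^ t := by
      rw [← Nat.cast_mul, ← Nat.ascFactorial_eq_factorial_mul_choose]
      exact_mod_cast Nat.ascFactorial_le_pow_add n t
    have hsp := shiftedMean_re_pos hm rule hx (one_lt_mul_of_one_lt_lambdaReal hm t hx hl) (n + t)
    rw [hshift] at hsp
    have e2 : c * binomCoeff s n ≤ ((n + t : ℕ) : ℝ) ^ t * (b (n + t) + γ) :=
      e1.trans (mul_le_mul_of_nonneg_right hfac hsp.le)
    simp only [Function.comp]
    have hp1 : 0 < ((n + t : ℕ) : ℝ) ^ (l - 1) := Real.rpow_pos_of_pos hn0 _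
    rw [Real.rpow_neg hn0.le, ← div_eq_mul_inv, sub_le_iff_le_add, ← add_div]
    have hpow : ((n + t : ℕ) : ℝ) ^ (s - 1) ≤ ((n : ℝ) + 1) ^ (s - 1) * ((t : ℝ) + 1) ^ (s - 1) := by
      rw [← Real.mul_rpow (by positivity) (by positivity)]
      refine Real.rpow_le_rpow hn0.le ?_ (by rw [hs]; linarith [Nat.cast_nonneg (α := ℝ) t])
      push_cast
      nlinarith [Nat.cast_nonneg (α := ℝ) t, Nat.cast_nonneg (α := ℝ) n]
    have hsplit : ((n + t : ℕ) : ℝ) ^ (s - 1) = ((n + t : ℕ) : ℝ) ^ t * ((n + t : ℕ) : ℝ) ^ (l - 1) := by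
      rw [← Real.rpow_natCast, ← Real.rpow_add hn0]; congr 1; rw [hs]; ring
    have hu := binomCoeff_pos hs0 n
    rw [mul_div_assoc, div_div, ← mul_div_assoc]
    calc c * binomCoeff s n / (((n : ℝ) + 1) ^ (s - 1) * ((t : ℝ) + 1) ^ (s - 1))
        ≤ c * binomCoeff s n / ((n + t : ℕ) : ℝ) ^ (s - 1) := by
          gcongr
      _ ≤ ((n + t : ℕ) : ℝ) ^ t * (b (n + t) + γ) / ((n + t : ℕ) : ℝ) ^ (s - 1) := by
          gcongr
      _ = _ := by
          rw [hsplit]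
          field_simp

theorem isLeadingCoeff_leadingCoeff : IsLeadingCoeff hm rule (leadingCoeff hm rule) where
  tendsto _ hz := leadingCoeff_tendsto hm rule hz
  analytic := leadingCoeff_analytic hm rule
  positive _ hx hxD := leadingCoeff_pos hm rule hx hxD

end leading

/-! ### Laplace's method -/

theorem le_exp_half (v : ℝ) : v ≤ Real.exp (v / 2) := by
  by_cases hv : 0 ≤ v
  · have := Real.quadratic_le_exp_of_nonneg (show 0 ≤ v / 2 by linarith)
    nlinarith [sq_nonneg (v / 2 - 1)]
  · have := Real.exp_pos (v / 2)
    linarith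

theorem abs_mul_exp_le {b : ℝ} (hb : 0 < b) (φ : ℝ) :
    |φ| * Real.exp (-(b / 2 * φ ^ 2)) ≤ (√b)⁻¹ * Real.exp (-(b / 4) * φ ^ 2) := by
  have h1 : √b * |φ| ≤ Real.exp (b / 4 * φ ^ 2) := by
    refine abs_le_of_sq_le_sq' ?_ (Real.exp_pos _).le |>.2
    rw [mul_pow, Real.sq_sqrt hb.le, sq_abs, ← Real.exp_nat_mul]
    refine (le_exp_half _).trans (le_of_eq ?_)
    congr 1; push_cast; ring
  have h2 : Real.exp (-(b / 2 * φ ^ 2)) =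
      Real.exp (-(b / 4) * φ ^ 2) * (Real.exp (b / 4 * φ ^ 2))⁻¹ := by
    rw [← Real.exp_neg, ← Real.exp_add]; congr 1; ring
  have hs : 0 < √b := Real.sqrt_pos.2 hb
  rw [h2, inv_mul_eq_div, le_div_iff₀ hs]
  have h3 : Real.exp (b / 4 * φ ^ 2) * (Real.exp (b / 4 * φ ^ 2))⁻¹ = 1 :=
    mul_inv_cancel₀ (Real.exp_pos _).ne'
  have h4 : 0 < (Real.exp (b / 4 * φ ^ 2))⁻¹ := inv_pos.2 (Real.exp_pos _)
  have h5 := mul_le_mul_of_nonneg_right h1 h4.le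
  rw [h3] at h5
  have h6 := Real.exp_pos (-(b / 4) * φ ^ 2)
  nlinarith [mul_le_mul_of_nonneg_left h5 h6.le]

theorem norm_exp_sub_one_le_mul (w : ℂ) : ‖Complex.exp w - 1‖ ≤ ‖w‖ * Real.exp ‖w‖ := by
  simpa using Complex.norm_exp_sub_sum_le_norm_mul_exp w 1

/-- The pointwise estimate in Laplace's method. -/
theorem saddle_pointwise {C c₀ φ₀ : ℝ} (hC : 0 ≤ C) (hc₀ : 0 < c₀)
    (hsmall : C * φ₀ ≤ c₀ / 4) {L σ φ : ℝ} (hL : 0 < L) (hσ : c₀ ≤ σ) {e₀ e ψ : ℂ}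
    (he₀ : ‖e₀‖ ≤ C) (hφ : |φ| ≤ φ₀) (hψ : ‖ψ + σ * φ ^ 2 / 2‖ ≤ C * |φ| ^ 3)
    (he : ‖e - e₀‖ ≤ C * |φ|) :
    ‖Complex.exp (L * ψ)‖ ≤ 1 ∧
    ‖e * Complex.exp (L * ψ) - e₀ * (Real.exp (-(L * σ / 2) * φ ^ 2) : ℝ)‖ ≤
      (C + 4 * C ^ 2 / c₀) * (|φ| * Real.exp (-(L * c₀ / 4 / 2 * φ ^ 2))) := by
  set w : ℂ := L * (ψ + σ * φ ^ 2 / 2) with hw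
  have hwn : ‖w‖ ≤ L * (C * |φ| ^ 3) := by
    rw [hw, norm_mul, Complex.norm_real, Real.norm_eq_abs, abs_of_pos hL]
    gcongr
  have hφ3 : C * |φ| ^ 3 ≤ c₀ / 4 * φ ^ 2 := by
    have : C * |φ| ≤ c₀ / 4 := (mul_le_mul_of_nonneg_left hφ hC).trans hsmall
    calc C * |φ| ^ 3 = C * |φ| * |φ| ^ 2 := by ring
      _ ≤ c₀ / 4 * |φ| ^ 2 := by gcongr
      _ = _ := by rw [sq_abs]
  have hwn2 : ‖w‖ ≤ L * (c₀ / 4 * φ ^ 2) := hwn.trans (by gcongr)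
  have hexp : Complex.exp (L * ψ) = (Real.exp (-(L * σ / 2) * φ ^ 2) : ℝ) * Complex.exp w := by
    rw [Complex.ofReal_exp, ← Complex.exp_add]; congr 1; rw [hw]; push_cast; ring
  have hg : Real.exp (-(L * σ / 2) * φ ^ 2) ≤ Real.exp (-(L * c₀ / 2 * φ ^ 2)) := by
    rw [Real.exp_le_exp]
    have : L * c₀ / 2 * φ ^ 2 ≤ L * σ / 2 * φ ^ 2 := by gcongr
    linarith
  -- The cubic remainder `w` costs at most half of the exponent `L c₀ φ² / 2`, by the smallness of
  -- `φ₀`.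
  have hgw : Real.exp (-(L * σ / 2) * φ ^ 2) * Real.exp ‖w‖ ≤ Real.exp (-(L * c₀ / 4 * φ ^ 2)) := by
    calc _ ≤ Real.exp (-(L * c₀ / 2 * φ ^ 2)) * Real.exp (L * (c₀ / 4 * φ ^ 2)) := by gcongr
      _ = _ := by rw [← Real.exp_add]; congr 1; ring
  have hnorm : ‖Complex.exp (L * ψ)‖ ≤ Real.exp (-(L * c₀ / 4 * φ ^ 2)) := by
    rw [hexp, norm_mul, Complex.norm_real, Real.norm_eq_abs, abs_of_pos (Real.exp_pos _)]
    refine le_trans ?_ hgw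
    gcongr
    exact Complex.norm_exp_le_exp_norm w
  refine ⟨hnorm.trans (Real.exp_le_one_iff.2 (by have : 0 ≤ L * c₀ / 4 * φ ^ 2 := by positivity
                                                 linarith)), ?_⟩
  have hdiff : ‖Complex.exp (L * ψ) - (Real.exp (-(L * σ / 2) * φ ^ 2) : ℝ)‖ ≤
      L * (C * |φ| ^ 3) * Real.exp (-(L * c₀ / 4 * φ ^ 2)) := by
    have : Complex.exp (L * ψ) - (Real.exp (-(L * σ / 2) * φ ^ 2) : ℝ) =
        (Real.exp (-(L * σ / 2) * φ ^ 2) : ℝ) * (Complex.exp w - 1) := by rw [hexp]; ring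
    rw [this, norm_mul, Complex.norm_real, Real.norm_eq_abs, abs_of_pos (Real.exp_pos _)]
    calc _ ≤ Real.exp (-(L * σ / 2) * φ ^ 2) * (‖w‖ * Real.exp ‖w‖) := by
          gcongr
          exact norm_exp_sub_one_le_mul w
      _ = ‖w‖ * (Real.exp (-(L * σ / 2) * φ ^ 2) * Real.exp ‖w‖) := by ring
      _ ≤ _ := by gcongr
  have hid : e * Complex.exp (L * ψ) - e₀ * (Real.exp (-(L * σ / 2) * φ ^ 2) : ℝ) =
      (e - e₀) * Complex.exp (L * ψ) +
        e₀ * (Complex.exp (L * ψ) - (Real.exp (-(L * σ / 2) * φ ^ 2) : ℝ)) := by ring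
  set v : ℝ := L * c₀ / 4 * φ ^ 2 with hv
  have hv0 : 0 ≤ v := by positivity
  have hhalf : Real.exp (-v) ≤ Real.exp (-(L * c₀ / 4 / 2 * φ ^ 2)) := by
    rw [Real.exp_le_exp]
    have : L * c₀ / 4 / 2 * φ ^ 2 = v / 2 := by rw [hv]; ring
    linarith
  -- The cubic error `L |φ|³` is `|φ|` times a multiple of `v`; the factor `v` is paid for with half
  -- of the decay.
  have hvexp : v * Real.exp (-v) ≤ Real.exp (-(L * c₀ / 4 / 2 * φ ^ 2)) := by
    have h1 : L * c₀ / 4 / 2 * φ ^ 2 = v / 2 := by rw [hv]; ring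
    rw [h1]
    calc v * Real.exp (-v) ≤ Real.exp (v / 2) * Real.exp (-v) := by
          gcongr; exact le_exp_half v
      _ = _ := by rw [← Real.exp_add]; congr 1; ring
  rw [hid]
  calc _ ≤ C * |φ| * Real.exp (-v) + C * (L * (C * |φ| ^ 3) * Real.exp (-v)) := by
        refine (norm_add_le _ _).trans ?_
        rw [norm_mul, norm_mul]
        gcongr
    _ = C * (|φ| * Real.exp (-v)) + 4 * C ^ 2 / c₀ * (|φ| * (v * Real.exp (-v))) := by
        have : L * (C * |φ| ^ 3) = 4 * C / c₀ * (|φ| * v) := by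
          rw [hv, ← sq_abs φ]; field_simp
        rw [this]; ring
    _ ≤ C * (|φ| * Real.exp (-(L * c₀ / 4 / 2 * φ ^ 2))) +
        4 * C ^ 2 / c₀ * (|φ| * Real.exp (-(L * c₀ / 4 / 2 * φ ^ 2))) := by gcongr
    _ = _ := by ring

/-- Laplace's method with uniform error terms. -/
theorem saddle_integral {C c₀ φ₀ : ℝ} (hC : 0 ≤ C) (hc₀ : 0 < c₀) (hφ₀ : 0 < φ₀)
    (hsmall : C * φ₀ ≤ c₀ / 4) : ∃ K, 0 ≤ K ∧ ∀ (L σ : ℝ) (e₀ : ℂ) (e ψ : ℝ → ℂ), 0 < L → c₀ ≤ σ →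
      ‖e₀‖ ≤ C → ContinuousOn e (Set.Icc (-φ₀) φ₀) → ContinuousOn ψ (Set.Icc (-φ₀) φ₀) →
      (∀ φ, |φ| ≤ φ₀ → ‖ψ φ + σ * φ ^ 2 / 2‖ ≤ C * |φ| ^ 3) →
      (∀ φ, |φ| ≤ φ₀ → ‖e φ - e₀‖ ≤ C * |φ|) →
      ‖(∫ φ in (-φ₀)..φ₀, e φ * Complex.exp (L * ψ φ)) - e₀ * (√(2 * Real.pi / (σ * L)) : ℝ)‖ ≤
        K / L := by
  set K₁ : ℝ := C + 4 * C ^ 2 / c₀ + C / φ₀ with hK₁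
  have hK₁0 : 0 ≤ K₁ := by positivity
  refine ⟨K₁ * (8 * √Real.pi / c₀), by positivity,
    fun L σ e₀ e ψ hL hσ he₀ hec hψc hψ he => ?_⟩
  have hσ0 : 0 < σ := hc₀.trans_le hσ
  set b : ℝ := L * c₀ / 4 with hb
  have hb0 : 0 < b := by positivity
  -- Extended by zero, the integrand is compared with the full Gaussian `g` on the whole line.
  set f : ℝ → ℂ := Set.indicator (Set.Ioc (-φ₀) φ₀) fun φ => e φ * Complex.exp (L * ψ φ) with hf
  set g : ℝ → ℂ := fun φ => e₀ * (Real.exp (-(L * σ / 2) * φ ^ 2) : ℝ) with hg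
  have hfi : Integrable f := by
    rw [hf, integrable_indicator_iff measurableSet_Ioc]
    have : ContinuousOn (fun φ => e φ * Complex.exp (L * ψ φ)) (Set.Icc (-φ₀) φ₀) :=
      hec.mul (Complex.continuous_exp.comp_continuousOn (continuousOn_const.mul hψc))
    exact this.integrableOn_Icc.mono_set Set.Ioc_subset_Icc_self
  have hgi : Integrable g :=
    ((integrable_exp_neg_mul_sq (by positivity)).ofReal).const_mul e₀
  have hgint : ∫ φ, g φ = e₀ * (√(2 * Real.pi / (σ * L)) : ℝ) := by
    rw [hg, integral_const_mul, integral_complex_ofReal, integral_gaussian]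
    congr 3
    field_simp
  have hfint : ∫ φ in (-φ₀)..φ₀, e φ * Complex.exp (L * ψ φ) = ∫ φ, f φ := by
    rw [intervalIntegral.integral_of_le (by linarith), hf, integral_indicator measurableSet_Ioc]
  rw [hfint, ← hgint, ← integral_sub hfi hgi]
  have hbound : ∀ φ, ‖f φ - g φ‖ ≤ K₁ * (√b)⁻¹ * Real.exp (-(b / 4) * φ ^ 2) := by
    intro φ
    have key : ‖f φ - g φ‖ ≤ K₁ * (|φ| * Real.exp (-(b / 2 * φ ^ 2))) := by
      by_cases hmem : φ ∈ Set.Ioc (-φ₀) φ₀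
      · have hφ : |φ| ≤ φ₀ := abs_le.2 ⟨hmem.1.le, hmem.2⟩
        rw [hf, Set.indicator_of_mem hmem]
        refine ((saddle_pointwise hC hc₀ hsmall hL hσ he₀ hφ (hψ φ hφ) (he φ hφ)).2).trans ?_
        rw [← hb]
        gcongr
        rw [hK₁]
        have : 0 ≤ C / φ₀ := by positivity
        linarith
      · have hφ : φ₀ ≤ |φ| := by
          by_contra! hcon
          exact hmem ⟨(abs_lt.1 hcon).1, (abs_lt.1 hcon).2.le⟩
        rw [hf, Set.indicator_of_notMem hmem, zero_sub, norm_neg, hg, norm_mul, Complex.norm_real,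
          Real.norm_eq_abs, abs_of_pos (Real.exp_pos _)]
        have h1 : Real.exp (-(L * σ / 2) * φ ^ 2) ≤ Real.exp (-(b / 2 * φ ^ 2)) := by
          rw [Real.exp_le_exp]
          have h2 : L * c₀ * φ ^ 2 ≤ L * σ * φ ^ 2 := by gcongr
          have h3 : 0 ≤ L * c₀ * φ ^ 2 := by positivity
          have h4 : b / 2 * φ ^ 2 = L * c₀ * φ ^ 2 / 8 := by rw [hb]; ring
          have h5 : L * σ / 2 * φ ^ 2 = L * σ * φ ^ 2 / 2 := by ring
          linarith
        -- Outside the interval `|φ| ≥ φ₀`, so the Gaussian tail has the same bound with a factor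
        -- `|φ|`. This is the reason for `C / φ₀` in `K₁`.
        have h6 : C ≤ K₁ * |φ| := by
          have : C = C / φ₀ * φ₀ := by field_simp
          calc C = C / φ₀ * φ₀ := this
            _ ≤ K₁ * |φ| := by
              gcongr
              rw [hK₁]
              have : 0 ≤ C + 4 * C ^ 2 / c₀ := by positivity
              linarith
        calc _ ≤ C * Real.exp (-(b / 2 * φ ^ 2)) := by gcongr
          _ ≤ K₁ * |φ| * Real.exp (-(b / 2 * φ ^ 2)) := by gcongr
          _ = _ := by ring
    refine key.trans ?_
    rw [mul_assoc]
    exact mul_le_mul_of_nonneg_left (abs_mul_exp_le hb0 φ) hK₁0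
  have hhi : Integrable fun φ : ℝ => K₁ * (√b)⁻¹ * Real.exp (-(b / 4) * φ ^ 2) :=
    (integrable_exp_neg_mul_sq (by positivity)).const_mul _
  refine (norm_integral_le_of_norm_le hhi (Eventually.of_forall hbound)).trans (le_of_eq ?_)
  -- The factor `|φ|` has become `(√b)⁻¹`, and the Gaussian integral gives another `(√b)⁻¹`:
  -- together `1/b`, of order `1/L`.
  rw [integral_const_mul, integral_gaussian]
  have h1 : √(Real.pi / (b / 4)) = 2 * √Real.pi / √b := by
    rw [show Real.pi / (b / 4) = 2 ^ 2 * Real.pi / b by field_simp; norm_num, Real.sqrt_div (by positivity),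
      Real.sqrt_mul (by positivity), Real.sqrt_sq (by norm_num)]
  rw [h1]
  have h2 : √b * √b = b := Real.mul_self_sqrt hb0.le
  have hs : 0 < √b := Real.sqrt_pos.2 hb0
  calc K₁ * (√b)⁻¹ * (2 * √Real.pi / √b) = K₁ * (2 * √Real.pi) / (√b * √b) := by field_simp
    _ = _ := by rw [h2, hb]; field_simp; ring

/-! ### Taylor estimates, the coefficient integral and compactness -/

/-- Uniform Taylor estimates on a compact set for an analytic function. -/
theorem taylor_bound {U K : Set ℂ} (hU : IsOpen U) (hK : IsCompact K) (hKU : K ⊆ U) {f : ℂ → ℂ}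
    (hf : DifferentiableOn ℂ f U) : ∃ r C : ℝ, 0 < r ∧ 0 ≤ C ∧ ∀ w ∈ K, ∀ h : ℂ, ‖h‖ ≤ r →
      w + h ∈ U ∧ ‖f (w + h) - f w‖ ≤ C * ‖h‖ ∧
      ‖f (w + h) - f w - deriv f w * h - deriv (deriv f) w * h ^ 2 / 2‖ ≤ C * ‖h‖ ^ 3 := by
  obtain ⟨r, hr, hrU⟩ := hK.exists_cthickening_subset_open hU hKU
  have hd1 : DifferentiableOn ℂ (deriv f) U := hf.deriv hU
  have hd2 : DifferentiableOn ℂ (deriv (deriv f)) U := hd1.deriv hU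
  have hd3 : DifferentiableOn ℂ (deriv (deriv (deriv f))) U := hd2.deriv hU
  have hcpt : IsCompact (Metric.cthickening r K) := hK.cthickening
  obtain ⟨C₁, hC₁⟩ := hcpt.exists_bound_of_continuousOn (hd1.continuousOn.mono hrU)
  obtain ⟨C₃, hC₃⟩ := hcpt.exists_bound_of_continuousOn (hd3.continuousOn.mono hrU)
  refine ⟨r, max 0 (max C₁ C₃), hr, le_max_left _ _, fun w hw h hh => ?_⟩
  set C := max 0 (max C₁ C₃) with hC
  have hC0 : 0 ≤ C := le_max_left _ _
  have hmem : ∀ u ∈ Metric.closedBall w ‖h‖, u ∈ Metric.cthickening r K := fun u hu =>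
    Metric.closedBall_subset_cthickening hw r (Metric.closedBall_subset_closedBall hh hu)
  have hB1 : ∀ u ∈ Metric.closedBall w ‖h‖, ‖deriv f u‖ ≤ C := fun u hu =>
    (hC₁ u (hmem u hu)).trans ((le_max_left _ _).trans (le_max_right _ _))
  have hB3 : ∀ u ∈ Metric.closedBall w ‖h‖, ‖deriv (deriv (deriv f)) u‖ ≤ C := fun u hu =>
    (hC₃ u (hmem u hu)).trans ((le_max_right _ _).trans (le_max_right _ _))
  have hder : ∀ g : ℂ → ℂ, DifferentiableOn ℂ g U → ∀ u ∈ Metric.closedBall w ‖h‖,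
      HasDerivAt g (deriv g u) u := fun g hg u hu =>
    (hg.differentiableAt (hU.mem_nhds (hrU (hmem u hu)))).hasDerivAt
  have hconv := convex_closedBall w ‖h‖
  have hw0 : w ∈ Metric.closedBall w ‖h‖ := Metric.mem_closedBall_self (norm_nonneg _)
  have hwh : w + h ∈ Metric.closedBall w ‖h‖ := by simp [Metric.mem_closedBall, dist_eq_norm]
  have hdist : ∀ u ∈ Metric.closedBall w ‖h‖, ‖u - w‖ ≤ ‖h‖ := fun u hu => by
    rwa [Metric.mem_closedBall, dist_eq_norm] at hu
  -- The bound for the third derivative is integrated three times by the mean value inequality on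
  -- the ball.
  have e2 : ∀ u ∈ Metric.closedBall w ‖h‖, ‖deriv (deriv f) u - deriv (deriv f) w‖ ≤ C * ‖h‖ := by
    intro u hu
    have := hconv.norm_image_sub_le_of_norm_hasDerivWithin_le
      (fun v hv => (hder _ hd2 v hv).hasDerivWithinAt) hB3 hw0 hu
    exact this.trans (mul_le_mul_of_nonneg_left (hdist u hu) hC0)
  have e1 : ∀ u ∈ Metric.closedBall w ‖h‖,
      ‖deriv f u - deriv f w - deriv (deriv f) w * (u - w)‖ ≤ C * ‖h‖ ^ 2 := by
    intro u hu
    have := hconv.norm_image_sub_le_of_norm_hasDerivWithin_le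
      (f := fun v => deriv f v - deriv (deriv f) w * (v - w))
      (f' := fun v => deriv (deriv f) v - deriv (deriv f) w) (fun v hv => by
        have := (hder _ hd1 v hv).sub (((hasDerivAt_id v).sub_const w).const_mul (deriv (deriv f) w))
        simp only [mul_one] at this
        exact this.hasDerivWithinAt) e2 hw0 hu
    rw [sub_self, mul_zero, sub_zero] at this
    rw [sub_right_comm]
    refine this.trans ?_
    calc _ ≤ C * ‖h‖ * ‖h‖ := mul_le_mul_of_nonneg_left (hdist u hu) (by positivity)
      _ = _ := by ring
  have e0 := hconv.norm_image_sub_le_of_norm_hasDerivWithin_le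
      (f := fun v => f v - deriv f w * (v - w) - deriv (deriv f) w * (v - w) ^ 2 / 2)
      (f' := fun v => deriv f v - deriv f w - deriv (deriv f) w * (v - w)) (fun v hv => by
        have h1 := ((hder _ hf v hv).sub (((hasDerivAt_id v).sub_const w).const_mul (deriv f w))).sub
          (((((hasDerivAt_id v).sub_const w).pow 2).const_mul (deriv (deriv f) w)).div_const 2)
        refine (h1.congr_deriv ?_).hasDerivWithinAt
        simp; ring) e1 hw0 hwh
  refine ⟨hrU (hmem _ hwh), ?_, ?_⟩
  · have := hconv.norm_image_sub_le_of_norm_hasDerivWithin_le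
      (fun v hv => (hder _ hf v hv).hasDerivWithinAt) hB1 hw0 hwh
    rwa [add_sub_cancel_left] at this
  · simp only [sub_self, add_sub_cancel_left] at e0
    refine le_trans (le_of_eq ?_) (e0.trans (le_of_eq (by ring)))
    congr 1; ring

theorem deriv_eq_of_real {f : ℂ → ℂ} {g : ℝ → ℝ} {f' : ℂ} {g' x : ℝ} (hf : HasDerivAt f f' x)
    (hg : HasDerivAt g g' x) (h : ∀ᶠ y : ℝ in 𝓝 x, f y = g y) : f' = g' := by
  have h1 := hf.comp_ofReal
  have h2 : HasDerivAt (fun y : ℝ => f y) (g' : ℂ) x := hg.ofReal_comp.congr_of_eventuallyEq h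
  exact h1.unique h2

theorem integral_exp_int (l : ℤ) : ∫ φ in (-Real.pi)..Real.pi, Complex.exp (l * Complex.I * φ) =
    if l = 0 then (2 * Real.pi : ℂ) else 0 := by
  split_ifs with h
  · subst h
    simp
    ring
  · have hc : (l : ℂ) * Complex.I ≠ 0 := mul_ne_zero (by exact_mod_cast h) Complex.I_ne_zero
    rw [integral_exp_mul_complex hc]
    have : Complex.exp (l * Complex.I * (Real.pi : ℝ)) = Complex.exp (l * Complex.I * ((-Real.pi : ℝ) : ℝ)) := by
      rw [Complex.exp_eq_exp_iff_exists_int]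
      exact ⟨l, by push_cast; ring⟩
    rw [this, sub_self, zero_div]

/-- The coefficient formula for polynomials, on a circle about the origin. -/
theorem coeff_integral (c : ℕ → ℝ) (n k : ℕ) (hk : k < n) (r : ℝ) :
    ∫ φ in (-Real.pi)..Real.pi, (∑ j ∈ Finset.range n, (c j : ℂ) *
      (r * Complex.exp (Complex.I * φ)) ^ j) * Complex.exp (-(k * Complex.I * φ)) =
      2 * Real.pi * (c k * r ^ k : ℝ) := by
  have : ∀ φ : ℝ, (∑ j ∈ Finset.range n, (c j : ℂ) * (r * Complex.exp (Complex.I * φ)) ^ j) *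
      Complex.exp (-(k * Complex.I * φ)) = ∑ j ∈ Finset.range n, (c j * r ^ j : ℝ) *
        Complex.exp (((j : ℤ) - k : ℤ) * Complex.I * φ) := by
    intro φ
    rw [Finset.sum_mul]
    refine Finset.sum_congr rfl fun j _ => ?_
    rw [mul_pow, ← Complex.exp_nat_mul, mul_assoc, mul_assoc, ← Complex.exp_add]
    have : (j : ℂ) * (Complex.I * φ) + -(k * Complex.I * φ) =
        (((j : ℤ) - k : ℤ) : ℂ) * Complex.I * φ := by push_cast; ring
    rw [this]
    push_cast
    ring
  simp only [this]
  rw [intervalIntegral.integral_finsetSum]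
  · simp only [intervalIntegral.integral_const_mul, integral_exp_int]
    rw [Finset.sum_eq_single_of_mem k (Finset.mem_range.2 hk)]
    · simp; ring
    · intro j _ hj
      rw [if_neg (by omega), mul_zero]
  · intro j _
    exact Continuous.intervalIntegrable (by fun_prop) _ _

/-- Local power bounds are uniform on compact sets. -/
theorem uniform_of_local {X : Type*} [TopologicalSpace X] {K : Set X} (hK : IsCompact K)
    {f : ℕ → X → ℝ} {N : ℕ} (hN : 1 ≤ N)
    (h : ∀ x ∈ K, ∃ δ C : ℝ, 0 < δ ∧ 0 ≤ C ∧ ∀ᶠ y in 𝓝 x, ∀ n : ℕ, N ≤ n →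
      f n y ≤ C * (n : ℝ) ^ (-δ)) :
    ∃ δ C : ℝ, 0 < δ ∧ 0 ≤ C ∧ ∀ y ∈ K, ∀ n : ℕ, N ≤ n → f n y ≤ C * (n : ℝ) ^ (-δ) := by
  refine hK.induction_on (p := fun S => ∃ δ C : ℝ, 0 < δ ∧ 0 ≤ C ∧ ∀ y ∈ S, ∀ n : ℕ, N ≤ n →
    f n y ≤ C * (n : ℝ) ^ (-δ)) ⟨1, 0, one_pos, le_rfl, by simp⟩ ?_ ?_ ?_
  · rintro S T hST ⟨δ, C, hδ, hC, hb⟩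
    exact ⟨δ, C, hδ, hC, fun y hy => hb y (hST hy)⟩
  · rintro S T ⟨δ, C, hδ, hC, hb⟩ ⟨δ', C', hδ', hC', hb'⟩
    refine ⟨min δ δ', max C C', lt_min hδ hδ', hC.trans (le_max_left _ _), fun y hy n hn => ?_⟩
    have hn1 : (1 : ℝ) ≤ n := by exact_mod_cast hN.trans hn
    rcases hy with hy | hy
    · refine (hb y hy n hn).trans (mul_le_mul (le_max_left _ _) ?_ (by positivity) (by positivity))
      exact Real.rpow_le_rpow_of_exponent_le hn1 (neg_le_neg (min_le_left _ _))
    · refine (hb' y hy n hn).trans (mul_le_mul (le_max_right _ _) ?_ (by positivity)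
        (hC.trans (le_max_left _ _)))
      exact Real.rpow_le_rpow_of_exponent_le hn1 (neg_le_neg (min_le_right _ _))
  · intro x hx
    obtain ⟨δ, C, hδ, hC, hb⟩ := h x hx
    exact ⟨_, mem_nhdsWithin_of_mem_nhds hb, δ, C, hδ, hC, fun y hy => hy⟩

/-- Power savings are needed only in logarithmic strength. -/
theorem rpow_neg_le {δ : ℝ} (hδ : 0 < δ) {n : ℕ} (hn : 2 ≤ n) :
    (n : ℝ) ^ (-δ) ≤ 1 / δ / Real.log n := by
  have hn0 : (0 : ℝ) < n := by positivity
  have hL : 0 < Real.log n := Real.log_pos (by exact_mod_cast hn)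
  rw [Real.rpow_neg hn0.le, div_div, ← one_div]
  refine one_div_le_one_div_of_le (by positivity) ?_
  rw [Real.rpow_def_of_pos hn0]
  linarith [Real.add_one_le_exp (Real.log n * δ)]

/-! ### The saddle point estimate for the mean profile -/

section profile

variable {m t : ℕ} (hm : 2 ≤ m) (rule : SupplementaryRule m t)
include hm

theorem continuousOn_lambdaReal : ContinuousOn (lambdaReal m t) (Set.Ioi 0) := fun _ hx =>
  (hasDerivAt_lambdaReal hm t hx).continuousAt.continuousWithinAt

theorem continuousOn_varOf : ContinuousOn (varOf m t) (Set.Ioi 0) := by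
  have h1 : ∀ x ∈ Set.Ioi (0 : ℝ), -t < lambdaReal m t x := fun x hx => (lambdaReal_spec hm t hx).1
  have hlam := continuousOn_lambdaReal hm (t := t)
  have hlog : ContinuousOn (fun x => logDerivF m t (lambdaReal m t x)) (Set.Ioi 0) := fun x hx =>
    (hasDerivAt_logDerivF (m := m) t (h1 x hx)).continuousAt.comp_continuousWithinAt (hlam x hx)
  unfold varOf squareSum
  refine ContinuousOn.div (continuousOn_finsetSum _ fun i _ => ?_) (hlog.pow 3) fun x hx =>
    (pow_pos (logDerivF_pos hm t (h1 x hx)) 3).ne'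
  refine continuousOn_const.div (((hlam.add_const _).add_const _).pow 2) fun x hx => ?_
  have := h1 x hx
  have : (0 : ℝ) ≤ i := Nat.cast_nonneg i
  exact (pow_pos (by linarith) 2).ne'

/-- Away from the positive half-line, the mean profile polynomials are of smaller order. -/
theorem mean_bound_far {b₁ b₂ φ₀ : ℝ} (hb : 0 < b₁) (h1 : 1 < lambdaReal m t b₁) (hφ₀ : 0 < φ₀) :
    ∃ δ C : ℝ, 0 < δ ∧ 0 ≤ C ∧ ∀ b ∈ Set.Icc b₁ b₂, ∀ φ : ℝ, φ₀ ≤ |φ| → |φ| ≤ Real.pi →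
      ∀ n : ℕ, max t 1 ≤ n → ‖expProfilePoly hm rule n (b * Complex.exp (Complex.I * φ))‖ /
        (n : ℝ) ^ (lambdaReal m t b - 1) ≤ C * (n : ℝ) ^ (-δ) := by
  have hK : IsCompact (Set.Icc b₁ b₂ ×ˢ {φ : ℝ | φ₀ ≤ |φ| ∧ |φ| ≤ Real.pi}) := by
    refine isCompact_Icc.prod ((isCompact_Icc (a := -Real.pi) (b := Real.pi)).of_isClosed_subset ?_
      fun φ hφ => abs_le.1 hφ.2)
    exact (isClosed_le continuous_const continuous_abs).inter
      (isClosed_le continuous_abs continuous_const)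
  suffices hloc : ∀ p ∈ Set.Icc b₁ b₂ ×ˢ {φ : ℝ | φ₀ ≤ |φ| ∧ |φ| ≤ Real.pi},
      ∃ δ C : ℝ, 0 < δ ∧ 0 ≤ C ∧ ∀ᶠ q : ℝ × ℝ in 𝓝 p, ∀ n : ℕ, max t 1 ≤ n →
        ‖expProfilePoly hm rule n (q.1 * Complex.exp (Complex.I * q.2))‖ /
          (n : ℝ) ^ (lambdaReal m t q.1 - 1) ≤ C * (n : ℝ) ^ (-δ) by
    obtain ⟨δ, C, hδ, hC, h⟩ := uniform_of_local hK (le_max_right _ _) hloc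
    exact ⟨δ, C, hδ, hC, fun b hb φ h1 h2 => h (b, φ) ⟨hb, h1, h2⟩⟩
  rintro ⟨b, φ⟩ ⟨hbm, hφ, hφπ⟩
  replace hbm : b₁ ≤ b := hbm.1
  have hb0 : 0 < b := hb.trans_le hbm
  have hlb : 1 < lambdaReal m t b := by
    rcases hbm.eq_or_lt with h | h
    · exact h ▸ h1
    · exact h1.trans (lambdaReal_lt hm t hb h)
  dsimp only at hφ hφπ
  set z₀ : ℂ := b * Complex.exp (Complex.I * φ) with hz₀
  have hnorm : ‖z₀‖ = b := by
    rw [hz₀, norm_mul, mul_comm Complex.I, Complex.norm_exp_ofReal_mul_I, mul_one,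
      Complex.norm_real, Real.norm_of_nonneg hb0.le]
  have hne : z₀ ≠ b := by
    intro h
    have h2 : Complex.exp (Complex.I * φ) = 1 :=
      mul_left_cancel₀ (Complex.ofReal_ne_zero.2 hb0.ne') (h.trans (mul_one _).symm)
    have h3 : Real.cos φ = 1 := by
      have := congrArg Complex.re h2
      rwa [mul_comm, Complex.exp_ofReal_mul_I_re, Complex.one_re] at this
    have hφ' := abs_le.1 hφπ
    have hpi := Real.pi_pos
    have := (Real.cos_eq_one_iff_of_lt_of_lt (by linarith) (by linarith)).1 h3
    rw [this, abs_zero] at hφ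
    linarith
  have hzm : z₀ * m ≠ 1 := by
    intro h
    have h2 := congrArg norm h
    rw [norm_mul, hnorm, Complex.norm_natCast, norm_one] at h2
    exact (one_lt_mul_of_one_lt_lambdaReal hm t hb0 hlb).ne' h2
  have hlt := re_lambdaOne_lt hm t hb0 hnorm.le hne
  set μ := max 1 (lambdaOne m t z₀).re with hμ
  have hμl : μ < lambdaReal m t b := max_lt hlb hlt
  have hμ1 : 1 ≤ μ := le_max_left _ _
  -- The gap between `μ` and `λ₁(b)` is cut into thirds: one for the bound on the mean, one for the
  -- variation of `λ₁` in `b`, and one remains as `δ`.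
  obtain ⟨C, hC, hev⟩ := mean_bound_near hm rule hzm (κ := (2 * μ + lambdaReal m t b) / 3)
    (by linarith) (lt_of_le_of_lt (le_max_right 1 _) (by linarith))
  refine ⟨(lambdaReal m t b - μ) / 3, C, by linarith, hC, ?_⟩
  have hc1 : ContinuousAt (fun p : ℝ × ℝ => (p.1 : ℂ) * Complex.exp (Complex.I * p.2)) (b, φ) := by
    fun_prop
  have hc2 : ContinuousAt (fun p : ℝ × ℝ => lambdaReal m t p.1) (b, φ) :=
    (hasDerivAt_lambdaReal hm t hb0).continuousAt.comp'
      (f := Prod.fst) (x := (b, φ)) continuousAt_fst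
  filter_upwards [hc1.eventually hev, hc2.eventually (lt_mem_nhds
    (show (μ + 2 * lambdaReal m t b) / 3 < lambdaReal m t b by linarith))] with p hp1 hp2 n hn
  have hn1 : (1 : ℝ) ≤ n := by exact_mod_cast (le_max_right _ _).trans hn
  have hn0 : (0 : ℝ) < n := by linarith
  rw [div_le_iff₀ (by positivity)]
  refine (hp1 n hn).trans ?_
  rw [mul_assoc, ← Real.rpow_add hn0]
  refine mul_le_mul_of_nonneg_left (Real.rpow_le_rpow_of_exponent_le hn1 ?_) hC
  linarith

/-- In the variable `w = log z` the angle on the circle is an imaginary increment. The operator `z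
d/dz` applied once and twice to `λ₁` gives the saddle point equation and the variance. -/
theorem deriv_lambdaOne_exp {x : ℝ} (hx : (Real.exp x : ℂ) ∈ D m t 1) :
    deriv (fun w => lambdaOne m t (Complex.exp w)) x = alphaOf m t (Real.exp x) ∧
    deriv (deriv fun w => lambdaOne m t (Complex.exp w)) x = varOf m t (Real.exp x) := by
  set G : ℂ → ℂ := fun w => lambdaOne m t (Complex.exp w) with hG
  set Ω : Set ℂ := Complex.exp ⁻¹' D m t 1 with hΩ
  have hΩo : IsOpen Ω := (isOpen_D hm t 1).preimage Complex.continuous_exp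
  have hGd : DifferentiableOn ℂ G Ω := fun w hw =>
    ((analyticOnNhd_lambdaOne hm t 1 _ hw).differentiableAt.comp w
      Complex.differentiableAt_exp).differentiableWithinAt
  have hev : ∀ {y : ℝ}, (y : ℂ) ∈ Ω → deriv G y = alphaOf m t (Real.exp y) := by
    intro y hy
    have h1 := (hGd.differentiableAt (hΩo.mem_nhds hy)).hasDerivAt
    have h2 := (hasDerivAt_lambdaReal hm t (Real.exp_pos y)).comp y (Real.hasDerivAt_exp y)
    rw [div_mul_cancel₀ _ (Real.exp_pos y).ne'] at h2
    refine deriv_eq_of_real h1 h2 (Eventually.of_forall fun s => ?_)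
    rw [hG]
    simp only [Function.comp, ← Complex.ofReal_exp]
    exact (lambdaReal_spec hm t (Real.exp_pos s)).2.2
  have hxΩ : (x : ℂ) ∈ Ω := by rwa [hΩ, Set.mem_preimage, ← Complex.ofReal_exp]
  refine ⟨hev hxΩ, ?_⟩
  have h1 := ((hGd.deriv hΩo).differentiableAt (hΩo.mem_nhds hxΩ)).hasDerivAt
  have h2 := (hasDerivAt_alphaOf hm t (Real.exp_pos x)).comp x (Real.hasDerivAt_exp x)
  rw [div_mul_cancel₀ _ (Real.exp_pos x).ne'] at h2
  refine deriv_eq_of_real h1 h2 ?_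
  filter_upwards [Complex.continuous_ofReal.continuousAt.eventually (hΩo.mem_nhds hxΩ)] with y hy
  exact hev hy

/-- The local expansions that enter the saddle point method, uniformly on compact sets. -/
theorem exists_local_expansion {b₁ b₂ : ℝ} (hb : 0 < b₁) (hb₂ : b₁ ≤ b₂)
    (h1 : 1 < lambdaReal m t b₁) : ∃ φ₀ C c₀ : ℝ, 0 < φ₀ ∧ φ₀ ≤ Real.pi ∧ 0 ≤ C ∧ 0 < c₀ ∧
      C * φ₀ ≤ c₀ / 4 ∧ ∀ b ∈ Set.Icc b₁ b₂, c₀ ≤ varOf m t b ∧ ‖leadingCoeff hm rule b‖ ≤ C ∧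
        ∀ φ : ℝ, |φ| ≤ φ₀ → b * Complex.exp (Complex.I * φ) ∈ D m t 1 ∧
          ‖leadingCoeff hm rule (b * Complex.exp (Complex.I * φ)) - leadingCoeff hm rule b‖ ≤
            C * |φ| ∧
          ‖lambdaOne m t (b * Complex.exp (Complex.I * φ)) - lambdaReal m t b -
            alphaOf m t b * Complex.I * φ + varOf m t b * φ ^ 2 / 2‖ ≤ C * |φ| ^ 3 := by
  have hpos : ∀ b ∈ Set.Icc b₁ b₂, 0 < b := fun b h => hb.trans_le h.1
  have hmem : ∀ b ∈ Set.Icc b₁ b₂, (b : ℂ) ∈ D m t 1 := fun b h => by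
    refine ofReal_mem_D hm t (hpos b h) ?_
    rcases h.1.eq_or_lt with h | h
    · exact h ▸ h1
    · exact h1.trans (lambdaReal_lt hm t hb h)
  set Ω : Set ℂ := Complex.exp ⁻¹' D m t 1 with hΩ
  have hΩo : IsOpen Ω := (isOpen_D hm t 1).preimage Complex.continuous_exp
  set K : Set ℂ := (fun b : ℝ => (Real.log b : ℂ)) '' Set.Icc b₁ b₂ with hK
  have hKc : IsCompact K := by
    refine isCompact_Icc.image_of_continuousOn (Complex.continuous_ofReal.comp_continuousOn ?_)
    exact Real.continuousOn_log.mono fun b h => (hpos b h).ne'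
  have hexp : ∀ b ∈ Set.Icc b₁ b₂, Complex.exp (Real.log b : ℂ) = b := fun b h => by
    rw [← Complex.ofReal_exp, Real.exp_log (hpos b h)]
  have hKΩ : K ⊆ Ω := by
    rintro _ ⟨b, hbm, rfl⟩
    simp only [hΩ, Set.mem_preimage, hexp b hbm]
    exact hmem b hbm
  have hdiff : ∀ f : ℂ → ℂ, AnalyticOnNhd ℂ f (D m t 1) →
      DifferentiableOn ℂ (fun w => f (Complex.exp w)) Ω := fun f hf w hw =>
    ((hf _ hw).differentiableAt.comp w Complex.differentiableAt_exp).differentiableWithinAt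
  obtain ⟨r₁, C₁, hr₁, hC₁, hT₁⟩ := taylor_bound hΩo hKc hKΩ
    (hdiff _ (analyticOnNhd_lambdaOne hm t 1))
  obtain ⟨r₂, C₂, hr₂, hC₂, hT₂⟩ := taylor_bound hΩo hKc hKΩ
    (hdiff _ (leadingCoeff_analytic hm rule))
  obtain ⟨b₀, hb₀, hmin⟩ := isCompact_Icc.exists_isMinOn (Set.nonempty_Icc.2 hb₂)
    ((continuousOn_varOf hm (t := t)).mono hpos)
  have hcont : ContinuousOn (fun b : ℝ => leadingCoeff hm rule b) (Set.Icc b₁ b₂) :=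
    (leadingCoeff_analytic hm rule).continuousOn.comp Complex.continuous_ofReal.continuousOn hmem
  obtain ⟨C₃, hC₃⟩ := isCompact_Icc.exists_bound_of_continuousOn hcont
  set C := max (max C₁ C₂) C₃ with hCdef
  have hc1 : C₁ ≤ C := (le_max_left _ _).trans (le_max_left _ _)
  have hc2 : C₂ ≤ C := (le_max_right _ _).trans (le_max_left _ _)
  have hC0 : 0 ≤ C := hC₁.trans hc1
  have hc₀ : 0 < varOf m t b₀ := varOf_pos hm t (hpos _ hb₀)
  set c₀ := varOf m t b₀ with hc₀def
  -- The angle stays within both Taylor radii and within the circle. The last bound gives `C φ₀ ≤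
  -- c₀/4`, with `C+1` to avoid division by zero.
  refine ⟨min (min r₁ r₂) (min Real.pi (c₀ / (4 * (C + 1)))), C, c₀,
    lt_min (lt_min hr₁ hr₂) (lt_min Real.pi_pos (by positivity)),
    (min_le_right _ _).trans (min_le_left _ _), hC0, hc₀, ?_, fun b hbm =>
      ⟨hmin hbm, (hC₃ b hbm).trans (le_max_right _ _), fun φ hφ => ?_⟩⟩
  · calc _ ≤ (C + 1) * (c₀ / (4 * (C + 1))) := by
          refine mul_le_mul (by linarith) ((min_le_right _ _).trans (min_le_right _ _))
            (le_min (le_min hr₁.le hr₂.le) (le_min Real.pi_pos.le (by positivity))) (by linarith)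
      _ = c₀ / 4 := by field_simp
  · have hn : ‖Complex.I * φ‖ = |φ| := by simp
    have hbK : (Real.log b : ℂ) ∈ K := ⟨b, hbm, rfl⟩
    obtain ⟨-, -, hA⟩ := hT₁ _ hbK (Complex.I * φ)
      (hn.le.trans (hφ.trans ((min_le_left _ _).trans (min_le_left _ _))))
    obtain ⟨hB1, hB2, -⟩ := hT₂ _ hbK (Complex.I * φ)
      (hn.le.trans (hφ.trans ((min_le_left _ _).trans (min_le_right _ _))))
    have hD : (Real.exp (Real.log b) : ℂ) ∈ D m t 1 := by
      rw [Real.exp_log (hpos b hbm)]; exact hmem b hbm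
    obtain ⟨hd1, hd2⟩ := deriv_lambdaOne_exp hm hD
    rw [hd1, hd2, Real.exp_log (hpos b hbm)] at hA
    simp only [hΩ, Set.mem_preimage] at hB1
    rw [Complex.exp_add, hexp b hbm] at hA hB1 hB2
    rw [hn] at hA hB2
    refine ⟨hB1, hB2.trans (by gcongr), le_trans (le_of_eq ?_) (hA.trans (by gcongr))⟩
    rw [(lambdaReal_spec hm t (hpos b hbm)).2.2]
    congr 1
    rw [mul_pow, Complex.I_sq]
    ring

theorem leadingCoeff_uniform {K : Set ℂ} (hK : IsCompact K) (hKD : K ⊆ D m t 1) :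
    ∃ δ C : ℝ, 0 < δ ∧ 0 ≤ C ∧ ∀ z ∈ K, ∀ n : ℕ, max t 1 ≤ n →
      ‖expProfilePoly hm rule n z / (n : ℂ) ^ (lambdaOne m t z - 1) - leadingCoeff hm rule z‖ ≤
        C * (n : ℝ) ^ (-δ) :=
  uniform_of_local hK (le_max_right _ _) fun _ hz => leadingCoeff_near hm rule (hKD hz)

/-- Cauchy's integral for the mean profile, evaluated by the saddle point method. -/
theorem saddle_estimate {b₁ b₂ : ℝ} (hb : 0 < b₁) (hb₂ : b₁ ≤ b₂) (h1 : 1 < lambdaReal m t b₁) :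
    ∃ K : ℝ, 0 ≤ K ∧ ∀ n : ℕ, max t 2 ≤ n → ∀ k : ℕ, ∀ b ∈ Set.Icc b₁ b₂,
      alphaOf m t b * Real.log n = k →
      |2 * Real.pi * (expProfile hm rule n k * b ^ k / (n : ℝ) ^ (lambdaReal m t b - 1)) -
        (leadingCoeff hm rule b).re * √(2 * Real.pi / (varOf m t b * Real.log n))| ≤
          K / Real.log n := by
  obtain ⟨φ₀, C, c₀, hφ₀, hφπ, hC, hc₀, hsmall, hloc⟩ :=
    exists_local_expansion hm rule hb hb₂ h1
  obtain ⟨K₀, hK₀, hsad⟩ := saddle_integral hC hc₀ hφ₀ hsmall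
  have hKc : IsCompact ((fun p : ℝ × ℝ => (p.1 : ℂ) * Complex.exp (Complex.I * p.2)) ''
      (Set.Icc b₁ b₂ ×ˢ Set.Icc (-φ₀) φ₀)) :=
    (isCompact_Icc.prod isCompact_Icc).image (by fun_prop)
  obtain ⟨δ₁, C₁, hδ₁, hC₁, hnear⟩ := leadingCoeff_uniform hm rule hKc (by
    rintro _ ⟨⟨b, φ⟩, ⟨hb, hφ⟩, rfl⟩
    exact ((hloc b hb).2.2 φ (abs_le.2 hφ)).1)
  obtain ⟨δ₂, C₂, hδ₂, hC₂, hfar⟩ := mean_bound_far hm rule (b₂ := b₂) hb h1 hφ₀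
  have hpi := Real.pi_pos
  refine ⟨K₀ + 2 * Real.pi * (C₁ / δ₁) + 2 * Real.pi * (C₂ / δ₂), by positivity,
    fun n hn k b hbm hk => ?_⟩
  have hn2 : 2 ≤ n := (le_max_right _ _).trans hn
  have hnt : max t 1 ≤ n := max_le ((le_max_left _ _).trans hn) (by omega)
  have hn0 : (0 : ℝ) < n := by positivity
  have hnC : (n : ℂ) ≠ 0 := by exact_mod_cast hn0.ne'
  have hL : 0 < Real.log n := Real.log_pos (by exact_mod_cast hn2)
  have hb0 : 0 < b := hb.trans_le hbm.1
  obtain ⟨hvar, hE, hloc⟩ := hloc b hbm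
  set L := Real.log n with hLdef
  set lam := lambdaReal m t b with hlam
  have hexpL : ∀ w : ℂ, (n : ℂ) ^ w = Complex.exp (L * w) := fun w => by
    rw [Complex.cpow_def_of_ne_zero hnC, ← Complex.natCast_log]
  set z : ℝ → ℂ := fun φ => b * Complex.exp (Complex.I * φ) with hz
  have hzc : Continuous z := by fun_prop
  set a : ℝ → ℂ := fun φ => expProfilePoly hm rule n (z φ) * Complex.exp (-(k * Complex.I * φ)) /
    ((n : ℝ) ^ (lam - 1) : ℝ) with ha
  have hac : Continuous a := by
    refine Continuous.div_const (Continuous.mul ?_ (by fun_prop)) _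
    exact (continuous_expProfilePoly hm rule n).comp hzc
  have hnorm_phase : ∀ φ : ℝ, ‖Complex.exp (-(k * Complex.I * φ))‖ = 1 := fun φ => by
    have : -(k * Complex.I * φ) = ((-(k * φ) : ℝ) : ℂ) * Complex.I := by push_cast; ring
    rw [this, Complex.norm_exp_ofReal_mul_I]
  -- the whole integral
  have hint : ∫ φ in (-Real.pi)..Real.pi, a φ =
      ((2 * Real.pi * (expProfile hm rule n k * b ^ k / (n : ℝ) ^ (lam - 1)) : ℝ) : ℂ) := by
    -- The polynomial is padded to more than `k` terms so that the formula also covers `k ≥ n`.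
    have h := coeff_integral (expProfile hm rule n) (max n (k + 1)) k
      (lt_of_lt_of_le (Nat.lt_succ_self k) (le_max_right _ _)) b
    simp only [ha, intervalIntegral.integral_div, hz,
      expProfilePoly_eq_sum_of_le hm rule (le_max_left n (k + 1))]
    rw [h]
    push_cast
    ring
  -- the outer parts
  have hout : ∀ φ : ℝ, φ₀ ≤ |φ| → |φ| ≤ Real.pi → ‖a φ‖ ≤ C₂ / δ₂ / L := by
    intro φ h1 h2
    have h3 := hfar b hbm φ h1 h2 n hnt
    rw [ha]
    simp only [norm_div, norm_mul, hnorm_phase, mul_one, Complex.norm_real]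
    rw [Real.norm_of_nonneg (by positivity)]
    refine h3.trans ((mul_le_mul_of_nonneg_left (rpow_neg_le hδ₂ hn2) hC₂).trans (le_of_eq ?_))
    ring
  have hI₁ : ‖∫ φ in (-Real.pi)..(-φ₀), a φ‖ ≤ C₂ / δ₂ / L * Real.pi := by
    refine (intervalIntegral.norm_integral_le_of_norm_le_const (C := C₂ / δ₂ / L)
      fun φ hφ => ?_).trans ?_
    · rw [Set.uIoc_of_le (by linarith)] at hφ
      have : |φ| = -φ := abs_of_neg (by linarith [hφ.2])
      exact hout φ (by linarith [hφ.2]) (by linarith [hφ.1])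
    · refine mul_le_mul_of_nonneg_left ?_ (by positivity)
      rw [abs_of_nonneg (by linarith)]; linarith
  have hI₃ : ‖∫ φ in φ₀..Real.pi, a φ‖ ≤ C₂ / δ₂ / L * Real.pi := by
    refine (intervalIntegral.norm_integral_le_of_norm_le_const (C := C₂ / δ₂ / L)
      fun φ hφ => ?_).trans ?_
    · rw [Set.uIoc_of_le (by linarith)] at hφ
      have : |φ| = φ := abs_of_pos (by linarith [hφ.1])
      exact hout φ (by linarith [hφ.1]) (by linarith [hφ.2])
    · refine mul_le_mul_of_nonneg_left ?_ (by positivity)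
      rw [abs_of_nonneg (by linarith)]; linarith
  -- the central part
  set ψ : ℝ → ℂ := fun φ => lambdaOne m t (z φ) - lam - alphaOf m t b * Complex.I * φ with hψ
  set e : ℝ → ℂ := fun φ => leadingCoeff hm rule (z φ) with he
  have hψb : ∀ φ : ℝ, |φ| ≤ φ₀ → ‖ψ φ + varOf m t b * φ ^ 2 / 2‖ ≤ C * |φ| ^ 3 :=
    fun φ hφ => (hloc φ hφ).2.2
  have heb : ∀ φ : ℝ, |φ| ≤ φ₀ → ‖e φ - leadingCoeff hm rule b‖ ≤ C * |φ| :=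
    fun φ hφ => (hloc φ hφ).2.1
  have hzD : Set.MapsTo z (Set.Icc (-φ₀) φ₀) (D m t 1) := fun φ hφ => (hloc φ (abs_le.2 hφ)).1
  have hec : ContinuousOn e (Set.Icc (-φ₀) φ₀) :=
    (leadingCoeff_analytic hm rule).continuousOn.comp hzc.continuousOn hzD
  have hψc : ContinuousOn ψ (Set.Icc (-φ₀) φ₀) := by
    refine ContinuousOn.sub (ContinuousOn.sub ?_ continuousOn_const) (by fun_prop)
    exact (analyticOnNhd_lambdaOne hm t 1).continuousOn.comp hzc.continuousOn hzD
  have hmain := hsad L (varOf m t b) (leadingCoeff hm rule b) e ψ hL hvar hE hec hψc hψb heb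
  -- On the central arc the mean is replaced by its leading term.
  have hmid : ∀ φ : ℝ, |φ| ≤ φ₀ → ‖a φ - e φ * Complex.exp (L * ψ φ)‖ ≤ C₁ / δ₁ / L := by
    intro φ hφ
    have h1 := hnear (z φ) ⟨(b, φ), ⟨hbm, abs_le.1 hφ⟩, rfl⟩ n hnt
    have h2 := (saddle_pointwise hC hc₀ hsmall hL hvar hE hφ (hψb φ hφ) (heb φ hφ)).1
    have h3 : a φ = expProfilePoly hm rule n (z φ) / (n : ℂ) ^ (lambdaOne m t (z φ) - 1) *
        Complex.exp (L * ψ φ) := by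
      have h4 : Complex.exp (L * ψ φ) = Complex.exp (L * (lambdaOne m t (z φ) - 1)) *
          Complex.exp (-(k * Complex.I * φ)) / Complex.exp (L * (lam - 1)) := by
        rw [← Complex.exp_add, ← Complex.exp_sub]
        congr 1
        -- The saddle point equation: the phase `kφ` is the linear term `α L φ` that `ψ` subtracts.
        have : (k : ℂ) = alphaOf m t b * L := by exact_mod_cast hk.symm
        rw [this, hψ]
        ring
      have h5 : (((n : ℝ) ^ (lam - 1) : ℝ) : ℂ) = Complex.exp (L * (lam - 1)) := by
        rw [Complex.ofReal_cpow hn0.le]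
        push_cast
        exact hexpL _
      rw [h4, hexpL, ha, h5]
      have h6 := Complex.exp_ne_zero (L * (lambdaOne m t (z φ) - 1))
      have h7 := Complex.exp_ne_zero (L * (lam - 1))
      field_simp
    rw [h3, ← sub_mul, norm_mul]
    calc _ ≤ C₁ * (n : ℝ) ^ (-δ₁) * 1 := mul_le_mul h1 h2 (norm_nonneg _) (by positivity)
      _ ≤ C₁ * (1 / δ₁ / L) := by
        rw [mul_one]; exact mul_le_mul_of_nonneg_left (rpow_neg_le hδ₁ hn2) hC₁
      _ = _ := by ring
  have hprodc : ContinuousOn (fun φ => e φ * Complex.exp (L * ψ φ)) (Set.Icc (-φ₀) φ₀) :=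
    hec.mul (Complex.continuous_exp.comp_continuousOn (continuousOn_const.mul hψc))
  have hle : -φ₀ ≤ φ₀ := by linarith
  have hI₂ : ‖(∫ φ in (-φ₀)..φ₀, a φ) - ∫ φ in (-φ₀)..φ₀, e φ * Complex.exp (L * ψ φ)‖ ≤
      C₁ / δ₁ / L * (2 * Real.pi) := by
    rw [← intervalIntegral.integral_sub (hac.intervalIntegrable _ _)
      ((Set.uIcc_of_le hle ▸ hprodc).intervalIntegrable)]
    refine (intervalIntegral.norm_integral_le_of_norm_le_const (C := C₁ / δ₁ / L)
      fun φ hφ => ?_).trans ?_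
    · rw [Set.uIoc_of_le hle] at hφ
      exact hmid φ (abs_le.2 ⟨hφ.1.le, hφ.2⟩)
    · refine mul_le_mul_of_nonneg_left ?_ (by positivity)
      rw [abs_of_nonneg (by linarith)]; linarith
  have hsplit : ∫ φ in (-Real.pi)..Real.pi, a φ = (∫ φ in (-Real.pi)..(-φ₀), a φ) +
      (∫ φ in (-φ₀)..φ₀, a φ) + ∫ φ in φ₀..Real.pi, a φ := by
    rw [intervalIntegral.integral_add_adjacent_intervals (hac.intervalIntegrable _ _)
      (hac.intervalIntegrable _ _), intervalIntegral.integral_add_adjacent_intervals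
      (hac.intervalIntegrable _ _) (hac.intervalIntegrable _ _)]
  have hEre : leadingCoeff hm rule b = ((leadingCoeff hm rule b).re : ℂ) := by
    have hbD : (b : ℂ) ∈ D m t 1 := by
      simpa [hz] using hzD (show (0 : ℝ) ∈ Set.Icc (-φ₀) φ₀ from ⟨by linarith, hφ₀.le⟩)
    exact Complex.ext rfl (leadingCoeff_pos hm rule hb0 hbD).1
  rw [hEre] at hmain
  rw [← Real.norm_eq_abs, ← Complex.norm_real, Complex.ofReal_sub, ← hint, hsplit,
    Complex.ofReal_mul]
  set I₁ := ∫ φ in (-Real.pi)..(-φ₀), a φ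
  set I₂ := ∫ φ in (-φ₀)..φ₀, a φ
  set I₃ := ∫ φ in φ₀..Real.pi, a φ
  set J := ∫ φ in (-φ₀)..φ₀, e φ * Complex.exp (L * ψ φ)
  set M : ℂ := ((leadingCoeff hm rule b).re : ℂ) * (√(2 * Real.pi / (varOf m t b * L)) : ℝ)
  calc ‖I₁ + I₂ + I₃ - M‖ = ‖I₁ + (I₂ - J) + (J - M) + I₃‖ := by congr 1; ring
    _ ≤ ‖I₁‖ + ‖I₂ - J‖ + ‖J - M‖ + ‖I₃‖ := norm_add₄_le
    _ ≤ C₂ / δ₂ / L * Real.pi + C₁ / δ₁ / L * (2 * Real.pi) + K₀ / L + C₂ / δ₂ / L * Real.pi := by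
      gcongr
    _ = _ := by ring

/-- Since `α = k / log n`, the factor `n^(-α log β)` is `β^(-k)`, the form produced by the Cauchy
integral. -/
theorem mainTerm_eq {n k : ℕ} (hn : 2 ≤ n) (h : alphaZero m t < k / Real.log n) (E : ℂ → ℂ) :
    mainTerm m t E n k = (E (beta m t (k / Real.log n))).re *
      ((n : ℝ) ^ (lambdaReal m t (beta m t (k / Real.log n)) - 1) /
        beta m t (k / Real.log n) ^ k) /
      √(2 * Real.pi * varOf m t (beta m t (k / Real.log n)) * Real.log n) := by
  have hn0 : (0 : ℝ) < n := by positivity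
  have hL : 0 < Real.log n := Real.log_pos (by exact_mod_cast hn)
  obtain ⟨h1, h2⟩ := beta_spec hm t ((alphaZero_pos hm t).trans h)
  unfold mainTerm
  simp only
  have h3 := varOf_eq hm t h1
  rw [h2] at h3
  rw [h3]
  set b := beta m t (k / Real.log n)
  congr 2
  rw [show lambdaReal m t b - k / Real.log n * Real.log b - 1 =
    (lambdaReal m t b - 1) - k / Real.log n * Real.log b by ring, Real.rpow_sub hn0]
  congr 1
  rw [Real.rpow_def_of_pos hn0, ← mul_assoc, mul_div_cancel₀ _ hL.ne', ← Real.rpow_natCast,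
    Real.rpow_def_of_pos h1, mul_comm]

theorem mainTerm_pos {n k : ℕ} (hn : 2 ≤ n) (h : alphaZero m t < k / Real.log n) :
    0 < mainTerm m t (leadingCoeff hm rule) n k := by
  have hn0 : (0 : ℝ) < n := by positivity
  have hL : 0 < Real.log n := Real.log_pos (by exact_mod_cast hn)
  have hb := (beta_spec hm t ((alphaZero_pos hm t).trans h)).1
  have hE := (leadingCoeff_pos hm rule hb (beta_mem_D hm t h)).2
  have hv := varOf_pos hm t hb
  rw [mainTerm_eq hm hn h]
  have := Real.pi_pos
  positivity

/-- By monotonicity `β` stays in the compact interval `[β(α₁), β(α₂)]`, where `E` is bounded below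
and the variance above. This makes the absolute error of `saddle_estimate` a relative one. -/
theorem expProfile_asymptotic_of_large {α₁ α₂ : ℝ} (hα₁ : alphaZero m t < α₁) (hα : α₁ < α₂) :
    ∃ C : ℝ, 0 ≤ C ∧ ∀ n k : ℕ, max t 2 ≤ n →
      α₁ ≤ (k : ℝ) / Real.log n → (k : ℝ) / Real.log n ≤ α₂ →
      |expProfile hm rule n k - mainTerm m t (leadingCoeff hm rule) n k| ≤
        C * (Real.log n) ^ (-(1 / 2) : ℝ) * mainTerm m t (leadingCoeff hm rule) n k := by
  have hα0 := (alphaZero_pos hm t).trans hα₁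
  set b₁ := beta m t α₁ with hb₁
  set b₂ := beta m t α₂ with hb₂
  have hb0 : 0 < b₁ := (beta_spec hm t hα0).1
  have hle : b₁ ≤ b₂ := beta_le hm t hα0 hα.le
  have hlam : 1 < lambdaReal m t b₁ := one_lt_lambdaReal_beta hm t hα₁
  have hpos : ∀ b ∈ Set.Icc b₁ b₂, 0 < b := fun b h => hb0.trans_le h.1
  have hmem : ∀ b ∈ Set.Icc b₁ b₂, (b : ℂ) ∈ D m t 1 := fun b h => by
    refine ofReal_mem_D hm t (hpos b h) ?_
    rcases h.1.eq_or_lt with h | h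
    · exact h ▸ hlam
    · exact hlam.trans (lambdaReal_lt hm t hb0 h)
  obtain ⟨K, hK, hest⟩ := saddle_estimate hm rule hb0 hle hlam
  obtain ⟨c, hc, hmax⟩ := isCompact_Icc.exists_isMaxOn (Set.nonempty_Icc.2 hle)
    ((continuousOn_varOf hm (t := t)).mono hpos)
  have hcontE : ContinuousOn (fun b : ℝ => (leadingCoeff hm rule b).re) (Set.Icc b₁ b₂) :=
    Complex.continuous_re.comp_continuousOn
      ((leadingCoeff_analytic hm rule).continuousOn.comp Complex.continuous_ofReal.continuousOn hmem)
  obtain ⟨d, hd, hmin⟩ := isCompact_Icc.exists_isMinOn (Set.nonempty_Icc.2 hle) hcontE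
  have hEd := (leadingCoeff_pos hm rule (hpos d hd) (hmem d hd)).2
  have hvc := varOf_pos hm t (hpos c hc)
  set e₁ := (leadingCoeff hm rule d).re with he₁
  set v := varOf m t c with hv
  have hpi := Real.pi_pos
  refine ⟨K / (2 * Real.pi) * (√(2 * Real.pi * v) / e₁), by positivity, fun n k hn h1 h2 => ?_⟩
  have hn2 : 2 ≤ n := (le_max_right _ _).trans hn
  have hn0 : (0 : ℝ) < n := by positivity
  have hL : 0 < Real.log n := Real.log_pos (by exact_mod_cast hn2)
  have hα' := hα0.trans_le h1
  rw [mainTerm_eq hm hn2 (hα₁.trans_le h1)]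
  obtain ⟨h3, h4⟩ := beta_spec hm t hα'
  have hbm : beta m t (k / Real.log n) ∈ Set.Icc b₁ b₂ :=
    ⟨beta_le hm t hα0 h1, beta_le hm t hα' h2⟩
  set b := beta m t (k / Real.log n) with hb
  have hest := hest n hn k b hbm (by rw [h4]; field_simp)
  have hEb : e₁ ≤ (leadingCoeff hm rule b).re := hmin hbm
  have hvb : varOf m t b ≤ v := hmax hbm
  have hvb0 : 0 < varOf m t b := varOf_pos hm t h3
  set E := (leadingCoeff hm rule b).re
  set w := varOf m t b
  set L := Real.log n
  set q := (n : ℝ) ^ (lambdaReal m t b - 1) / b ^ k with hq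
  have hq0 : 0 < q := by positivity
  have hS : 0 < √(2 * Real.pi * w * L) := Real.sqrt_pos.2 (by positivity)
  have hsq : √(2 * Real.pi / (w * L)) = 2 * Real.pi / √(2 * Real.pi * w * L) := by
    rw [eq_div_iff hS.ne', ← Real.sqrt_mul (by positivity)]
    rw [show 2 * Real.pi / (w * L) * (2 * Real.pi * w * L) = (2 * Real.pi) ^ 2 by field_simp,
      Real.sqrt_sq (by positivity)]
  have hfac : 2 * Real.pi * (expProfile hm rule n k * b ^ k / (n : ℝ) ^ (lambdaReal m t b - 1)) -
      E * √(2 * Real.pi / (w * L)) = 2 * Real.pi / q *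
        (expProfile hm rule n k - E * q / √(2 * Real.pi * w * L)) := by
    rw [hsq, mul_sub]
    congr 1
    · rw [hq]; field_simp
    · field_simp
  rw [hfac, abs_mul, abs_of_pos (by positivity : 0 < 2 * Real.pi / q)] at hest
  have hestq : |expProfile hm rule n k - E * q / √(2 * Real.pi * w * L)| ≤
      K / (2 * Real.pi) * (q / L) := by
    have := mul_le_mul_of_nonneg_left hest (by positivity : 0 ≤ q / (2 * Real.pi))
    calc _ = q / (2 * Real.pi) * (2 * Real.pi / q *
          |expProfile hm rule n k - E * q / √(2 * Real.pi * w * L)|) := by field_simp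
      _ ≤ _ := this
      _ = _ := by field_simp
  refine hestq.trans ?_
  rw [mul_assoc, mul_assoc]
  refine mul_le_mul_of_nonneg_left ?_ (by positivity)
  have hsl : √L * √L = L := Real.mul_self_sqrt hL.le
  have hsl0 : 0 < √L := Real.sqrt_pos.2 hL
  rw [Real.rpow_neg hL.le, ← Real.sqrt_eq_rpow]
  have hsle : √(2 * Real.pi * w * L) ≤ √(2 * Real.pi * v) * √L := by
    rw [← Real.sqrt_mul (by positivity)]
    exact Real.sqrt_le_sqrt (by gcongr)
  have hv0 : 0 < √(2 * Real.pi * v) := Real.sqrt_pos.2 (by positivity)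
  calc q / L = √(2 * Real.pi * v) / e₁ * ((√L)⁻¹ * (e₁ * q / (√(2 * Real.pi * v) * √L))) := by
        rw [← show q / (√L * √L) = q / L by rw [hsl]]; field_simp
    _ ≤ √(2 * Real.pi * v) / e₁ * ((√L)⁻¹ * (E * q / √(2 * Real.pi * w * L))) := by
      have : 0 ≤ E * q := mul_nonneg (hEd.le.trans hEb) hq0.le
      gcongr

theorem expProfile_asymptotic {α₁ α₂ : ℝ} (hα₁ : alphaZero m t < α₁) (hα : α₁ < α₂) :
    ∃ C : ℝ, ∀ n k : ℕ, 2 ≤ n →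
      α₁ ≤ (k : ℝ) / Real.log n → (k : ℝ) / Real.log n ≤ α₂ →
      |expProfile hm rule n k - mainTerm m t (leadingCoeff hm rule) n k| ≤
        C * (Real.log n) ^ (-(1 / 2) : ℝ) * mainTerm m t (leadingCoeff hm rule) n k := by
  obtain ⟨C, hC, hlarge⟩ := expProfile_asymptotic_of_large hm rule hα₁ hα
  -- For `n < max t 2` only finitely many `k` satisfy `k ≤ α₂ log n`. The main term is positive at
  -- the admissible pairs, so adding all the error ratios to the constant covers them.
  obtain ⟨M, hM⟩ := exists_nat_gt (α₂ * Real.log (max t 2 : ℕ))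
  have hα₂ : 0 < α₂ := ((alphaZero_pos hm t).trans hα₁).trans hα
  set ratio : ℕ × ℕ → ℝ := fun p =>
    |(expProfile hm rule p.1 p.2 - mainTerm m t (leadingCoeff hm rule) p.1 p.2) /
      ((Real.log p.1) ^ (-(1 / 2) : ℝ) * mainTerm m t (leadingCoeff hm rule) p.1 p.2)| with hratio
  set S := ∑ p ∈ Finset.range (max t 2) ×ˢ Finset.range M, ratio p with hS
  have hS0 : 0 ≤ S := Finset.sum_nonneg fun _ _ => abs_nonneg _
  refine ⟨C + S, fun n k hn h1 h2 => ?_⟩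
  have hL : 0 < Real.log n := Real.log_pos (by exact_mod_cast hn)
  have hpos := mainTerm_pos hm rule hn (hα₁.trans_le h1)
  rw [mul_assoc]
  have hX : 0 < (Real.log n) ^ (-(1 / 2) : ℝ) * mainTerm m t (leadingCoeff hm rule) n k := by
    positivity
  rcases le_or_gt (max t 2) n with hnt | hnt
  · refine (hlarge n k hnt h1 h2).trans ?_
    rw [mul_assoc]
    exact mul_le_mul_of_nonneg_right (by linarith) hX.le
  · have hkM : k < M := by
      rw [div_le_iff₀ hL] at h2
      have h3 : Real.log n ≤ Real.log (max t 2 : ℕ) :=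
        Real.log_le_log (by positivity) (by exact_mod_cast hnt.le)
      have : (k : ℝ) < M := (h2.trans (mul_le_mul_of_nonneg_left h3 hα₂.le)).trans_lt hM
      exact_mod_cast this
    have hle : ratio (n, k) ≤ S := Finset.single_le_sum (f := ratio) (fun _ _ => abs_nonneg _)
      (Finset.mem_product.2 ⟨Finset.mem_range.2 hnt, Finset.mem_range.2 hkM⟩)
    rw [hratio] at hle
    simp only [abs_div, abs_of_pos hX] at hle
    rw [div_le_iff₀ hX] at hle
    exact hle.trans (mul_le_mul_of_nonneg_right (by linarith) hX.le)

end profile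

end SearchTree

end

theorem lemma8p3 {m t : ℕ} (hm : 2 ≤ m) (rule : SearchTree.SupplementaryRule m t) :
    (∀ α : ℝ, 0 < α → ∃! β : ℝ, SearchTree.IsBeta m t α β) ∧
    (∀ α : ℝ, SearchTree.alphaZero m t < α →
      ((SearchTree.beta m t α : ℝ) : ℂ) ∈ SearchTree.D m t 1) ∧
    ∃ E : ℂ → ℂ, SearchTree.IsLeadingCoeff hm rule E ∧
      ∀ α₁ α₂ : ℝ, SearchTree.alphaZero m t < α₁ → α₁ < α₂ →
        ∃ C : ℝ, ∀ n k : ℕ, 2 ≤ n →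
          α₁ ≤ (k : ℝ) / Real.log n → (k : ℝ) / Real.log n ≤ α₂ →
          |SearchTree.expProfile hm rule n k - SearchTree.mainTerm m t E n k| ≤
            C * (Real.log n) ^ (-(1 / 2) : ℝ) * SearchTree.mainTerm m t E n k :=
  ⟨fun _ hα => SearchTree.existsUnique_isBeta hm t hα, fun _ hα => SearchTree.beta_mem_D hm t hα,
    SearchTree.leadingCoeff hm rule, SearchTree.isLeadingCoeff_leadingCoeff hm rule,
    fun _ _ hα₁ hα => SearchTree.expProfile_asymptotic hm rule hα₁ hα⟩
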